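/- For vectors $w_1,\dots,w_d\in\mathbb{Z}^n$, a matrix $A\in\mathbb{Z}^{m\times n}$, a vector $b\in\mathbb{Z}^m$ and a convex function $c:\mathbb{R}^d\to\mathbb{R}$, consider the convex integer program $$\max\{c(w_1x,\dots,w_dx)\ :\ Ax=b,\ x\in\mathbb{N}^n\}.\qquad(*)$$ A *linear integer programming oracle* for $A,b$ is one that, queried on $h\in\mathbb{Z}^n$, either returns an optimal solution of $\max\{hx: Ax=b,\ x\in\mathbb{N}^n\}$, or asserts that this program is infeasible, or asserts that its objective is unbounded. A *comparison oracle* for $c$, queried on $x,y\in\mathbb{R}^d$, tells whether or not $c(x)\le c(y)$. A *direction* of an edge ($1$-face) $e$ of a polyhedron $P$ is a nonzero scalar multiple of $u-v$ with $u,v$ two distinct points of $e$; a set of vectors *covers all edge-directions* of $P$ if it contains a direction of each edge of $P$. To *solve* $(*)$ means either to return an optimal solution $x\in\mathbb{N}^n$, or to assert correctly that $(*)$ is infeasible, or to assert correctly that the polyhedron $\{x\in\mathbb{R}^n: x\ge 0,\ Ax=b\}$ is unbounded. **Lemma.** For every fixed positive integer $d$ there is a strongly polynomial oracle-time algorithm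 that, given any $m\ge 0$ and $n\geq 1$, vectors $w_1,\dots,w_d\in\mathbb{Z}^n$, a matrix $A\in\mathbb{Z}^{m\times n}$ and a vector $b\in\mathbb{Z}^m$ endowed with a linear integer programming oracle, a finite list $E$ of vectors in $\mathbb{Z}^n$ covering all edge-directions of $\mathrm{conv}\{x\in\mathbb{N}^n: Ax=b\}$, and a convex function $c:\mathbb{R}^d\to\mathbb{R}$ presented by a comparison oracle, solves $(*)$. Here an algorithm is a program of a random access machine with integer registers and arrays that computes with $+,-,\cdot$, comparisons, memory accesses and calls to the two oracles. *Strongly polynomial oracle-time* means that there are polynomials $T$ and $S$, depending only on $d$, such that, with $L$ the number of bits in the binary representation of the entries of $w_1,\dots,w_d,A,b,E$ (one sign bit included for each entry): 1. the number of operations and oracle calls is at most $T(m+n+|E|)$, where $|E|$ is the length of the list; 2. every entry of a query to the linear integer programming oracle has at most $S(L)$ bits; 3. every number that is written into memory during the run, the oracle replies included, has at most $S(L+R)$ bits, where $R$ is the largest number of bits of an entry of a solution returned by the linear integer programming oracle during the run; 4. if the polyhedron $\{x\in\mathbb{R}^n: x\ge 0,\ Ax=b\}$ is bounded, every such number has at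 most $S(L)$ bits. -/

import Mathlib

namespace ConvIntMax

/-! ## The geometry of the problem -/

/-- The feasible set `{x ∈ ℕⁿ : A x = b}`. -/
def feasible {m n : ℕ} (A : Matrix (Fin m) (Fin n) ℤ) (b : Fin m → ℤ) : Set (Fin n → ℕ) :=
  {x | A.mulVec (fun j => (x j : ℤ)) = b}

/-- The polyhedron `{x ∈ ℝⁿ : x ≥ 0, A x = b}`. -/
def polyhedron {m n : ℕ} (A : Matrix (Fin m) (Fin n) ℤ) (b : Fin m → ℤ) : Set (Fin n → ℝ) :=
  {x | 0 ≤ x ∧ (A.map (fun a : ℤ => (a : ℝ))).mulVec x = fun i => (b i : ℝ)}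

/-- The integer hull `conv {x ∈ ℕⁿ : A x = b}` in `ℝⁿ`. -/
def integerHull {m n : ℕ} (A : Matrix (Fin m) (Fin n) ℤ) (b : Fin m → ℤ) : Set (Fin n → ℝ) :=
  convexHull ℝ ((fun (x : Fin n → ℕ) (j : Fin n) => (x j : ℝ)) '' feasible A b)

/-- `F` is an edge (a one-dimensional face) of `P`. A face is the set of maximizers over `P` of a
linear functional. -/
def IsEdge {n : ℕ} (P F : Set (Fin n → ℝ)) : Prop :=
  IsExposed ℝ P F ∧ Module.finrank ℝ (vectorSpan ℝ F) = 1

/-- `e` is a direction of the edge `F`: a nonzero multiple of the difference of two distinct points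
of `F`. -/
def IsDirection {n : ℕ} (F : Set (Fin n → ℝ)) (e : Fin n → ℝ) : Prop :=
  ∃ u ∈ F, ∃ v ∈ F, u ≠ v ∧ ∃ t : ℝ, t ≠ 0 ∧ e = t • (u - v)

/-- The set `E` of integer vectors contains a direction of every edge of `P`. -/
def CoversEdgeDirections {n : ℕ} (E : Set (Fin n → ℤ)) (P : Set (Fin n → ℝ)) : Prop :=
  ∀ F, IsEdge P F → ∃ e ∈ E, IsDirection F (fun j => (e j : ℝ))

/-! ## The two oracles -/

/-- The possible replies of a linear integer programming oracle. -/
inductive LinReply (n : ℕ) where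
  | optimal (x : Fin n → ℕ)
  | infeasible
  | unbounded

/-- The reply `r` solves the linear integer program `max {h x : A x = b, x ∈ ℕⁿ}`. -/
def LinReply.Correct {m n : ℕ} (A : Matrix (Fin m) (Fin n) ℤ) (b : Fin m → ℤ) (h : Fin n → ℤ) :
    LinReply n → Prop
  | .optimal x => x ∈ feasible A b ∧
      ∀ y ∈ feasible A b, h ⬝ᵥ (fun j => (y j : ℤ)) ≤ h ⬝ᵥ (fun j => (x j : ℤ))
  | .infeasible => feasible A b = ∅
  | .unbounded => ¬ BddAbove ((fun y : Fin n → ℕ => h ⬝ᵥ (fun j => (y j : ℤ))) '' feasible A b)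

/-- The oracles to which a program has access. -/
structure Oracles (d n : ℕ) where
  /-- queried on an objective function in `ℤⁿ` -/
  lin : (Fin n → ℤ) → LinReply n
  /-- queried on two points of `ℝᵈ` -/
  cmp : (Fin d → ℝ) → (Fin d → ℝ) → Bool

/-- `lin` is a linear integer programming oracle for `A` and `b`. -/
def IsLinearOracle {m n : ℕ} (A : Matrix (Fin m) (Fin n) ℤ) (b : Fin m → ℤ)
    (lin : (Fin n → ℤ) → LinReply n) : Prop :=
  ∀ h, (lin h).Correct A b h

/-- `cmp` is a comparison oracle for `c`: it tells whether or not `c x ≤ c y`. -/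
def IsComparisonOracle {d : ℕ} (c : (Fin d → ℝ) → ℝ)
    (cmp : (Fin d → ℝ) → (Fin d → ℝ) → Bool) : Prop :=
  ∀ x y, cmp x y = true ↔ c x ≤ c y

/-! ## The machine model

Programs of a random access machine with integer variables and integer arrays of unbounded length,
with arithmetic `+`, `-`, `*`, comparisons, and calls to the two oracles. -/

/-- The memory: `var x` is the value of variable `x`, and `arr a i` is cell `i` of array `a`. -/
structure State where
  var : ℕ → ℤ
  arr : ℕ → ℕ → ℤ

/-- Assign `v` to the variable `x`. -/
def State.setVar (σ : State) (x : ℕ) (v : ℤ) : State :=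
  { σ with var := Function.update σ.var x v }

/-- Write `v` into cell `i` of the array `a`. -/
def State.setCell (σ : State) (a i : ℕ) (v : ℤ) : State :=
  { σ with arr := Function.update σ.arr a (Function.update (σ.arr a) i v) }

/-- Write the vector `v` into the first `n` cells of the array `a`. -/
def State.setVec {n : ℕ} (σ : State) (a : ℕ) (v : Fin n → ℤ) : State :=
  ⟨σ.var, Function.update σ.arr a (fun i => if h : i < n then v ⟨i, h⟩ else σ.arr a i)⟩

/-- The vector in the first `n` cells of the array `a`. -/
def State.vec (σ : State) (n a : ℕ) : Fin n → ℤ := fun j => σ.arr a j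

/-- Programs. Operands are names of variables and arrays. -/
inductive Cmd where
  /-- do nothing -/
  | skip
  /-- `x := z` for an integer constant `z` -/
  | const (x : ℕ) (z : ℤ)
  /-- `x := y + z` -/
  | add (x y z : ℕ)
  /-- `x := y - z` -/
  | sub (x y z : ℕ)
  /-- `x := y * z` -/
  | mul (x y z : ℕ)
  /-- `x := a[y]` -/
  | load (x a y : ℕ)
  /-- `a[y] := x` -/
  | store (a y x : ℕ)
  /-- first `p`, then `q` -/
  | seq (p q : Cmd)
  /-- if `x < y` then `p` else `q` -/
  | ite (x y : ℕ) (p q : Cmd)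
  /-- while `x < y` do `p` -/
  | loop (x y : ℕ) (p : Cmd)
  /-- query the linear integer programming oracle on the vector in the array `a`; the variable `s`
  is set to `0` (optimal), `1` (infeasible) or `2` (unbounded), and an optimal solution is written
  into the array `r` -/
  | linQuery (a s r : ℕ)
  /-- query the comparison oracle on the vectors in the arrays `a` and `b`; the variable `x` is set
  to `1` if the answer is yes and to `0` otherwise -/
  | cmpQuery (x a b : ℕ)

/-- The number of bits of an integer, including one bit for the sign. -/
def bitSize (z : ℤ) : ℕ := z.natAbs.size + 1

/-- The largest number of bits of an entry of a vector. -/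
def vecSize {n : ℕ} (v : Fin n → ℤ) : ℕ := Finset.univ.sup (fun j => bitSize (v j))

/-- The resources used by a run. -/
structure Usage where
  /-- the number of operations (arithmetic operations, assignments, tests, memory accesses) and
  oracle calls -/
  steps : ℕ
  /-- the largest number of bits of a number written into the memory, by an operation or an
  oracle -/
  numSize : ℕ
  /-- the largest number of bits of an entry of a query to the linear oracle -/
  querySize : ℕ
  /-- the largest number of bits of an entry of a solution received from the linear oracle -/
  replySize : ℕ

/-- The resources used by two runs in succession. -/
instance : Add Usage where
  add u v := ⟨u.steps + v.steps, max u.numSize v.numSize, max u.querySize v.querySize,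
    max u.replySize v.replySize⟩

/-- One step that writes no number. -/
def Usage.test : Usage := ⟨1, 0, 0, 0⟩

/-- One step that writes the number `v`. -/
def Usage.write (v : ℤ) : Usage := ⟨1, bitSize v, 0, 0⟩

/-- The memory after the linear oracle has given a reply. -/
def LinReply.record {n : ℕ} (σ : State) (s r : ℕ) : LinReply n → State
  | .optimal x => (σ.setVar s 0).setVec r (fun j => (x j : ℤ))
  | .infeasible => σ.setVar s 1
  | .unbounded => σ.setVar s 2

/-- The resources used by a query `h` to the linear oracle, given the reply. -/
def LinReply.usage {n : ℕ} (h : Fin n → ℤ) : LinReply n → Usage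
  | .optimal x => ⟨1, max (bitSize 0) (vecSize (fun j => (x j : ℤ))), vecSize h,
      vecSize (fun j => (x j : ℤ))⟩
  | .infeasible => ⟨1, bitSize 1, vecSize h, 0⟩
  | .unbounded => ⟨1, bitSize 2, vecSize h, 0⟩

/-- The integer answer of the comparison oracle on two integer points. -/
def Oracles.answer {d n : ℕ} (O : Oracles d n) (x y : Fin d → ℤ) : ℤ :=
  if O.cmp (fun i => (x i : ℝ)) (fun i => (y i : ℝ)) then 1 else 0

/-- `Exec O p σ τ u`: with the oracles `O` and started in the memory `σ`, the program `p` halts in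
the memory `τ`, having used the resources `u`. An access to a negative address has no rule, so such
a program does not halt properly. -/
inductive Exec {d n : ℕ} (O : Oracles d n) : Cmd → State → State → Usage → Prop
  | skip (σ : State) : Exec O .skip σ σ .test
  | const (σ : State) (x : ℕ) (z : ℤ) : Exec O (.const x z) σ (σ.setVar x z) (.write z)
  | add (σ : State) (x y z : ℕ) :
      Exec O (.add x y z) σ (σ.setVar x (σ.var y + σ.var z)) (.write (σ.var y + σ.var z))
  | sub (σ : State) (x y z : ℕ) :
      Exec O (.sub x y z) σ (σ.setVar x (σ.var y - σ.var z)) (.write (σ.var y - σ.var z))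
  | mul (σ : State) (x y z : ℕ) :
      Exec O (.mul x y z) σ (σ.setVar x (σ.var y * σ.var z)) (.write (σ.var y * σ.var z))
  | load (σ : State) (x a y i : ℕ) (hi : σ.var y = (i : ℤ)) :
      Exec O (.load x a y) σ (σ.setVar x (σ.arr a i)) (.write (σ.arr a i))
  | store (σ : State) (a y x i : ℕ) (hi : σ.var y = (i : ℤ)) :
      Exec O (.store a y x) σ (σ.setCell a i (σ.var x)) (.write (σ.var x))
  | seq {p q : Cmd} {σ τ ρ : State} {u v : Usage} (hp : Exec O p σ τ u) (hq : Exec O q τ ρ v) :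
      Exec O (.seq p q) σ ρ (u + v)
  | ite_true {x y : ℕ} {p q : Cmd} {σ τ : State} {u : Usage} (h : σ.var x < σ.var y)
      (hp : Exec O p σ τ u) : Exec O (.ite x y p q) σ τ (.test + u)
  | ite_false {x y : ℕ} {p q : Cmd} {σ τ : State} {u : Usage} (h : ¬ σ.var x < σ.var y)
      (hq : Exec O q σ τ u) : Exec O (.ite x y p q) σ τ (.test + u)
  | loop_done {x y : ℕ} {p : Cmd} {σ : State} (h : ¬ σ.var x < σ.var y) :
      Exec O (.loop x y p) σ σ .test
  | loop_step {x y : ℕ} {p : Cmd} {σ τ ρ : State} {u v : Usage} (h : σ.var x < σ.var y)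
      (hp : Exec O p σ τ u) (hl : Exec O (.loop x y p) τ ρ v) :
      Exec O (.loop x y p) σ ρ (.test + u + v)
  | linQuery (σ : State) (a s r : ℕ) :
      Exec O (.linQuery a s r) σ ((O.lin (σ.vec n a)).record σ s r)
        ((O.lin (σ.vec n a)).usage (σ.vec n a))
  | cmpQuery (σ : State) (x a b : ℕ) :
      Exec O (.cmpQuery x a b) σ (σ.setVar x (O.answer (σ.vec d a) (σ.vec d b)))
        (.write (O.answer (σ.vec d a) (σ.vec d b)))

/-! ## Input and output -/

/-- An array that holds a vector, followed by zeros. -/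
def vecArray {l : ℕ} (v : Fin l → ℤ) : ℕ → ℤ := fun t => if h : t < l then v ⟨t, h⟩ else 0

/-- An array that holds a matrix with `n` columns row by row (the entry in row `i` and column `j`
is in cell `n * i + j`), followed by zeros. -/
def rowArray {l n : ℕ} (M : Fin l → Fin n → ℤ) : ℕ → ℤ :=
  vecArray (fun t => M (finProdFinEquiv.symm t).1 (finProdFinEquiv.symm t).2)

/-- The memory at the start: the numbers `n`, `m` and `k` of variables, of equations and of
vectors in the list `E` are in the variables `0`, `1`, `2`, the data `W`, `A`, `b`, `E` are in the
arrays `0`, `1`, `2`, `3`, and all else is zero. -/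
def initialState {d m n k : ℕ} (W : Matrix (Fin d) (Fin n) ℤ) (A : Matrix (Fin m) (Fin n) ℤ)
    (b : Fin m → ℤ) (E : Fin k → Fin n → ℤ) : State where
  var
    | 0 => n
    | 1 => m
    | 2 => k
    | _ => 0
  arr
    | 0 => rowArray W
    | 1 => rowArray A
    | 2 => vecArray b
    | 3 => rowArray E
    | _ => fun _ => 0

/-- The number of bits in the binary representation of the entries of `W`, `A`, `b`, `E`. -/
def inputSize {d m n k : ℕ} (W : Matrix (Fin d) (Fin n) ℤ) (A : Matrix (Fin m) (Fin n) ℤ)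
    (b : Fin m → ℤ) (E : Fin k → Fin n → ℤ) : ℕ :=
  (∑ i, ∑ j, bitSize (W i j)) + (∑ i, ∑ j, bitSize (A i j)) + (∑ i, bitSize (b i)) +
    ∑ i, ∑ j, bitSize (E i j)

/-- The objective value `c (w₁ x, …, w_d x)`, where the `wᵢ` are the rows of `W`. -/
def objective {d n : ℕ} (W : Matrix (Fin d) (Fin n) ℤ) (c : (Fin d → ℝ) → ℝ) (x : Fin n → ℕ) : ℝ :=
  c (fun i => ((W.mulVec (fun j => (x j : ℤ)) i : ℤ) : ℝ))

/-- The memory `τ` at the end holds a correct answer to the program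
`max {c (w₁ x, …, w_d x) : A x = b, x ∈ ℕⁿ}`: variable `0` is `0` and array `0` holds an optimal
solution; or variable `0` is `1` (infeasible) and there is no feasible point; or variable `0` is `2`
(unbounded) and the polyhedron `{x ∈ ℝⁿ : x ≥ 0, A x = b}` is unbounded. -/
def Solves {d m n : ℕ} (W : Matrix (Fin d) (Fin n) ℤ) (A : Matrix (Fin m) (Fin n) ℤ)
    (b : Fin m → ℤ) (c : (Fin d → ℝ) → ℝ) (τ : State) : Prop :=
  (τ.var 0 = 0 ∧ ∃ x ∈ feasible A b, (∀ j : Fin n, τ.arr 0 j = (x j : ℤ)) ∧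
      ∀ y ∈ feasible A b, objective W c y ≤ objective W c x) ∨
  (τ.var 0 = 1 ∧ feasible A b = ∅) ∨
  (τ.var 0 = 2 ∧ ¬ Bornology.IsBounded (polyhedron A b))

end ConvIntMax

namespace ConvIntMax

/-! ## A program logic with resource bounds -/

/-! Suppose that the feasible set is finite and nonempty, and let `U` be its copy in real space, so
that the integer hull is a polytope. Over the finite set `W(U)` the convex function `c` is maximal
at some exposed point `v`: a linear functional `l` attains its maximum over `W(U)` at `v` only
(`exists_exposed_maximizer`). So every maximizer over `U` of the linear functional `g = l ∘ W` has
image `v` and is optimal.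

The functional `l` is unknown, but only the signs of `g` on the edge-directions matter. If `h` is
positive on each vector of `E` on which `g` is positive, and negative where `g` is negative, then
maximizers of `h` also maximize `g` (`maximizes_of_edgeDirections`): otherwise some vertex among the
maximizers of `h` has an edge along which `g`, and hence `h`, increases (`exists_improving_edge`).
One linear query for each sign pattern on the vectors `W e` is therefore enough.

The sign patterns are enumerated as follows (`exists_normalVec_sign`). List the vectors `W e`, the
unit vectors of dimension `d`, and all their negatives. Perturb `l` so that it vanishes on no
nonzero vector of the list. The vectors `a` on which it is positive define a nonempty pointed
polyhedron of all `g` with `a g ≥ 1`. A vertex `g` of it solves `B g = 1` for `d` independent rows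
`B` from the list, and `det B • adj B • 1 = (det B)² g` is an integer vector with the required
signs. There are `(2(k + d))^d` choices of rows, polynomially many for fixed `d`, and no division is
needed.

Unboundedness is settled by also querying the unit vectors of dimension `n`. If some query is
unbounded, there are infinitely many feasible points and the polyhedron is unbounded. If none is,
every coordinate is bounded on the feasible set, which is then finite (`finite_feasible_of_lin`).
`exists_optimal_query` combines these facts.

On the machine side, `Runs` is a Hoare triple with resource bounds: all numbers have at most `M + r`
bits, where `M` is linear in the input size and `r` bounds the oracle replies so far. For a bounded
polyhedron, Cramer's rule at its vertices (`extreme_le`) bounds the replies in terms of the input.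
-/

@[simp] theorem Usage.steps_add (u v : Usage) : (u + v).steps = u.steps + v.steps := rfl
@[simp] theorem Usage.numSize_add (u v : Usage) :
    (u + v).numSize = max u.numSize v.numSize := rfl
@[simp] theorem Usage.querySize_add (u v : Usage) :
    (u + v).querySize = max u.querySize v.querySize := rfl
@[simp] theorem Usage.replySize_add (u v : Usage) :
    (u + v).replySize = max u.replySize v.replySize := rfl

@[simp] theorem State.var_setVar (σ : State) (x : ℕ) (v : ℤ) (y : ℕ) :
    (σ.setVar x v).var y = if y = x then v else σ.var y := by
  simp [State.setVar, Function.update_apply]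

@[simp] theorem State.arr_setVar (σ : State) (x : ℕ) (v : ℤ) : (σ.setVar x v).arr = σ.arr := rfl

@[simp] theorem State.var_setCell (σ : State) (a i : ℕ) (v : ℤ) :
    (σ.setCell a i v).var = σ.var := rfl

@[simp] theorem State.arr_setCell (σ : State) (a i : ℕ) (v : ℤ) (b j : ℕ) :
    (σ.setCell a i v).arr b j = if b = a ∧ j = i then v else σ.arr b j := by
  simp only [State.setCell, Function.update_apply]
  split_ifs <;> simp_all

@[simp] theorem State.var_setVec {n : ℕ} (σ : State) (a : ℕ) (v : Fin n → ℤ) :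
    (σ.setVec a v).var = σ.var := rfl

theorem State.arr_setVec {n : ℕ} (σ : State) (a : ℕ) (v : Fin n → ℤ) (b j : ℕ) :
    (σ.setVec a v).arr b j =
      if h : b = a ∧ j < n then v ⟨j, h.2⟩ else σ.arr b j := by
  simp only [State.setVec, Function.update_apply]
  split_ifs <;> simp_all

/-- The program `p` contains an instruction that writes to the variable `v`. -/
def Cmd.WritesVar : Cmd → ℕ → Prop
  | .skip, _ => False
  | .const x _, v => v = x
  | .add x _ _, v => v = x
  | .sub x _ _, v => v = x
  | .mul x _ _, v => v = x
  | .load x _ _, v => v = x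
  | .store _ _ _, _ => False
  | .seq p q, v => p.WritesVar v ∨ q.WritesVar v
  | .ite _ _ p q, v => p.WritesVar v ∨ q.WritesVar v
  | .loop _ _ p, v => p.WritesVar v
  | .linQuery _ s _, v => v = s
  | .cmpQuery x _ _, v => v = x

/-- The program `p` contains an instruction that writes to the array `a`. -/
def Cmd.WritesArr : Cmd → ℕ → Prop
  | .store b _ _, a => a = b
  | .seq p q, a => p.WritesArr a ∨ q.WritesArr a
  | .ite _ _ p q, a => p.WritesArr a ∨ q.WritesArr a
  | .loop _ _ p, a => p.WritesArr a
  | .linQuery _ _ r, a => a = r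
  | _, _ => False

/-- The states `σ` and `τ` agree on all that the program `p` does not write. -/
structure Frame (p : Cmd) (σ τ : State) : Prop where
  var : ∀ x, ¬ p.WritesVar x → τ.var x = σ.var x
  arr : ∀ a, ¬ p.WritesArr a → τ.arr a = σ.arr a

theorem Frame.refl (p : Cmd) (σ : State) : Frame p σ σ := ⟨fun _ _ => rfl, fun _ _ => rfl⟩

theorem Frame.trans {p : Cmd} {σ τ ρ : State} (h : Frame p σ τ) (h' : Frame p τ ρ) :
    Frame p σ ρ :=
  ⟨fun x hx => (h'.var x hx).trans (h.var x hx), fun a ha => (h'.arr a ha).trans (h.arr a ha)⟩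

theorem Frame.mono {p q : Cmd} {σ τ : State} (h : Frame p σ τ)
    (hv : ∀ x, p.WritesVar x → q.WritesVar x) (ha : ∀ a, p.WritesArr a → q.WritesArr a) :
    Frame q σ τ :=
  ⟨fun x hx => h.var x (fun h => hx (hv x h)), fun a hx => h.arr a (fun h => hx (ha a h))⟩

variable {d n : ℕ} {O : Oracles d n}

/-- Which memory a run can change is read off from the text of the program. Postconditions and
invariants therefore need to mention only what changes. -/
theorem Exec.frame {p : Cmd} {σ τ : State} {u : Usage} (h : Exec O p σ τ u) : Frame p σ τ := by
  induction h with
  | skip σ => exact .refl _ _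
  | const | add | sub | mul | load | cmpQuery =>
    refine ⟨fun x hx => ?_, fun a _ => rfl⟩
    simp only [Cmd.WritesVar] at hx
    simp [hx]
  | store =>
    refine ⟨fun x _ => rfl, fun a ha => ?_⟩
    simp only [Cmd.WritesArr] at ha
    funext j
    simp [ha]
  | seq _ _ ih1 ih2 =>
    exact (ih1.mono (fun _ => Or.inl) (fun _ => Or.inl)).trans
      (ih2.mono (fun _ => Or.inr) (fun _ => Or.inr))
  | ite_true _ _ ih => exact ih.mono (fun _ => Or.inl) (fun _ => Or.inl)
  | ite_false _ _ ih => exact ih.mono (fun _ => Or.inr) (fun _ => Or.inr)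
  | loop_done => exact .refl _ _
  | loop_step _ _ _ ih1 ih2 =>
    exact ⟨fun x hx => (ih2.var x hx).trans (ih1.var x hx),
      fun a ha => (ih2.arr a ha).trans (ih1.arr a ha)⟩
  | linQuery σ a s r =>
    refine ⟨fun x hx => ?_, fun b hb => ?_⟩
    · simp only [Cmd.WritesVar] at hx
      cases O.lin (σ.vec n a) <;> simp [LinReply.record, hx]
    · simp only [Cmd.WritesArr] at hb
      funext j
      cases O.lin (σ.vec n a) <;> simp [LinReply.record, State.arr_setVec, hb]

/-- Started in `σ`, the program `p` halts after at most `T` steps, its queries have at most `M` bits,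
and its numbers at most `M + r'` bits, where `r'` is the maximum of `r` and of the sizes of the
replies; then `Q τ r'` holds in the final state `τ`. -/
def Runs (O : Oracles d n) (M : ℕ) (p : Cmd) (σ : State) (r T : ℕ) (Q : State → ℕ → Prop) : Prop :=
  ∃ τ u, Exec O p σ τ u ∧ u.steps ≤ T ∧ u.querySize ≤ M ∧ u.numSize ≤ M + max r u.replySize ∧
    Q τ (max r u.replySize)

variable {M : ℕ} {σ : State} {r T : ℕ} {Q : State → ℕ → Prop}

theorem Runs.mono {p : Cmd} {T' : ℕ} {Q' : State → ℕ → Prop} (h : Runs O M p σ r T' Q')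
    (hT : T' ≤ T) (hQ : ∀ τ r', r ≤ r' → Frame p σ τ → Q' τ r' → Q τ r') : Runs O M p σ r T Q := by
  obtain ⟨τ, u, he, h1, h2, h3, h4⟩ := h
  exact ⟨τ, u, he, h1.trans hT, h2, h3, hQ _ _ (le_max_left _ _) he.frame h4⟩

/-- The second program may assume the frame of the first, and the reply bound reached by the first
is the one from which the second starts. -/
theorem Runs.seq {p q : Cmd} {T₁ T₂ : ℕ} {Q₁ : State → ℕ → Prop} (hp : Runs O M p σ r T₁ Q₁)
    (hq : ∀ τ r', r ≤ r' → Frame p σ τ → Q₁ τ r' → Runs O M q τ r' T₂ Q) :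
    Runs O M (.seq p q) σ r (T₂ + T₁) Q := by
  obtain ⟨τ, u, he, h1, h2, h3, h4⟩ := hp
  obtain ⟨ρ, v, he', h1', h2', h3', h4'⟩ := hq _ _ (le_max_left _ _) he.frame h4
  refine ⟨ρ, u + v, .seq he he', ?_, ?_, ?_, ?_⟩
  · simp only [Usage.steps_add]; omega
  · simp only [Usage.querySize_add]; omega
  · simp only [Usage.numSize_add, Usage.replySize_add]; omega
  · rwa [Usage.replySize_add, ← max_assoc]

theorem Runs.skip (h : Q σ r) : Runs O M .skip σ r 1 Q :=
  ⟨σ, _, .skip σ, le_rfl, Nat.zero_le _, Nat.zero_le _, by simpa [Usage.test] using h⟩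

theorem Runs.of_write_seq {p q : Cmd} {τ : State} {v : ℤ} (he : Exec O p σ τ (.write v))
    (hv : bitSize v ≤ M + r) (h : Runs O M q τ r T Q) : Runs O M (.seq p q) σ r (T + 1) Q := by
  obtain ⟨ρ, u, he', h1, h2, h3, h4⟩ := h
  refine ⟨ρ, _, .seq he he', ?_, ?_, ?_, ?_⟩
  · simp only [Usage.steps_add, Usage.write]; omega
  · simp only [Usage.querySize_add, Usage.write]; omega
  · simp only [Usage.numSize_add, Usage.replySize_add, Usage.write]; omega
  · simpa [Usage.write] using h4

section Instructions

variable {x y z a i : ℕ} {q : Cmd}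

theorem Runs.const {c : ℤ} (hv : bitSize c ≤ M + r) (h : Runs O M q (σ.setVar x c) r T Q) :
    Runs O M (.seq (.const x c) q) σ r (T + 1) Q := .of_write_seq (.const σ x c) hv h

theorem Runs.add (hv : bitSize (σ.var y + σ.var z) ≤ M + r)
    (h : Runs O M q (σ.setVar x (σ.var y + σ.var z)) r T Q) :
    Runs O M (.seq (.add x y z) q) σ r (T + 1) Q := .of_write_seq (.add σ x y z) hv h

theorem Runs.sub (hv : bitSize (σ.var y - σ.var z) ≤ M + r)
    (h : Runs O M q (σ.setVar x (σ.var y - σ.var z)) r T Q) :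
    Runs O M (.seq (.sub x y z) q) σ r (T + 1) Q := .of_write_seq (.sub σ x y z) hv h

theorem Runs.mul (hv : bitSize (σ.var y * σ.var z) ≤ M + r)
    (h : Runs O M q (σ.setVar x (σ.var y * σ.var z)) r T Q) :
    Runs O M (.seq (.mul x y z) q) σ r (T + 1) Q := .of_write_seq (.mul σ x y z) hv h

theorem Runs.load (i : ℕ) (hi : σ.var y = i) (hv : bitSize (σ.arr a i) ≤ M + r)
    (h : Runs O M q (σ.setVar x (σ.arr a i)) r T Q) :
    Runs O M (.seq (.load x a y) q) σ r (T + 1) Q := .of_write_seq (.load σ x a y i hi) hv h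

theorem Runs.store (i : ℕ) (hi : σ.var y = i) (hv : bitSize (σ.var x) ≤ M + r)
    (h : Runs O M q (σ.setCell a i (σ.var x)) r T Q) :
    Runs O M (.seq (.store a y x) q) σ r (T + 1) Q := .of_write_seq (.store σ a y x i hi) hv h

end Instructions

theorem Runs.ite {x y : ℕ} {p q : Cmd} (hp : σ.var x < σ.var y → Runs O M p σ r T Q)
    (hq : ¬ σ.var x < σ.var y → Runs O M q σ r T Q) : Runs O M (.ite x y p q) σ r (T + 1) Q := by
  by_cases h : σ.var x < σ.var y
  · obtain ⟨τ, u, he, h1, h2, h3, h4⟩ := hp h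
    refine ⟨τ, _, .ite_true h he, ?_, ?_, ?_, ?_⟩ <;> simp [Usage.test, *]; omega
  · obtain ⟨τ, u, he, h1, h2, h3, h4⟩ := hq h
    refine ⟨τ, _, .ite_false h he, ?_, ?_, ?_, ?_⟩ <;> simp [Usage.test, *]; omega

/-- `for i < N do p`, where the variable `4` is supposed to hold `1`. -/
def Cmd.for (i N : ℕ) (p : Cmd) : Cmd := .seq (.const i 0) (.loop i N (.seq p (.add i i 4)))

/-- The crude bound `v < 2 ^ v` is enough, because counters and addresses are themselves at most
linear in the input size. -/
theorem bitSize_natCast_le (v : ℕ) : bitSize (v : ℤ) ≤ v + 1 := by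
  simpa [bitSize] using Nat.size_le.2 (Nat.lt_two_pow_self (n := v))

theorem bitSize_natCast_le_of_lt {v M r : ℕ} (h : v < M) : bitSize (v : ℤ) ≤ M + r :=
  (bitSize_natCast_le v).trans (by omega)

/-- The increment belongs to the loop body, so the invariant is re-established after the counter has
been raised to `t + 1`. A round costs `T` plus one test and one increment. The final `2` is the
initial assignment and the failing test. -/
theorem Runs.for {i N : ℕ} {p : Cmd} (len : ℕ) (hN : σ.var N = len) (h1 : σ.var 4 = 1)
    (hiN : N ≠ i) (hi4 : i ≠ 4) (hpi : ¬ p.WritesVar i) (hpN : ¬ p.WritesVar N)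
    (hp4 : ¬ p.WritesVar 4) (hlen : len < M) (Inv : ℕ → State → ℕ → Prop)
    (h0 : Inv 0 (σ.setVar i 0) r)
    (hstep : ∀ t < len, ∀ (τ : State) (r' : ℕ), r ≤ r' → τ.var i = (t : ℤ) → Frame (Cmd.for i N p) σ τ → Inv t τ r' →
      Runs O M p τ r' T (fun ρ r'' => Inv (t + 1) (ρ.setVar i (t + 1)) r'')) :
    Runs O M (Cmd.for i N p) σ r (len * (T + 2) + 2) (fun τ r' => τ.var i = len ∧ Inv len τ r') := by
  -- Induction on the number `s` of rounds that remain.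
  have key : ∀ s t, t + s = len → ∀ (τ : State) (r' : ℕ), r ≤ r' → τ.var i = (t : ℤ) → Frame (Cmd.for i N p) σ τ →
      Inv t τ r' → Runs O M (.loop i N (.seq p (.add i i 4))) τ r' (s * (T + 2) + 1)
        (fun τ r' => τ.var i = len ∧ Inv len τ r') := by
    have w4 : ¬ (Cmd.for i N p).WritesVar 4 := by simp [Cmd.for, Cmd.WritesVar, hp4, Ne.symm hi4]
    have wN : ¬ (Cmd.for i N p).WritesVar N := by simp [Cmd.for, Cmd.WritesVar, hpN, hiN]
    intro s
    induction s with
    | zero =>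
      intro t ht τ r' _ hi hF hI
      obtain rfl : t = len := by omega
      refine ⟨τ, _, .loop_done ?_, by simp [Usage.test], by simp [Usage.test],
        by simp [Usage.test], by simp [Usage.test, hi, hI]⟩
      rw [hF.var N wN, hi, hN]; exact lt_irrefl _
    | succ s ih =>
      intro t ht τ r' hr hi hF hI
      obtain ⟨ρ, u, he, a1, a2, a3, a4⟩ := hstep t (by omega) τ r' hr hi hF hI
      have hρi : ρ.var i = t := by rw [he.frame.var i hpi, hi]
      have hρ4 : ρ.var 4 = 1 := by rw [he.frame.var 4 hp4, hF.var 4 w4, h1]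
      have hadd := Exec.add (O := O) ρ i i 4
      rw [hρi, hρ4] at hadd
      have hb : bitSize ((t : ℤ) + 1) ≤ M + r' := by
        have := bitSize_natCast_le_of_lt (v := t + 1) (M := M) (r := r') (by omega)
        exact_mod_cast this
      have hbody := Exec.seq he hadd
      obtain ⟨π, v, he', b1, b2, b3, b4⟩ := ih (t + 1) (by omega) (ρ.setVar i (t + 1))
        (max r' u.replySize) (by omega) (by simp)
        (hF.trans (hbody.frame.mono (fun x hx => Or.inr hx) (fun x hx => Or.inr hx))) a4
      refine ⟨π, _, .loop_step ?_ hbody he', ?_, ?_, ?_, ?_⟩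
      · rw [hi, hF.var N wN, hN]; exact_mod_cast (by omega : t < len)
      · simp only [Usage.steps_add, Usage.write, Usage.test]; rw [Nat.succ_mul]; omega
      · simp only [Usage.querySize_add, Usage.write, Usage.test]; omega
      · simp only [Usage.numSize_add, Usage.replySize_add, Usage.write, Usage.test]; omega
      · have : max r' (Usage.test + (u + Usage.write (t + 1)) + v).replySize =
            max (max r' u.replySize) v.replySize := by
          simp only [Usage.replySize_add, Usage.write, Usage.test]; omega
        rw [this]; exact b4
  have hM : bitSize 0 ≤ M + r := bitSize_natCast_le_of_lt (v := 0) (by omega)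
  refine Runs.const hM (key len 0 (by omega) _ r le_rfl (by simp) ?_ h0)
  exact ⟨fun x hx => by
    have : x ≠ i := fun h => hx (Or.inl h)
    simp [this], fun a _ => rfl⟩

/-- Used for bounded polyhedra, where every possible reply is small whatever the program asks. -/
theorem Exec.replySize_le {p : Cmd} {τ : State} {u : Usage} (h : Exec O p σ τ u) {C : ℕ}
    (hC : ∀ g x, O.lin g = .optimal x → vecSize (fun j => (x j : ℤ)) ≤ C) : u.replySize ≤ C := by
  induction h with
  | seq _ _ ih1 ih2 => simp [ih1, ih2]
  | ite_true _ _ ih => simp [Usage.test, ih]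
  | ite_false _ _ ih => simp [Usage.test, ih]
  | loop_step _ _ _ ih1 ih2 => simp [Usage.test, ih1, ih2]
  | linQuery σ a s r =>
    cases h : O.lin (σ.vec n a) with
    | optimal x => exact hC _ x h
    | infeasible => simp [LinReply.usage]
    | unbounded => simp [LinReply.usage]
  | _ => simp [Usage.test, Usage.write]

end ConvIntMax

namespace ConvIntMax

/-! ### Bit sizes, and programs for inner products, matrix-vector products and copying. -/

theorem bitSize_le_succ_iff {z : ℤ} {s : ℕ} : bitSize z ≤ s + 1 ↔ z.natAbs < 2 ^ s := by
  rw [bitSize, Nat.add_le_add_iff_right, Nat.size_le]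

theorem one_le_bitSize (z : ℤ) : 1 ≤ bitSize z := by simp [bitSize]

theorem natAbs_lt_two_pow_bitSize (z : ℤ) : z.natAbs < 2 ^ (bitSize z - 1) := by
  rw [← bitSize_le_succ_iff]
  have := one_le_bitSize z
  omega

theorem bitSize_add_le {x y : ℤ} {s : ℕ} (hx : bitSize x ≤ s) (hy : bitSize y ≤ s) :
    bitSize (x + y) ≤ s + 1 := by
  obtain ⟨s, rfl⟩ : ∃ t, s = t + 1 := ⟨s - 1, by have := one_le_bitSize x; omega⟩
  rw [bitSize_le_succ_iff] at *
  have := Int.natAbs_add_le x y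
  rw [pow_succ]
  omega

theorem bitSize_mul_le {x y : ℤ} {s t : ℕ} (hx : bitSize x ≤ s) (hy : bitSize y ≤ t) :
    bitSize (x * y) ≤ s + t := by
  obtain ⟨s, rfl⟩ : ∃ t, s = t + 1 := ⟨s - 1, by have := one_le_bitSize x; omega⟩
  obtain ⟨t, rfl⟩ : ∃ s, t = s + 1 := ⟨t - 1, by have := one_le_bitSize y; omega⟩
  refine le_trans (b := s + t + 1) ?_ (by omega)
  rw [bitSize_le_succ_iff] at *
  rw [Int.natAbs_mul, pow_add]
  exact Nat.mul_lt_mul'' hx hy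

@[simp] theorem bitSize_neg (x : ℤ) : bitSize (-x) = bitSize x := by simp [bitSize]

@[simp] theorem bitSize_zero : bitSize 0 = 1 := by simp [bitSize]

@[simp] theorem bitSize_one : bitSize 1 = 2 := by simp [bitSize]

@[simp] theorem bitSize_two : bitSize 2 = 3 := by simp [bitSize]; rfl

/-- Each addition costs at most one more bit. The final `1` is the size of the empty sum. -/
theorem bitSize_sum_mul_le {f g : ℕ → ℤ} {X Y len : ℕ} (hX : ∀ l < len, bitSize (f l) ≤ X)
    (hY : ∀ l < len, bitSize (g l) ≤ Y) :
    bitSize (∑ l ∈ Finset.range len, f l * g l) ≤ X + Y + len + 1 := by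
  induction len with
  | zero => simp
  | succ t ih =>
    rw [Finset.sum_range_succ]
    refine bitSize_add_le (ih (fun l hl => hX l (by omega)) (fun l hl => hY l (by omega))) ?_
    have := bitSize_mul_le (hX t (by omega)) (hY t (by omega))
    omega

variable {d n : ℕ} {O : Oracles d n} {M : ℕ} {σ : State} {r : ℕ}

/-- The inner product of two strided vectors: variable `20` becomes the sum of the products of the
cells `a[pa + l * sa]` and `b[pb + l * sb]` over `l < len`, with `pa`, `sa`, `pb`, `sb`, `len` in the
variables `21` to `25`. -/
def dotProg (a b : ℕ) : Cmd :=
  .seq (.const 20 0) (.for 26 25 (.seq (.load 27 a 21) (.seq (.load 28 b 23)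
    (.seq (.mul 27 27 28) (.seq (.add 20 20 27) (.seq (.add 21 21 22) (.seq (.add 23 23 24)
      .skip)))))))

/-- The bounds `haM` and `hbM` involve `len` rather than `len - 1` because both pointers are
advanced in the last round too. -/
theorem runs_dotProg {a b pa sa pb sb len X Y : ℕ} (h4 : σ.var 4 = 1) (hpa : σ.var 21 = pa)
    (hsa : σ.var 22 = sa) (hpb : σ.var 23 = pb) (hsb : σ.var 24 = sb) (hlen : σ.var 25 = len)
    (hX : ∀ l < len, bitSize (σ.arr a (pa + l * sa)) ≤ X)
    (hY : ∀ l < len, bitSize (σ.arr b (pb + l * sb)) ≤ Y)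
    (hM : X + Y + len + 1 ≤ M + r) (hlM : len < M)
    (haM : pa + len * sa < M) (hbM : pb + len * sb < M) :
    Runs O M (dotProg a b) σ r (len * 9 + 3) (fun τ _ => τ.var 20 =
      ∑ l ∈ Finset.range len, σ.arr a (pa + l * sa) * σ.arr b (pb + l * sb)) := by
  refine Runs.const (by simp; omega) ?_
  refine (Runs.for (T := 7) len (by simp [hlen]) (by simp [h4]) (by decide) (by decide)
    (by simp [Cmd.WritesVar]) (by simp [Cmd.WritesVar]) (by simp [Cmd.WritesVar]) hlM
    (fun t τ _ => τ.var 20 = ∑ l ∈ Finset.range t, σ.arr a (pa + l * sa) * σ.arr b (pb + l * sb) ∧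
      τ.var 21 = (pa + t * sa : ℕ) ∧ τ.var 23 = (pb + t * sb : ℕ)) (by simp [hpa, hpb]) ?_).mono
      le_rfl (fun τ r' _ _ h => h.2.1)
  rintro t ht τ r' hr hi hF ⟨e0, e1, e3⟩
  have f22 : τ.var 22 = sa := by
    rw [hF.var 22 (by simp [Cmd.for, Cmd.WritesVar])]; simp [hsa]
  have f24 : τ.var 24 = sb := by
    rw [hF.var 24 (by simp [Cmd.for, Cmd.WritesVar])]; simp [hsb]
  have fa : ∀ a, τ.arr a = σ.arr a := fun a => by
    rw [hF.arr a (by simp [Cmd.for, Cmd.WritesArr])]; simp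
  have hx := hX t ht
  have hy := hY t ht
  have la : pa + (t + 1) * sa ≤ pa + len * sa := by gcongr; omega
  have lb : pb + (t + 1) * sb ≤ pb + len * sb := by gcongr; omega
  have hs : bitSize (∑ l ∈ Finset.range (t + 1),
      σ.arr a (pa + l * sa) * σ.arr b (pb + l * sb)) ≤ X + Y + (t + 1) + 1 :=
    bitSize_sum_mul_le (fun l hl => hX l (by omega)) (fun l hl => hY l (by omega))
  have hm := bitSize_mul_le hx hy
  refine Runs.load (pa + t * sa) e1 (by rw [fa]; omega) ?_
  refine Runs.load (pb + t * sb) (by simpa using e3) (by simp [fa]; omega) ?_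
  refine Runs.mul (by simp [fa]; omega) ?_
  refine Runs.add (by simp [fa, e0, ← Finset.sum_range_succ]; omega) ?_
  refine Runs.add (by
    have := bitSize_natCast_le_of_lt (v := pa + (t + 1) * sa) (M := M) (r := r') (by omega)
    convert this using 2; simp [e1, f22]; ring) ?_
  refine Runs.add (by
    have := bitSize_natCast_le_of_lt (v := pb + (t + 1) * sb) (M := M) (r := r') (by omega)
    convert this using 2; simp [e3, f24]; ring) ?_
  refine Runs.skip ⟨?_, ?_, ?_⟩
  · simp [fa, e0, Finset.sum_range_succ]
  · simp [e1, f22]; ring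
  · simp [e3, f24]; ring

/-- The product of a matrix and a vector: the sums of `a[i * ra + l * sa] * b[pb + l]` over `l < len`
are written into the cells `out + i` of the array `o`, for `i < rows`, with `sa`, `len`, `rows`,
`ra`, `pb`, `out` in the variables `22`, `25`, `30`, `31`, `32`, `33`; at the end variable `33`
is `out + rows`. -/
def matVecProg (a b o : ℕ) : Cmd :=
  .seq (.const 34 0) (.seq (.const 24 1) (.for 35 30 (.seq (.add 21 34 3) (.seq (.add 23 32 3)
    (.seq (dotProg a b) (.seq (.store o 33 20) (.seq (.add 34 34 31) (.seq (.add 33 33 4)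
      .skip))))))))

/-- With the strides `ra = n`, `sa = 1` this multiplies by `W`, and with `ra = 1`, `sa = n` by its
transpose. The untouched cells and the final value of variable `33` allow further results to be
appended. -/
theorem runs_matVecProg {a b o sa ra pb len rows out X Y : ℕ} (hoa : a ≠ o) (hob : b ≠ o)
    (h3 : σ.var 3 = 0) (h4 : σ.var 4 = 1) (hsa : σ.var 22 = sa) (hlen : σ.var 25 = len)
    (hrows : σ.var 30 = rows) (hra : σ.var 31 = ra) (hpb : σ.var 32 = pb) (hout : σ.var 33 = out)
    (hX : ∀ i < rows, ∀ l < len, bitSize (σ.arr a (i * ra + l * sa)) ≤ X)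
    (hY : ∀ l < len, bitSize (σ.arr b (pb + l)) ≤ Y)
    (hM : X + Y + len + 1 ≤ M + r) (hlM : len < M) (hrM : rows < M) (hM1 : 1 < M)
    (haM : rows * ra + len * sa < M) (hbM : pb + len < M) (hoM : out + rows < M) :
    Runs O M (matVecProg a b o) σ r (rows * (len * 9 + 11) + 4) (fun τ _ =>
      (∀ i < rows, τ.arr o (out + i) =
        ∑ l ∈ Finset.range len, σ.arr a (i * ra + l * sa) * σ.arr b (pb + l)) ∧
      (∀ j, (j < out ∨ out + rows ≤ j) → τ.arr o j = σ.arr o j) ∧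
      τ.var 33 = (out + rows : ℕ)) := by
  refine Runs.const (by simp; omega) ?_
  refine Runs.const (by simp; omega) ?_
  refine (Runs.for (T := len * 9 + 9) rows (by simp [hrows]) (by simp [h4]) (by decide) (by decide)
    (by simp [Cmd.WritesVar, dotProg, Cmd.for]) (by simp [Cmd.WritesVar, dotProg, Cmd.for])
    (by simp [Cmd.WritesVar, dotProg, Cmd.for]) hrM
    (fun t τ _ => (∀ i < t, τ.arr o (out + i) =
        ∑ l ∈ Finset.range len, σ.arr a (i * ra + l * sa) * σ.arr b (pb + l)) ∧
      (∀ j, (j < out ∨ out + t ≤ j) → τ.arr o j = σ.arr o j) ∧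
      τ.var 33 = (out + t : ℕ) ∧ τ.var 34 = (t * ra : ℕ)) (by simp [hout]) ?_).mono
      (by ring_nf; omega) (fun τ r' _ _ h => ⟨h.2.1, h.2.2.1, h.2.2.2.1⟩)
  rintro t ht τ r' hr hi hF ⟨e0, e1, e33, e34⟩
  have fv : ∀ x ∈ [3, 4, 22, 25, 30, 31, 32], τ.var x = σ.var x := fun x hx => by
    rw [hF.var x (by simp at hx; simp [Cmd.for, Cmd.WritesVar, dotProg]; omega)]
    simp at hx
    simp; omega
  simp only [List.forall_mem_cons, h3, h4, hsa, hlen, hrows, hra, hpb] at fv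
  obtain ⟨f3, f4, f22, f25, f30, f31, f32, -⟩ := fv
  have f24 : τ.var 24 = 1 := by
    rw [hF.var 24 (by simp [Cmd.for, Cmd.WritesVar, dotProg])]; simp
  have fa : ∀ a ≠ o, τ.arr a = σ.arr a := fun a ha => by
    rw [hF.arr a (by simp [Cmd.for, Cmd.WritesArr, dotProg, ha])]; simp
  have l1 : (t + 1) * ra ≤ rows * ra := by gcongr; omega
  have l2 : (t + 1) * ra = t * ra + ra := by ring
  refine Runs.add (by
    simpa [e34, f3] using bitSize_natCast_le_of_lt (v := t * ra) (M := M) (r := r') (by omega)) ?_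
  refine Runs.add (by
    simpa [f32, f3] using bitSize_natCast_le_of_lt (v := pb) (M := M) (r := r') (by omega)) ?_
  refine (Runs.seq (T₂ := 4) (runs_dotProg (pa := t * ra) (sa := sa) (pb := pb) (sb := 1)
    (len := len) (X := X) (Y := Y)
    (by simp [f4]) (by simp [e34, f3]) (by simp [f22]) (by simp [f32, f3]) (by simp [f24])
    (by simp [f25]) ?_ ?_ (by omega) hlM (by omega) (by omega)) ?_).mono (by omega)
    (fun τ r' _ _ h => h)
  · intro l hl; simpa [fa a hoa] using hX t ht l hl
  · intro l hl; simpa [fa b hob] using hY l hl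
  intro ρ r'' hr' hF' e20
  simp [fa a hoa, fa b hob] at e20
  have g : ∀ x ∈ [4, 31, 33, 34], ρ.var x = τ.var x := fun x hx => by
    rw [hF'.var x (by simp at hx; simp [Cmd.for, Cmd.WritesVar, dotProg]; omega)]
    simp only [List.mem_cons, List.not_mem_nil, or_false] at hx
    rcases hx with rfl | rfl | rfl | rfl <;> simp
  simp only [List.forall_mem_cons, f4, f31, e33, e34] at g
  obtain ⟨g4, g31, g33, g34, -⟩ := g
  have ga : ∀ a, ρ.arr a = τ.arr a := fun a => by
    rw [hF'.arr a (by simp [Cmd.for, Cmd.WritesArr, dotProg])]; simp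
  have hs := bitSize_sum_mul_le (len := len) (fun l hl => hX t ht l hl) hY
  refine Runs.store (out + t) g33 (by rw [e20]; omega) ?_
  refine Runs.add (by
    have := bitSize_natCast_le_of_lt (v := (t + 1) * ra) (M := M) (r := r'') (by omega)
    convert this using 2; simp [g34, g31]; ring) ?_
  refine Runs.add (by
    have := bitSize_natCast_le_of_lt (v := out + (t + 1)) (M := M) (r := r'') (by omega)
    convert this using 2; simp [g33, g4]; ring) ?_
  refine Runs.skip ⟨?_, ?_, ?_, ?_⟩
  · intro i hi
    simp only [State.arr_setVar, State.arr_setCell, true_and, Nat.add_left_cancel_iff]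
    split_ifs with h
    · rw [h, e20]
    · rw [ga, e0 i (by omega)]
  · intro j hj
    simp only [State.arr_setVar, State.arr_setCell, true_and]
    rw [if_neg (by omega), ga, e1 j (by omega)]
  · simp [g33, g4]; ring
  · simp [g34, g31]; ring

/-- Copy the cells `src, …, src + len - 1` of the array `a` to the cells from `dst` on of the array
`b`, with `src`, `dst`, `len` in the variables `41`, `42`, `43`. -/
def copyProg (a b : ℕ) : Cmd :=
  .for 44 43 (.seq (.load 45 a 41) (.seq (.store b 42 45) (.seq (.add 41 41 4)
    (.seq (.add 42 42 4) .skip))))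

theorem runs_copyProg {a b src dst len : ℕ} (hab : a ≠ b) (h4 : σ.var 4 = 1)
    (hsrc : σ.var 41 = src) (hdst : σ.var 42 = dst) (hlen : σ.var 43 = len)
    (hX : ∀ l < len, bitSize (σ.arr a (src + l)) ≤ M + r) (hlM : len < M)
    (hsM : src + len < M) (hdM : dst + len < M) :
    Runs O M (copyProg a b) σ r (len * 7 + 2) (fun τ _ =>
      (∀ l < len, τ.arr b (dst + l) = σ.arr a (src + l)) ∧
      (∀ j, (j < dst ∨ dst + len ≤ j) → τ.arr b j = σ.arr b j)) := by
  refine (Runs.for (T := 5) len (by simp [hlen]) (by simp [h4]) (by decide) (by decide)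
    (by simp [Cmd.WritesVar]) (by simp [Cmd.WritesVar]) (by simp [Cmd.WritesVar]) hlM
    (fun t τ _ => (∀ l < t, τ.arr b (dst + l) = σ.arr a (src + l)) ∧
      (∀ j, (j < dst ∨ dst + t ≤ j) → τ.arr b j = σ.arr b j) ∧
      τ.var 41 = (src + t : ℕ) ∧ τ.var 42 = (dst + t : ℕ)) (by simp [hsrc, hdst]) ?_).mono
      le_rfl (fun τ r' _ _ h => ⟨h.2.1, h.2.2.1⟩)
  rintro t ht τ r' hr hi hF ⟨e0, e1, e41, e42⟩
  have f4 : τ.var 4 = 1 := by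
    rw [hF.var 4 (by simp [Cmd.for, Cmd.WritesVar]), h4]
  have fa : τ.arr a = σ.arr a := by
    rw [hF.arr a (by simp [Cmd.for, Cmd.WritesArr, hab])]
  have hx := hX t ht
  refine Runs.load (src + t) e41 (by rw [fa]; omega) ?_
  refine Runs.store (dst + t) (by simp [e42]) (by simp [fa]; omega) ?_
  refine Runs.add (by
    have := bitSize_natCast_le_of_lt (v := src + (t + 1)) (M := M) (r := r') (by omega)
    convert this using 2; simp [e41, f4]; ring) ?_
  refine Runs.add (by
    have := bitSize_natCast_le_of_lt (v := dst + (t + 1)) (M := M) (r := r') (by omega)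
    convert this using 2; simp [e42, f4]; ring) ?_
  refine Runs.skip ⟨?_, ?_, ?_, ?_⟩
  · intro i hi
    simp only [State.arr_setVar, State.arr_setCell, true_and, Nat.add_left_cancel_iff]
    split_ifs with h
    · simp [h, fa]
    · rw [e0 i (by omega)]
  · intro j hj
    simp only [State.arr_setVar, State.arr_setCell, true_and]
    rw [if_neg (by omega), e1 j (by omega)]
  · simp [e41, f4]; ring
  · simp [e42, f4]; ring

end ConvIntMax

namespace ConvIntMax

/-! ### The incumbent solution and the processing of one linear query. -/

theorem rowArray_apply {l n : ℕ} (N : Fin l → Fin n → ℤ) (i : Fin l) (j : Fin n) :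
    rowArray N (i * n + j) = N i j := by
  have h : (i : ℕ) * n + j < l * n := by
    have := (finProdFinEquiv (i, j)).2
    simp only [finProdFinEquiv_apply_val] at this
    linarith [mul_comm (i : ℕ) n]
  have : (⟨i * n + j, h⟩ : Fin (l * n)) = finProdFinEquiv (i, j) := by
    ext; simp [mul_comm, add_comm]
  rw [rowArray, vecArray, dif_pos h, this, Equiv.symm_apply_apply]

variable {d n m : ℕ}

/-- The constants of the main program: `0`, `1`, `n`, `d` and the matrix `W`. -/
structure Constants (W : Matrix (Fin d) (Fin n) ℤ) (σ : State) : Prop where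
  zero : σ.var 3 = 0
  one : σ.var 4 = 1
  numVars : σ.var 0 = n
  dim : σ.var 5 = d
  rows : σ.arr 0 = rowArray W

theorem Constants.of_frame {W : Matrix (Fin d) (Fin n) ℤ} {σ τ : State} {p : Cmd}
    (h : Constants W σ) (hF : Frame p σ τ) (h3 : ¬ p.WritesVar 3) (h4 : ¬ p.WritesVar 4)
    (h0 : ¬ p.WritesVar 0) (h5 : ¬ p.WritesVar 5) (hA : ¬ p.WritesArr 0) : Constants W τ :=
  ⟨(hF.var 3 h3).trans h.zero, (hF.var 4 h4).trans h.one, (hF.var 0 h0).trans h.numVars,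
    (hF.var 5 h5).trans h.dim, (hF.arr 0 hA).trans h.rows⟩

theorem Constants.entry {W : Matrix (Fin d) (Fin n) ℤ} {σ : State} (h : Constants W σ)
    (i : Fin d) (j : Fin n) : σ.arr 0 (i * n + j) = W i j := by
  rw [h.rows]; exact rowArray_apply _ i j

/-- The point of `ℝᵈ` in array `8`. -/
def State.bestValue (d : ℕ) (σ : State) : Fin d → ℝ := fun i => (σ.arr 8 i : ℝ)

/-- Variable `7` tells whether array `9` holds a feasible point (and array `8` its image under `W`);
if variable `8` is `1`, then the polyhedron is unbounded. -/
structure Incumbent (W : Matrix (Fin d) (Fin n) ℤ) (A : Matrix (Fin m) (Fin n) ℤ) (b : Fin m → ℤ)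
    (σ : State) (r : ℕ) : Prop where
  flag : σ.var 7 = 0 ∨ σ.var 7 = 1
  point : σ.var 7 = 1 → ∃ x ∈ feasible A b, (∀ j : Fin n, σ.arr 9 j = x j) ∧
    (∀ i : Fin d, σ.arr 8 i = W.mulVec (fun j => (x j : ℤ)) i) ∧ vecSize (fun j => (x j : ℤ)) ≤ r
  unbounded : σ.var 8 = 0 ∨ (σ.var 8 = 1 ∧ ¬ Bornology.IsBounded (polyhedron A b))

/-- The reply of the linear oracle to the query `h` has been taken into account. -/
def Covered (W : Matrix (Fin d) (Fin n) ℤ) (c : (Fin d → ℝ) → ℝ) (O : Oracles d n) (σ : State)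
    (h : Fin n → ℤ) : Prop :=
  match O.lin h with
  | .optimal x => σ.var 7 = 1 ∧ objective W c x ≤ c (σ.bestValue d)
  | .infeasible => True
  | .unbounded => σ.var 8 = 1

/-- All that variables `7`, `8` and arrays `8`, `9` record is kept. -/
structure SameIncumbent (σ τ : State) : Prop where
  var7 : τ.var 7 = σ.var 7
  var8 : τ.var 8 = σ.var 8
  arr8 : τ.arr 8 = σ.arr 8
  arr9 : τ.arr 9 = σ.arr 9

theorem SameIncumbent.covered {W : Matrix (Fin d) (Fin n) ℤ} {c : (Fin d → ℝ) → ℝ}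
    {O : Oracles d n} {σ τ : State} {h : Fin n → ℤ} (hs : SameIncumbent σ τ)
    (hc : Covered W c O σ h) : Covered W c O τ h := by
  have : τ.bestValue d = σ.bestValue d := by
    funext i; simp only [State.bestValue, hs.arr8]
  simpa only [Covered, hs.var7, hs.var8, this] using hc

theorem SameIncumbent.incumbent {W : Matrix (Fin d) (Fin n) ℤ} {A : Matrix (Fin m) (Fin n) ℤ}
    {b : Fin m → ℤ} {σ τ : State} {r r' : ℕ} (hs : SameIncumbent σ τ)
    (hc : Incumbent W A b σ r) (hr : r ≤ r') : Incumbent W A b τ r' := by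
  refine ⟨by rw [hs.var7]; exact hc.flag, fun h => ?_, by rw [hs.var8]; exact hc.unbounded⟩
  obtain ⟨x, h1, h2, h3, h4⟩ := hc.point (by rw [← hs.var7]; exact h)
  exact ⟨x, h1, by rw [hs.arr9]; exact h2, by rw [hs.arr8]; exact h3, h4.trans hr⟩

/-- Replace the incumbent by the point in array `6`, whose image under `W` is in array `7`. -/
def replaceProg : Cmd :=
  .seq (.const 41 0) (.seq (.const 42 0) (.seq (.add 43 0 3) (.seq (copyProg 6 9)
    (.seq (.const 41 0) (.seq (.const 42 0) (.seq (.add 43 5 3) (.seq (copyProg 7 8)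
      (.seq (.const 7 1) .skip))))))))

/-- Compare the point in array `6` with the incumbent. -/
def compareProg : Cmd :=
  .seq (.add 30 5 3) (.seq (.add 31 0 3) (.seq (.const 22 1) (.seq (.add 25 0 3)
    (.seq (.const 32 0) (.seq (.const 33 0) (.seq (matVecProg 0 6 7) (.seq (.cmpQuery 11 8 7)
      (.seq (.ite 7 4 (.seq (.const 11 1) .skip) .skip) (.ite 3 11 replaceProg .skip)))))))))

/-- Query the linear oracle on the vector in array `a` and update the incumbent. -/
def processProg (a : ℕ) : Cmd :=
  .seq (.linQuery a 10 6) (.ite 10 4 compareProg (.ite 4 10 (.seq (.const 8 1) .skip) .skip))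

variable {O : Oracles d n} {M : ℕ} {σ : State} {r : ℕ} {W : Matrix (Fin d) (Fin n) ℤ}
  {A : Matrix (Fin m) (Fin n) ℤ} {b : Fin m → ℤ} {c : (Fin d → ℝ) → ℝ}

theorem bitSize_le_vecSize (v : Fin n → ℤ) (j : Fin n) : bitSize (v j) ≤ vecSize v :=
  Finset.le_sup (f := fun j => bitSize (v j)) (Finset.mem_univ j)

theorem vecSize_le {v : Fin n → ℤ} {s : ℕ} (h : ∀ j, bitSize (v j) ≤ s) : vecSize v ≤ s :=
  Finset.sup_le fun j _ => h j

theorem runs_replaceProg {x : Fin n → ℕ} (hσ : Constants W σ)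
    (hx : ∀ j : Fin n, σ.arr 6 j = x j) (hv : ∀ i : Fin d, σ.arr 7 i = W.mulVec (fun j => (x j : ℤ)) i)
    (hxr : vecSize (fun j => (x j : ℤ)) ≤ r) (hvM : ∀ i : Fin d, bitSize (σ.arr 7 i) ≤ M + r)
    (hnM : n < M) (hdM : d < M) (hM : 2 < M) :
    Runs O M replaceProg σ r (7 * n + 7 * d + 12) (fun τ _ => τ.var 7 = 1 ∧
      (∀ j : Fin n, τ.arr 9 j = x j) ∧
      ∀ i : Fin d, τ.arr 8 i = W.mulVec (fun j => (x j : ℤ)) i) := by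
  have hsz : ∀ v < M, ∀ r, bitSize (v : ℤ) ≤ M + r := fun v hv r => bitSize_natCast_le_of_lt hv
  refine Runs.mono (T' := ((1 + 1 + (d * 7 + 2)) + 1 + 1 + 1 + (n * 7 + 2)) + 1 + 1 + 1) ?_ (by omega)
    (fun _ _ _ _ h => h)
  refine Runs.const (by simp; omega) (Runs.const (by simp; omega) (Runs.add ?_ ?_))
  · simpa [hσ.zero, hσ.numVars] using hsz n hnM r
  refine Runs.seq (runs_copyProg (src := 0) (dst := 0) (len := n) (by decide) (by simp [hσ.one])
    (by simp) (by simp) (by simp [hσ.zero, hσ.numVars]) (fun l hl => ?_) hnM (by omega) (by omega))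
    fun τ r' hr hF ⟨h9, _⟩ => ?_
  · have := (bitSize_le_vecSize _ ⟨l, hl⟩).trans hxr
    simp only [← hx] at this
    simp only [State.arr_setVar, Nat.zero_add]; omega
  have hτ : Constants W τ := Constants.of_frame (p := replaceProg) hσ ⟨fun x hx => by
      rw [hF.var x (by simp_all [replaceProg, Cmd.WritesVar])]
      simp_all [replaceProg, Cmd.WritesVar], fun x hx => by
      rw [hF.arr x (by simp_all [replaceProg, Cmd.WritesArr])]; rfl⟩
    (by simp [replaceProg, copyProg, Cmd.for, Cmd.WritesVar])
    (by simp [replaceProg, copyProg, Cmd.for, Cmd.WritesVar])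
    (by simp [replaceProg, copyProg, Cmd.for, Cmd.WritesVar])
    (by simp [replaceProg, copyProg, Cmd.for, Cmd.WritesVar])
    (by simp [replaceProg, copyProg, Cmd.for, Cmd.WritesArr])
  have e7 : τ.arr 7 = σ.arr 7 := by
    rw [hF.arr 7 (by simp [copyProg, Cmd.for, Cmd.WritesArr])]; rfl
  refine Runs.const (by simp; omega) (Runs.const (by simp; omega) (Runs.add ?_ ?_))
  · simpa [hτ.zero, hτ.dim] using hsz d hdM r'
  refine Runs.seq (runs_copyProg (src := 0) (dst := 0) (len := d) (by decide) (by simp [hτ.one])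
    (by simp) (by simp) (by simp [hτ.zero, hτ.dim]) (fun l hl => ?_) hdM (by omega) (by omega))
    fun ρ r'' hr' hF' ⟨h8, _⟩ => ?_
  · have := hvM ⟨l, hl⟩
    simp only [State.arr_setVar, Nat.zero_add, e7]; simp at this; omega
  refine Runs.const (by simp; omega) (Runs.skip ⟨by simp, fun j => ?_, fun i => ?_⟩)
  · rw [State.arr_setVar, hF'.arr 9 (by simp [copyProg, Cmd.for, Cmd.WritesArr])]
    simpa [hx] using h9 j j.2
  · simpa [e7, hv] using h8 i i.2

/-- The last conjunct says that the best value never decreases. This is what keeps all earlier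
queries covered. -/
theorem runs_compareProg (hO : IsComparisonOracle c O.cmp) (hσ : Constants W σ)
    (hI : Incumbent W A b σ r) {x : Fin n → ℕ} (hx : ∀ j : Fin n, σ.arr 6 j = x j)
    (hxf : x ∈ feasible A b) (hxr : vecSize (fun j => (x j : ℤ)) ≤ r) {L : ℕ}
    (hL : ∀ i j, bitSize (W i j) ≤ L) (hLM : L + n + 1 ≤ M) (hdn : d * n + n + d + 2 < M) :
    Runs O M compareProg σ r (d * (n * 9 + 11) + 7 * n + 7 * d + 27) (fun τ r' =>
      Incumbent W A b τ r' ∧ τ.var 7 = 1 ∧ objective W c x ≤ c (τ.bestValue d) ∧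
      (σ.var 7 = 1 → c (σ.bestValue d) ≤ c (τ.bestValue d))) := by
  have hsz : ∀ v < M, ∀ r, bitSize (v : ℤ) ≤ M + r := fun v hv r => bitSize_natCast_le_of_lt hv
  refine Runs.mono
    (T' := ((((7 * n + 7 * d + 12) + 1) + (2 + 1)) + 1 + (d * (n * 9 + 11) + 4)) + 1 + 1 + 1 + 1 + 1 + 1)
    ?_ (by omega) (fun _ _ _ _ h => h)
  refine Runs.add ?_ (Runs.add ?_ (Runs.const (by simp; omega) (Runs.add ?_
    (Runs.const (by simp; omega) (Runs.const (by simp; omega) ?_)))))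
  · simpa [hσ.zero, hσ.dim] using hsz d (by omega) r
  · simpa [hσ.zero, hσ.numVars] using hsz n (by omega) r
  · simpa [hσ.zero, hσ.numVars] using hsz n (by omega) r
  refine Runs.seq (runs_matVecProg (sa := 1) (ra := n) (pb := 0) (len := n) (rows := d) (out := 0)
    (X := L) (Y := r) (by decide) (by decide) (by simp [hσ.zero]) (by simp [hσ.one])
    (by simp) (by simp [hσ.zero, hσ.numVars]) (by simp [hσ.zero, hσ.dim])
    (by simp [hσ.zero, hσ.numVars]) (by simp) (by simp)
    (fun i hi l hl => by
      simpa [hσ.entry ⟨i, hi⟩ ⟨l, hl⟩] using hL ⟨i, hi⟩ ⟨l, hl⟩)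
    (fun l hl => by
      have := (bitSize_le_vecSize _ ⟨l, hl⟩).trans hxr
      simp only [← hx] at this
      simpa using this)
    (by omega) (by omega) (by omega) (by omega) (by simp; omega) (by omega) (by omega))
    fun τ r' hr hF ⟨h7, _⟩ => ?_
  have hτ : Constants W τ := Constants.of_frame (p := compareProg) hσ ⟨fun x hx => by
      rw [hF.var x (by simp_all [compareProg, Cmd.WritesVar])]
      simp_all [compareProg, Cmd.WritesVar], fun x hx => by
      rw [hF.arr x (by simp_all [compareProg, Cmd.WritesArr])]; rfl⟩
    (by simp [compareProg, replaceProg, matVecProg, dotProg, copyProg, Cmd.for, Cmd.WritesVar])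
    (by simp [compareProg, replaceProg, matVecProg, dotProg, copyProg, Cmd.for, Cmd.WritesVar])
    (by simp [compareProg, replaceProg, matVecProg, dotProg, copyProg, Cmd.for, Cmd.WritesVar])
    (by simp [compareProg, replaceProg, matVecProg, dotProg, copyProg, Cmd.for, Cmd.WritesVar])
    (by simp [compareProg, replaceProg, matVecProg, dotProg, copyProg, Cmd.for, Cmd.WritesArr])
  have fv : ∀ x, x = 7 ∨ x = 8 → τ.var x = σ.var x := fun x hx => by
    rw [hF.var x (by rcases hx with rfl | rfl <;> simp [matVecProg, dotProg, Cmd.for, Cmd.WritesVar])]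
    rcases hx with rfl | rfl <;> simp
  have fa : ∀ a, a ≠ 7 → τ.arr a = σ.arr a := fun a ha => by
    rw [hF.arr a (by simp [matVecProg, dotProg, Cmd.for, Cmd.WritesArr, ha])]; rfl
  have hv : ∀ i : Fin d, τ.arr 7 i = W.mulVec (fun j => (x j : ℤ)) i := fun i => by
    have := h7 i i.2
    simp only [Nat.zero_add, State.arr_setVar, mul_one] at this
    rw [this, Finset.sum_range]
    exact Finset.sum_congr rfl fun j _ => by rw [hσ.entry, hx]
  have hvb : ∀ i : Fin d, bitSize (τ.arr 7 i) ≤ M + r' := fun i => by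
    have := bitSize_sum_mul_le (f := fun l => σ.arr 0 (i * n + l)) (g := σ.arr 6) (len := n)
      (X := L) (Y := r)
      (fun l hl => by simpa [hσ.entry i ⟨l, hl⟩] using hL i ⟨l, hl⟩)
      (fun l hl => by
        have := (bitSize_le_vecSize _ ⟨l, hl⟩).trans hxr
        simp only [← hx] at this
        exact this)
    have h := h7 i i.2
    simp only [Nat.zero_add, State.arr_setVar, mul_one] at h
    rw [h]; omega
  have hval : (fun i : Fin d => (τ.arr 7 i : ℝ)) =
      fun i => ((W.mulVec (fun j => (x j : ℤ)) i : ℤ) : ℝ) := by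
    funext i; rw [hv]
  have hsame : SameIncumbent σ τ := ⟨fv 7 (.inl rfl), fv 8 (.inr rfl), fa 8 (by decide), fa 9 (by decide)⟩
  have hbest : τ.bestValue d = σ.bestValue d := by
    funext i; simp only [State.bestValue, hsame.arr8]
  refine Runs.of_write_seq (.cmpQuery τ 11 8 7) ?_ ?_
  · unfold Oracles.answer; split_ifs <;> simp <;> omega
  set w := O.answer (τ.vec d 8) (τ.vec d 7) with hw
  have hw' : w = if c (σ.bestValue d) ≤ objective W c x then 1 else 0 := by
    rw [hw, Oracles.answer]
    have := hO (fun i => ((τ.vec d 8 i : ℤ) : ℝ)) (fun i => ((τ.vec d 7 i : ℤ) : ℝ))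
    simp only [this]
    rw [← hbest, objective, ← hval]
    rfl
  -- Without an incumbent, array `8` holds no meaningful point. The oracle's answer is then
  -- overwritten by `1`, which forces the replacement.
  refine Runs.mono (T' := 7 * n + 7 * d + 12 + 1 + (2 + 1)) (Runs.seq (Q₁ := fun ρ _ => ρ.var 11 =
      if τ.var 7 < 1 then 1 else w) (Runs.ite (fun h => ?_) (fun h => ?_)) ?_) (by omega)
      fun _ _ _ _ h => h
  · refine Runs.const (by simp; omega) (Runs.skip ?_)
    simp [hτ.one] at h
    simp [h]
  · refine (Runs.skip ?_).mono (by omega) fun _ _ _ _ h => h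
    simp [hτ.one] at h
    simp [h]
  intro ρ r'' hr' hF' h11
  have hF'' : Frame (.const 11 1) τ ρ := ⟨fun x hx => by
    rw [hF'.var x (by simpa [Cmd.WritesVar] using hx)]; simp_all [Cmd.WritesVar], fun a ha => by
    rw [hF'.arr a (by simp [Cmd.WritesArr])]; rfl⟩
  have hρ : Constants W ρ := Constants.of_frame hτ hF'' (by simp [Cmd.WritesVar])
    (by simp [Cmd.WritesVar]) (by simp [Cmd.WritesVar]) (by simp [Cmd.WritesVar])
    (by simp [Cmd.WritesArr])
  have fa' : ∀ a, ρ.arr a = τ.arr a := fun a => hF''.arr a (by simp [Cmd.WritesArr])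
  have hsame' : SameIncumbent σ ρ := ⟨by rw [hF''.var 7 (by simp [Cmd.WritesVar]), hsame.var7],
    by rw [hF''.var 8 (by simp [Cmd.WritesVar]), hsame.var8], by rw [fa', hsame.arr8],
    by rw [fa', hsame.arr9]⟩
  rw [fv 7 (.inl rfl), hw'] at h11
  refine Runs.ite (fun hlt => ?_) (fun h => ?_)
  · refine (runs_replaceProg hρ (x := x) (fun j => by rw [fa', fa 6 (by decide), hx])
      (fun i => by rw [fa', hv]) (by omega) (fun i => by rw [fa']; have := hvb i; omega) (by omega)
      (by omega) (by omega)).mono le_rfl ?_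
    rintro π s hs hFπ ⟨g7, g9, g8⟩
    have hπ : objective W c x = c (π.bestValue d) := by
      rw [objective]; congr 1; funext i; simp only [State.bestValue, g8]
    refine ⟨⟨Or.inr g7, fun _ => ⟨x, hxf, g9, g8, by omega⟩, ?_⟩, g7, hπ.le, fun h => ?_⟩
    · rw [hFπ.var 8 (by simp [replaceProg, copyProg, Cmd.for, Cmd.WritesVar]), hsame'.var8]
      exact hI.unbounded
    · rw [hρ.zero, h11] at hlt
      rw [← hπ]
      by_contra hcon
      simp [hcon, h] at hlt
  · rw [hρ.zero, h11] at h
    have h1 : σ.var 7 = 1 := by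
      rcases hI.flag with h0 | h1
      · simp [h0] at h
      · exact h1
    simp only [h1, lt_irrefl, if_false] at h
    have h2 : ¬ c (σ.bestValue d) ≤ objective W c x := by
      intro h2; simp [h2] at h
    have hb : ρ.bestValue d = σ.bestValue d := by
      funext i; simp only [State.bestValue, hsame'.arr8]
    refine (Runs.skip ⟨hsame'.incumbent hI (by omega), hsame'.var7.trans h1, ?_, fun _ => ?_⟩).mono
      (by omega) fun _ _ _ _ h => h
    · rw [hb]; exact (not_le.1 h2).le
    · rw [hb]

theorem cast_mem_polyhedron {x : Fin n → ℕ} (hx : x ∈ feasible A b) :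
    (fun j => (x j : ℝ)) ∈ polyhedron A b := by
  refine ⟨fun j => Nat.cast_nonneg _, funext fun i => ?_⟩
  have := congrFun hx i
  simp only [Matrix.mulVec, dotProduct] at this ⊢
  rw [← this]
  simp

theorem finite_feasible_of_isBounded (h : Bornology.IsBounded (polyhedron A b)) :
    (feasible A b).Finite := by
  obtain ⟨C, hC⟩ := h.exists_norm_le
  refine (Set.finite_Iic (fun _ : Fin n => ⌈C⌉₊)).subset fun x hx j => ?_
  have h1 := hC _ (cast_mem_polyhedron hx)
  have h2 := (norm_le_pi_norm (fun j => (x j : ℝ)) j).trans h1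
  simp only [RCLike.norm_natCast] at h2
  exact_mod_cast h2.trans (Nat.le_ceil C)

/-- The justification of the answer `2`: a bounded polyhedron has only finitely many integer points,
on which every objective is bounded. -/
theorem not_isBounded_polyhedron {h : Fin n → ℤ}
    (hu : ¬ BddAbove ((fun y : Fin n → ℕ => h ⬝ᵥ (fun j => (y j : ℤ))) '' feasible A b)) :
    ¬ Bornology.IsBounded (polyhedron A b) := fun hb =>
  hu ((finite_feasible_of_isBounded hb).image _).bddAbove

/-- The hypothesis `3 ≤ M` leaves room for the status `2`, which takes three bits with its sign. -/
theorem runs_linQuery {a s ρ : ℕ} {h : Fin n → ℤ} (hh : ∀ j : Fin n, σ.arr a j = h j)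
    (hhM : ∀ j, bitSize (h j) ≤ M) (hM : 3 ≤ M) :
    Runs O M (.linQuery a s ρ) σ r 1 (fun τ r' => τ = (O.lin h).record σ s ρ ∧
      ∀ x, O.lin h = .optimal x → vecSize (fun j => (x j : ℤ)) ≤ r') := by
  have hv : σ.vec n a = h := funext hh
  have he := Exec.linQuery (O := O) σ a s ρ
  rw [hv] at he
  refine ⟨_, _, he, ?_⟩
  have := vecSize_le hhM
  cases hr : O.lin h with
  | optimal x => simp [LinReply.usage, this]; omega
  | infeasible => simp [LinReply.usage, this]; omega
  | unbounded => simp [LinReply.usage, this]; omega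

/-- Queries covered before stay covered, since the incumbent's value never decreases and neither
flag `7` nor flag `8` is ever reset. -/
theorem runs_processProg {a : ℕ} {h : Fin n → ℤ} (hO : IsComparisonOracle c O.cmp)
    (hlin : IsLinearOracle A b O.lin) (hσ : Constants W σ) (hI : Incumbent W A b σ r)
    (hh : ∀ j : Fin n, σ.arr a j = h j) (hhM : ∀ j, bitSize (h j) ≤ M) {L : ℕ}
    (hL : ∀ i j, bitSize (W i j) ≤ L) (hLM : L + n + 1 ≤ M) (hdn : d * n + n + d + 2 < M) :
    Runs O M (processProg a) σ r (d * (n * 9 + 11) + 7 * n + 7 * d + 29) (fun τ r' =>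
      Incumbent W A b τ r' ∧ Covered W c O τ h ∧
      ∀ h', Covered W c O σ h' → Covered W c O τ h') := by
  refine Runs.mono (T' := (d * (n * 9 + 11) + 7 * n + 7 * d + 27 + 1) + 1) (Runs.seq
    (runs_linQuery hh hhM (by omega)) fun τ r' hr hF ⟨hτ, hx⟩ => ?_) (by omega)
    fun _ _ _ _ h => h
  have hC := hlin h
  have hcτ : Constants W τ := Constants.of_frame hσ hF (by simp [Cmd.WritesVar])
    (by simp [Cmd.WritesVar]) (by simp [Cmd.WritesVar]) (by simp [Cmd.WritesVar])
    (by simp [Cmd.WritesArr])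
  have hs : SameIncumbent σ τ := ⟨hF.var 7 (by simp [Cmd.WritesVar]),
    hF.var 8 (by simp [Cmd.WritesVar]), hF.arr 8 (by simp [Cmd.WritesArr]),
    hF.arr 9 (by simp [Cmd.WritesArr])⟩
  have hIτ := hs.incumbent hI hr
  cases hrep : O.lin h with
  | optimal x =>
    rw [hrep] at hτ hC
    simp only [LinReply.record] at hτ
    have h10 : τ.var 10 = 0 := by rw [hτ]; simp
    have h6 : ∀ j : Fin n, τ.arr 6 j = x j := fun j => by rw [hτ]; simp [State.arr_setVec]
    refine Runs.ite (fun _ => ?_) (fun h => absurd (by simp [h10, hcτ.one]) h)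
    refine (runs_compareProg hO hcτ hIτ h6 hC.1 (hx x hrep) hL hLM hdn).mono le_rfl ?_
    rintro ρ r'' hr'' hF' ⟨h1, h2, h3, h4⟩
    refine ⟨h1, by simp [Covered, hrep, h2, h3], fun h' hc' => ?_⟩
    have hc'' := hs.covered hc'
    have h8 : ρ.var 8 = τ.var 8 := hF'.var 8 (by
      simp [compareProg, replaceProg, matVecProg, dotProg, copyProg, Cmd.for, Cmd.WritesVar])
    unfold Covered at hc'' ⊢
    split at hc''
    · exact ⟨h2, hc''.2.trans (h4 hc''.1)⟩
    · trivial
    · exact h8.trans hc''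
  | infeasible =>
    rw [hrep] at hτ
    have h10 : τ.var 10 = 1 := by rw [hτ]; simp [LinReply.record]
    refine Runs.ite (fun h => absurd h (by simp [h10, hcτ.one])) (fun _ => ?_)
    refine Runs.mono (T' := 2 + 1) (Runs.ite (fun h => absurd h (by simp [h10, hcτ.one]))
      fun _ => (Runs.skip (Q := fun τ' s => τ' = τ ∧ s = r') ⟨rfl, rfl⟩).mono (by omega)
        fun _ _ _ _ h => h) (by omega) ?_
    rintro ρ r'' - - ⟨rfl, rfl⟩
    exact ⟨hIτ, by simp [Covered, hrep], fun h' hc' => hs.covered hc'⟩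
  | unbounded =>
    rw [hrep] at hτ hC
    have h10 : τ.var 10 = 2 := by rw [hτ]; simp [LinReply.record]
    refine Runs.ite (fun h => absurd h (by simp [h10, hcτ.one])) (fun _ => ?_)
    refine Runs.mono (T' := 2 + 1) (Runs.ite (fun _ => Runs.const (by simp; omega)
      (Runs.skip (Q := fun τ' s => τ' = τ.setVar 8 1 ∧ s = r') ⟨rfl, rfl⟩))
        (fun h => absurd (by simp [h10, hcτ.one]) h)) (by omega) ?_
    rintro ρ r'' - - ⟨rfl, rfl⟩
    refine ⟨⟨?_, fun h7 => ?_, Or.inr ⟨by simp, not_isBounded_polyhedron hC⟩⟩,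
      by simp [Covered, hrep], fun h' hc' => ?_⟩
    · simpa using hIτ.flag
    · simpa using hIτ.point (by simpa using h7)
    · have hc'' := hs.covered hc'
      have hb : (τ.setVar 8 1).bestValue d = τ.bestValue d := rfl
      unfold Covered at hc'' ⊢
      split at hc''
      · simpa [hb] using hc''
      · trivial
      · simp

end ConvIntMax

namespace ConvIntMax

/-! ## Straight-line programs for polynomials -/

/-- A polynomial is evaluated at cells of the array `a` by a program that writes to variables from
`t` on only. -/
theorem exists_evalProg {ι : Type*} (a : ℕ) (idx : ι → ℕ) (p : MvPolynomial ι ℤ) :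
    ∃ K, ∀ t, ∃ q : Cmd, (∀ x, q.WritesVar x → t ≤ x) ∧ (∀ x, ¬ q.WritesArr x) ∧
      ∀ (d n : ℕ) (O : Oracles d n) (M : ℕ) (σ : State) (r β : ℕ) (v : ι → ℤ),
        (∀ i, σ.arr a (idx i) = v i) → (∀ i, bitSize (v i) ≤ β) → K * (β + 1) ≤ M →
        (∀ i, idx i < M) → bitSize (MvPolynomial.eval v p) ≤ K * (β + 1) ∧
        Runs O M q σ r K (fun τ _ => τ.var t = MvPolynomial.eval v p) := by
  -- One constant `K` controls both the number of steps and, multiplied by `β + 1`, the bit sizes.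
  -- It does not depend on the first free variable `t`, which changes in the recursion.
  induction p using MvPolynomial.induction_on with
  | C z =>
    refine ⟨bitSize z + 2, fun t => ⟨.seq (.const t z) .skip, by simp [Cmd.WritesVar],
      by simp [Cmd.WritesArr], fun d n O M σ r β v hv hβ hK hidx => ?_⟩⟩
    have h : bitSize z ≤ (bitSize z + 2) * (β + 1) :=
      (Nat.le_add_right _ 2).trans (Nat.le_mul_of_pos_right _ (by omega))
    refine ⟨by simpa using h, (Runs.const (by omega) (Runs.skip ?_)).mono (by omega)
      fun _ _ _ _ h => h⟩
    simp
  | add p q ihp ihq =>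
    obtain ⟨Kp, hp⟩ := ihp
    obtain ⟨Kq, hq⟩ := ihq
    refine ⟨Kp + Kq + 2, fun t => ?_⟩
    obtain ⟨cp, p1, p2, p3⟩ := hp t
    -- The second summand is evaluated from variable `t + 1` on, so that the first value survives in
    -- `t`.
    obtain ⟨cq, q1, q2, q3⟩ := hq (t + 1)
    refine ⟨.seq cp (.seq cq (.seq (.add t t (t + 1)) .skip)), ?_, ?_,
      fun d n O M σ r β v hv hβ hK hidx => ?_⟩
    · rintro x (h | h | rfl | h)
      exacts [p1 x h, (q1 x h).trans' (by omega), le_rfl, h.elim]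
    · rintro x (h | h | h | h)
      exacts [p2 x h, q2 x h, h, h]
    rw [add_mul, add_mul] at hK ⊢
    obtain ⟨bp, rp⟩ := p3 d n O M σ r β v hv hβ (by omega) hidx
    have hb : bitSize (MvPolynomial.eval v (p + q)) ≤ Kp * (β + 1) + Kq * (β + 1) + 2 * (β + 1) := by
      rw [map_add]
      refine (bitSize_add_le (bp.trans (Nat.le_add_right _ (Kq * (β + 1)))) ?_).trans (by omega)
      exact (q3 d n O M σ r β v hv hβ (by omega) hidx).1.trans (Nat.le_add_left _ _)
    refine ⟨hb, Runs.mono (T' := (1 + 1 + Kq) + Kp) (rp.seq fun τ r' _ hF hτ => ?_) (by omega)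
      fun _ _ _ _ h => h⟩
    obtain ⟨bq, rq⟩ := q3 d n O M τ r' β v (fun i => by rw [hF.arr a (p2 a), hv]) hβ (by omega) hidx
    refine rq.seq fun ρ r'' _ hF' hρ => ?_
    have ht : ρ.var t = MvPolynomial.eval v p := by
      rw [hF'.var t (fun h => by have := q1 t h; omega), hτ]
    refine Runs.add ?_ (Runs.skip ?_)
    · rw [ht, hρ, ← map_add]; omega
    · simp [ht, hρ]
  | mul_X p i ih =>
    obtain ⟨K, hp⟩ := ih
    refine ⟨K + 5, fun t => ?_⟩
    obtain ⟨cp, p1, p2, p3⟩ := hp t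
    refine ⟨.seq cp (.seq (.const (t + 1) (idx i)) (.seq (.load (t + 1) a (t + 1))
      (.seq (.mul t t (t + 1)) .skip))), ?_, ?_, fun d n O M σ r β v hv hβ hK hidx => ?_⟩
    · rintro x (h | rfl | rfl | rfl | h)
      exacts [p1 x h, by omega, by omega, le_rfl, h.elim]
    · rintro x (h | h | h | h | h)
      exacts [p2 x h, h, h, h, h]
    rw [add_mul] at hK ⊢
    obtain ⟨bp, rp⟩ := p3 d n O M σ r β v hv hβ (by omega) hidx
    have hb : bitSize (MvPolynomial.eval v (p * MvPolynomial.X i)) ≤ K * (β + 1) + 5 * (β + 1) := by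
      rw [map_mul, MvPolynomial.eval_X]
      exact (bitSize_mul_le bp (hβ i)).trans (by omega)
    refine ⟨hb, Runs.mono (T' := (1 + 1 + 1 + 1) + K) (rp.seq fun τ r' _ hF hτ => ?_) (by omega)
      fun _ _ _ _ h => h⟩
    have hvτ : τ.arr a (idx i) = v i := by rw [hF.arr a (p2 a), hv]
    refine Runs.const (bitSize_natCast_le_of_lt (hidx i)) (Runs.load (idx i) (by simp) ?_
      (Runs.mul ?_ (Runs.skip ?_)))
    · have := hβ i
      simp only [State.arr_setVar, hvτ]; omega
    · simp only [State.var_setVar, State.arr_setVar, hvτ]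
      rw [map_mul, MvPolynomial.eval_X] at hb
      simp [hτ]; omega
    · simp [hτ, hvτ]

/-- Finitely many polynomials are evaluated at cells of the array `a`, the values being written into
the array `o`. -/
theorem exists_evalVecProg {ι : Type*} (a o : ℕ) (hao : a ≠ o) (idx : ι → ℕ) (t : ℕ) :
    ∀ (e : ℕ) (P : Fin e → MvPolynomial ι ℤ),
    ∃ (K : ℕ) (q : Cmd), (∀ x, q.WritesVar x → t ≤ x) ∧ (∀ x, q.WritesArr x → x = o) ∧
      ∀ (d n : ℕ) (O : Oracles d n) (M : ℕ) (σ : State) (r β : ℕ) (v : ι → ℤ),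
        (∀ i, σ.arr a (idx i) = v i) → (∀ i, bitSize (v i) ≤ β) → K * (β + 1) ≤ M →
        (∀ i, idx i < M) → e < M →
        (∀ j, bitSize (MvPolynomial.eval v (P j)) ≤ K * (β + 1)) ∧
        Runs O M q σ r K (fun τ _ => ∀ j : Fin e, τ.arr o j = MvPolynomial.eval v (P j)) := by
  intro e
  induction e with
  | zero =>
    refine fun P => ⟨1, .skip, by simp [Cmd.WritesVar], by simp [Cmd.WritesArr], fun d n O M σ r β v
      _ _ _ _ _ => ⟨fun j => j.elim0, Runs.skip fun j => j.elim0⟩⟩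
  | succ e ih =>
    intro P
    obtain ⟨K, q, q1, q2, q3⟩ := ih fun j => P j.castSucc
    obtain ⟨K', hp⟩ := exists_evalProg a idx (P (Fin.last e))
    obtain ⟨p, p1, p2, p3⟩ := hp t
    refine ⟨K + K' + 3, .seq q (.seq p (.seq (.const (t + 1) e) (.seq (.store o (t + 1) t) .skip))),
      ?_, ?_, fun d n O M σ r β v hv hβ hK hidx he => ?_⟩
    · rintro x (h | h | rfl | h | h)
      exacts [q1 x h, p1 x h, by omega, h.elim, h.elim]
    · rintro x (h | h | h | rfl | h)
      exacts [q2 x h, (p2 x h).elim, h.elim, rfl, h.elim]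
    rw [add_mul, add_mul] at hK ⊢
    obtain ⟨bq, rq⟩ := q3 d n O M σ r β v hv hβ (by omega) hidx (by omega)
    refine ⟨fun j => ?_, Runs.mono (T' := (1 + 1 + 1 + K') + K) (rq.seq fun τ r' _ hF hτ => ?_)
      (by omega) fun _ _ _ _ h => h⟩
    · refine Fin.lastCases ?_ (fun j => ?_) j
      · exact (p3 d n O M σ r β v hv hβ (by omega) hidx).1.trans (by omega)
      · exact (bq j).trans (by omega)
    obtain ⟨bp, rp⟩ := p3 d n O M τ r' β v
      (fun i => by rw [hF.arr a (fun h => hao (q2 a h)), hv]) hβ (by omega) hidx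
    refine rp.seq fun ρ r'' _ hF' hρ => ?_
    refine Runs.const (bitSize_natCast_le_of_lt (by omega)) (Runs.store e (by simp) ?_
      (Runs.skip fun j => ?_))
    · simp [hρ]; omega
    · refine Fin.lastCases ?_ (fun j => ?_) j
      · simp [hρ]
      · have : (j : ℕ) ≠ e := j.2.ne
        simp [this, hF'.arr o (p2 o), hτ]

/-- The vector `det B • adj B • 1`, a nonnegative multiple of the solution `g` of `B g = 1`. -/
def normalVec {d : ℕ} (B : Matrix (Fin d) (Fin d) ℤ) : Fin d → ℤ :=
  fun i => B.det * ∑ j, B.adjugate i j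

/-- For fixed `d` the entries of `normalVec` are fixed integer polynomials in the `d * d` entries of
the matrix, obtained from the generic matrix. A straight-line program thus computes them in
constantly many steps with linear growth of the sizes. Its variables start at `100 + d`, beyond the
loop counters of `nestProg`. -/
theorem exists_normalProg (d : ℕ) :
    ∃ (K : ℕ) (q : Cmd), (∀ x, q.WritesVar x → 100 + d ≤ x) ∧ (∀ x, q.WritesArr x → x = 11) ∧
      ∀ (n : ℕ) (O : Oracles d n) (M : ℕ) (σ : State) (r β : ℕ) (B : Matrix (Fin d) (Fin d) ℤ),
        (∀ l i : Fin d, σ.arr 10 (l * d + i) = B l i) → (∀ l i, bitSize (B l i) ≤ β) →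
        K * (β + 1) ≤ M → d * d + d < M →
        (∀ j, bitSize (normalVec B j) ≤ K * (β + 1)) ∧
        Runs O M q σ r K (fun τ _ => ∀ j : Fin d, τ.arr 11 j = normalVec B j) := by
  obtain ⟨K, q, q1, q2, q3⟩ := exists_evalVecProg 10 11 (by decide)
    (fun li : Fin d × Fin d => (li.1 : ℕ) * d + li.2) (100 + d) d
    (fun i => (Matrix.mvPolynomialX (Fin d) (Fin d) ℤ).det *
      ∑ j, (Matrix.mvPolynomialX (Fin d) (Fin d) ℤ).adjugate i j)
  refine ⟨K, q, q1, q2, fun n O M σ r β B hB hβ hK hM => ?_⟩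
  have hev : ∀ i, MvPolynomial.eval (fun li : Fin d × Fin d => B li.1 li.2)
      ((Matrix.mvPolynomialX (Fin d) (Fin d) ℤ).det *
        ∑ j, (Matrix.mvPolynomialX (Fin d) (Fin d) ℤ).adjugate i j) = normalVec B i := fun i => by
    have h := Matrix.mvPolynomialX_mapMatrix_eval B
    rw [map_mul, map_sum, RingHom.map_det, h, normalVec]
    congr 1
    refine Finset.sum_congr rfl fun j _ => ?_
    have h' := RingHom.map_adjugate (MvPolynomial.eval fun p : Fin d × Fin d => B p.1 p.2)
      (Matrix.mvPolynomialX (Fin d) (Fin d) ℤ)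
    rw [h] at h'
    rw [← h']
    rfl
  have := q3 d n O M σ r β (fun li => B li.1 li.2) (fun li => hB li.1 li.2) (fun li => hβ _ _) hK
    (fun li => by
      have : ((li.1 : ℕ) + 1) * d ≤ d * d := Nat.mul_le_mul_right _ li.1.2
      rw [add_mul] at this
      have := li.2.2
      omega) (by omega)
  simpa only [hev] using this

end ConvIntMax

namespace ConvIntMax

/-! ## Enumeration of the normal vectors -/

/-- Compute a vector `g` in array `11` by `q`, and process the query `Wᵀ g`. -/
def queryProg (q : Cmd) : Cmd :=
  .seq q (.seq (.add 30 0 3) (.seq (.const 31 1) (.seq (.add 22 0 3) (.seq (.add 25 5 3)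
    (.seq (.const 32 0) (.seq (.const 33 0) (.seq (matVecProg 0 11 5) (processProg 5))))))))

/-- Nested loops that run `body` for all choices of rows of the matrix in array `4` as rows
`0, …, l - 1` of the matrix in array `10`. -/
def nestProg (d : ℕ) (body : Cmd) : ℕ → Cmd
  | 0 => body
  | l + 1 => .for (100 + l) 6 (.seq (.mul 41 (100 + l) 5) (.seq (.const 42 (l * d : ℕ))
      (.seq (.add 43 5 3) (.seq (copyProg 4 10) (nestProg d body l)))))

/-- The number of steps of `nestProg`. -/
def nestSteps (d cnt T : ℕ) : ℕ → ℕ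
  | 0 => T
  | l + 1 => cnt * ((nestSteps d cnt T l + (d * 7 + 2) + 1 + 1 + 1) + 2) + 2

variable {d n m : ℕ} {O : Oracles d n} {M : ℕ} {σ : State} {r : ℕ} {W : Matrix (Fin d) (Fin n) ℤ}
  {A : Matrix (Fin m) (Fin n) ℤ} {b : Fin m → ℤ} {c : (Fin d → ℝ) → ℝ}

theorem nestProg_writesVar {body : Cmd} {l x : ℕ} (h : (nestProg d body l).WritesVar x) :
    body.WritesVar x ∨ (41 ≤ x ∧ x ≤ 45) ∨ (100 ≤ x ∧ x < 100 + l) := by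
  induction l with
  | zero => exact Or.inl h
  | succ l ih =>
    simp only [nestProg, copyProg, Cmd.for, Cmd.WritesVar, false_or, or_false] at h
    by_cases hn : (nestProg d body l).WritesVar x
    · rcases ih hn with h | h | h
      · exact Or.inl h
      · exact Or.inr (Or.inl h)
      · omega
    · simp only [hn, or_false] at h; omega

theorem nestProg_writesArr {body : Cmd} {l x : ℕ} (h : (nestProg d body l).WritesArr x) :
    body.WritesArr x ∨ x = 10 := by
  induction l with
  | zero => exact Or.inl h
  | succ l ih =>
    simp only [nestProg, copyProg, Cmd.for, Cmd.WritesArr, false_or, or_false] at h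
    rcases h with h | h
    · exact Or.inr h
    · exact ih h

/-- The first `cnt` rows of length `d` of array `4` are given by `V`, and variable `6` is `cnt`. -/
structure HoldsRows (d : ℕ) {cnt : ℕ} (V : Fin cnt → Fin d → ℤ) (σ : State) : Prop where
  count : σ.var 6 = cnt
  entry : ∀ (t : Fin cnt) (i : Fin d), σ.arr 4 ((t : ℕ) * d + i) = V t i

theorem HoldsRows.of_frame {cnt : ℕ} {V : Fin cnt → Fin d → ℤ} {σ τ : State} {p : Cmd}
    (h : HoldsRows d V σ) (hF : Frame p σ τ) (h6 : ¬ p.WritesVar 6) (h4 : ¬ p.WritesArr 4) :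
    HoldsRows d V τ :=
  ⟨(hF.var 6 h6).trans h.count, fun t i => by rw [hF.arr 4 h4]; exact h.entry t i⟩

/-- The rows from `l` on of the matrix in array `10` are the rows `f` of `V`. -/
def ChosenRows {cnt : ℕ} (V : Fin cnt → Fin d → ℤ) (l : ℕ) (f : Fin d → Fin cnt) (σ : State) :
    Prop :=
  ∀ l' : Fin d, l ≤ l' → ∀ i : Fin d, σ.arr 10 ((l' : ℕ) * d + i) = V (f l') i

/-- Induction on the depth: the loop at depth `l + 1` varies row `l`, while the rows above `l` stay
as prescribed by `f`. Its invariant says that all choices agreeing with `f` above `l` and with row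
index below `t` at `l` are covered. The conclusion repeats `ChosenRows` because the enclosing loops
continue with the same rows. -/
theorem runs_nestProg {cnt : ℕ} {V : Fin cnt → Fin d → ℤ} {body : Cmd} {T : ℕ}
    {h : (Fin d → Fin cnt) → Fin n → ℤ}
    (hv : ∀ x ∈ [0, 3, 4, 5, 6], ¬ body.WritesVar x)
    (hw : ∀ x, 100 ≤ x → x < 100 + d → ¬ body.WritesVar x)
    (ha : ∀ x ∈ [0, 4, 10], ¬ body.WritesArr x)
    (hbody : ∀ σ r f, Constants W σ → HoldsRows d V σ → Incumbent W A b σ r → ChosenRows V 0 f σ →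
      Runs O M body σ r T (fun τ r' => Incumbent W A b τ r' ∧ Covered W c O τ (h f) ∧
        ∀ h', Covered W c O σ h' → Covered W c O τ h'))
    (hV : ∀ t i, bitSize (V t i) ≤ M) (hcM : cnt * d + cnt + d * d + d < M) :
    ∀ l ≤ d, ∀ σ r f, Constants W σ → HoldsRows d V σ → Incumbent W A b σ r → ChosenRows V l f σ →
      Runs O M (nestProg d body l) σ r (nestSteps d cnt T l) (fun τ r' => Incumbent W A b τ r' ∧
        ChosenRows V l f τ ∧
        (∀ f', (∀ l' : Fin d, l ≤ l' → f' l' = f l') → Covered W c O τ (h f')) ∧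
        ∀ h', Covered W c O σ h' → Covered W c O τ h') := by
  simp only [List.forall_mem_cons, List.not_mem_nil, false_imp_iff, implies_true, and_true] at hv ha
  intro l
  induction l with
  | zero =>
    intro _ σ r f hσ hVσ hI hf
    refine (hbody σ r f hσ hVσ hI hf).mono le_rfl ?_
    rintro τ r' - hF ⟨h1, h2, h3⟩
    refine ⟨h1, fun l' hl' i => by rw [hF.arr 10 ha.2.2]; exact hf l' hl' i, fun f' hf' => ?_, h3⟩
    rwa [funext fun l' => hf' l' (Nat.zero_le _)]
  | succ l ih =>
    intro hl σ r f hσ hVσ hI hf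
    have nv : ∀ x, (body.WritesVar x ∨ (41 ≤ x ∧ x ≤ 45) ∨ (100 ≤ x ∧ x < 100 + l) → False) →
        ¬ (nestProg d body l).WritesVar x := fun x hx h => hx (nestProg_writesVar h)
    have na : ∀ x, (body.WritesArr x ∨ x = 10 → False) →
        ¬ (nestProg d body l).WritesArr x := fun x hx h => hx (nestProg_writesArr h)
    have n0 := nv 0 (by simp [hv])
    have n3 := nv 3 (by simp [hv])
    have n4 := nv 4 (by simp [hv])
    have n5 := nv 5 (by simp [hv])
    have n6 := nv 6 (by simp [hv])
    have nl := nv (100 + l) (by simp [hw (100 + l) (by omega) (by omega)]; omega)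
    have a0 := na 0 (by simp [ha])
    have a4 := na 4 (by simp [ha])
    refine (Runs.for (T := nestSteps d cnt T l + (d * 7 + 2) + 1 + 1 + 1) cnt hVσ.count hσ.one
      (by omega) (by omega) (by simp [Cmd.WritesVar, copyProg, Cmd.for, nl]; omega)
      (by simp [Cmd.WritesVar, copyProg, Cmd.for, n6])
      (by simp [Cmd.WritesVar, copyProg, Cmd.for, n4]) (by omega)
      (fun t τ r' => Incumbent W A b τ r' ∧ ChosenRows V (l + 1) f τ ∧
        (∀ f', (∀ l' : Fin d, l + 1 ≤ l' → f' l' = f l') → (f' ⟨l, hl⟩ : ℕ) < t →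
          Covered W c O τ (h f')) ∧ ∀ h', Covered W c O σ h' → Covered W c O τ h')
      ?_ ?_).mono le_rfl ?_
    · have hs : SameIncumbent σ (σ.setVar (100 + l) 0) :=
        ⟨by simp; omega, by simp; omega, rfl, rfl⟩
      exact ⟨hs.incumbent hI le_rfl, hf, fun f' _ h => absurd h (Nat.not_lt_zero _),
        fun h' => hs.covered⟩
    · rintro t ht τ r' hr hi hF ⟨hIτ, hfτ, hcov, hkeep⟩
      have hτ : Constants W τ := hσ.of_frame hF
        (by simp [Cmd.WritesVar, copyProg, Cmd.for, n3]; omega)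
        (by simp [Cmd.WritesVar, copyProg, Cmd.for, n4]; omega)
        (by simp [Cmd.WritesVar, copyProg, Cmd.for, n0]; omega)
        (by simp [Cmd.WritesVar, copyProg, Cmd.for, n5]; omega)
        (by simp [Cmd.WritesArr, copyProg, Cmd.for, a0])
      have hVτ : HoldsRows d V τ := hVσ.of_frame hF
        (by simp [Cmd.WritesVar, copyProg, Cmd.for, n6]; omega)
        (by simp [Cmd.WritesArr, copyProg, Cmd.for, a4])
      have htd : t * d + d ≤ cnt * d := by rw [← Nat.succ_mul]; gcongr; omega
      have hld : l * d + d ≤ d * d := by rw [← Nat.succ_mul]; gcongr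
      refine Runs.mul ?_ (Runs.const (bitSize_natCast_le_of_lt (by omega)) (Runs.add ?_ ?_))
      · rw [hi, hτ.dim]; exact_mod_cast bitSize_natCast_le_of_lt (by omega)
      · simpa [hτ.dim, hτ.zero] using bitSize_natCast_le_of_lt (by omega)
      refine Runs.seq (runs_copyProg (src := t * d) (dst := l * d) (len := d) (by decide)
        (by simp [hτ.one]) (by simp [hi, hτ.dim]) (by simp) (by simp [hτ.dim, hτ.zero])
        (fun i hi => ?_) (by omega) (by omega) (by omega)) fun ρ r'' hr'' hF' ⟨h1, h2⟩ => ?_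
      · simp only [State.arr_setVar]
        rw [hVτ.entry ⟨t, ht⟩ ⟨i, hi⟩]
        exact (hV _ _).trans (by omega)
      have hF2 : Frame (.seq (.const 41 0) (.seq (.const 42 0) (.seq (.const 43 0)
          (copyProg 4 10)))) τ ρ := ⟨fun x hx => by
        simp only [Cmd.WritesVar, not_or] at hx
        rw [hF'.var x hx.2.2.2]; simp [hx.1, hx.2.1, hx.2.2.1], fun x hx => by
        simp only [Cmd.WritesArr, not_or] at hx
        rw [hF'.arr x hx.2.2.2]; rfl⟩
      have hρ : Constants W ρ := hτ.of_frame hF2 (by simp [Cmd.WritesVar, copyProg, Cmd.for])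
        (by simp [Cmd.WritesVar, copyProg, Cmd.for]) (by simp [Cmd.WritesVar, copyProg, Cmd.for])
        (by simp [Cmd.WritesVar, copyProg, Cmd.for]) (by simp [Cmd.WritesArr, copyProg, Cmd.for])
      have hVρ : HoldsRows d V ρ := hVτ.of_frame hF2 (by simp [Cmd.WritesVar, copyProg, Cmd.for])
        (by simp [Cmd.WritesArr, copyProg, Cmd.for])
      have hs : SameIncumbent τ ρ := ⟨hF2.var 7 (by simp [Cmd.WritesVar, copyProg, Cmd.for]),
        hF2.var 8 (by simp [Cmd.WritesVar, copyProg, Cmd.for]),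
        hF2.arr 8 (by simp [Cmd.WritesArr, copyProg, Cmd.for]),
        hF2.arr 9 (by simp [Cmd.WritesArr, copyProg, Cmd.for])⟩
      have hfρ : ChosenRows V l (Function.update f ⟨l, hl⟩ ⟨t, ht⟩) ρ := by
        intro l' hl' i
        rcases hl'.eq_or_lt with h | h
        · obtain rfl : l' = ⟨l, hl⟩ := Fin.ext h.symm
          rw [Function.update_self, h1 i i.2, ← hVτ.entry ⟨t, ht⟩ i]
          simp
        · rw [Function.update_of_ne (fun h' => by simp [h'] at h), ← hfτ l' h i, h2]
          · simp
          · right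
            have : (l + 1) * d ≤ (l' : ℕ) * d := by gcongr; omega
            rw [add_mul] at this
            omega
      refine (ih (by omega) ρ r'' _ hρ hVρ (hs.incumbent hIτ hr'') hfρ).mono le_rfl ?_
      rintro π s hr3 hF3 ⟨g1, g2, g3, g4⟩
      have hs' : SameIncumbent π (π.setVar (100 + l) (t + 1)) :=
        ⟨by simp; omega, by simp; omega, rfl, rfl⟩
      refine ⟨hs'.incumbent g1 le_rfl, fun l' hl' i => ?_, fun f' hf' hft => hs'.covered ?_,
        fun h' hh' => hs'.covered (g4 h' (hs.covered (hkeep h' hh')))⟩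
      · rw [State.arr_setVar, g2 l' (by omega) i, Function.update_of_ne]
        rintro rfl; simp at hl'
      · rcases Nat.lt_succ_iff_lt_or_eq.1 hft with hlt | heq
        · exact g4 _ (hs.covered (hcov f' hf' hlt))
        · refine g3 f' fun l' hl' => ?_
          rcases hl'.eq_or_lt with h | h
          · obtain rfl : l' = ⟨l, hl⟩ := Fin.ext h.symm
            rw [Function.update_self]; exact Fin.ext heq
          · rw [Function.update_of_ne (fun h' => by simp [h'] at h), hf' l' h]
    · rintro τ r' - - ⟨-, h1, h2, h3, h4⟩
      exact ⟨h1, h2, fun f' hf' => h3 f' hf' (f' _).2, h4⟩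

/-- The transpose of `W` is read directly from array `0` by exchanging the two strides. -/
theorem runs_queryProg {cnt : ℕ} {V : Fin cnt → Fin d → ℤ} {q : Cmd} {K β : ℕ}
    (hq : ∀ x, q.WritesVar x → 100 + d ≤ x) (hqa : ∀ x, q.WritesArr x → x = 11)
    (hqr : ∀ (σ : State) (r : ℕ) (B : Matrix (Fin d) (Fin d) ℤ),
        (∀ l i : Fin d, σ.arr 10 (l * d + i) = B l i) → (∀ l i, bitSize (B l i) ≤ β) →
        (∀ j, bitSize (normalVec B j) ≤ K * (β + 1)) ∧
        Runs O M q σ r K (fun τ _ => ∀ j : Fin d, τ.arr 11 j = normalVec B j))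
    (hO : IsComparisonOracle c O.cmp) (hlin : IsLinearOracle A b O.lin) {L : ℕ}
    (hL : ∀ i j, bitSize (W i j) ≤ L) (hLM : L + n + K * (β + 1) + d + 1 ≤ M)
    (hdn : d * n + n + d + 2 < M) (hV : ∀ t i, bitSize (V t i) ≤ β)
    (σ : State) (r : ℕ) (f : Fin d → Fin cnt) (hσ : Constants W σ)
    (hI : Incumbent W A b σ r) (hf : ChosenRows V 0 f σ) :
    Runs O M (queryProg q) σ r
      ((d * (n * 9 + 11) + 7 * n + 7 * d + 29) + (n * (d * 9 + 11) + 4) + 6 + K) (fun τ r' =>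
      Incumbent W A b τ r' ∧ Covered W c O τ (W.transpose.mulVec (normalVec fun l => V (f l))) ∧
        ∀ h', Covered W c O σ h' → Covered W c O τ h') := by
  obtain ⟨hb, hr⟩ := hqr σ r (fun l => V (f l)) (fun l i => hf l (Nat.zero_le _) i)
    (fun l i => hV _ _)
  set g := normalVec fun l => V (f l)
  have nq : ∀ x < 100, ¬ q.WritesVar x := fun x hx h => by have := hq x h; omega
  have na : ∀ x, x ≠ 11 → ¬ q.WritesArr x := fun x hx h => hx (hqa x h)
  refine Runs.mono (T' := ((d * (n * 9 + 11) + 7 * n + 7 * d + 29) + (n * (d * 9 + 11) + 4)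
    + 1 + 1 + 1 + 1 + 1 + 1) + K) (hr.seq fun τ r' hr hF hτg => ?_) (by omega) fun _ _ _ _ h => h
  have hτ : Constants W τ := hσ.of_frame hF (nq 3 (by omega)) (nq 4 (by omega)) (nq 0 (by omega))
    (nq 5 (by omega)) (na 0 (by omega))
  have hs : SameIncumbent σ τ := ⟨hF.var 7 (nq 7 (by omega)), hF.var 8 (nq 8 (by omega)),
    hF.arr 8 (na 8 (by omega)), hF.arr 9 (na 9 (by omega))⟩
  have hsz : ∀ v < M, ∀ r, bitSize (v : ℤ) ≤ M + r := fun v hv r => bitSize_natCast_le_of_lt hv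
  refine Runs.add ?_ (Runs.const (by simp; omega) (Runs.add ?_ (Runs.add ?_
    (Runs.const (by simp; omega) (Runs.const (by simp; omega) ?_)))))
  · simpa [hτ.zero, hτ.numVars] using hsz n (by omega) r'
  · simpa [hτ.zero, hτ.numVars] using hsz n (by omega) r'
  · simpa [hτ.zero, hτ.dim] using hsz d (by omega) r'
  have hWa : ∀ i < n, ∀ l < d, bitSize (τ.arr 0 (i * 1 + l * n)) ≤ L := fun i hi l hl => by
    have := hL ⟨l, hl⟩ ⟨i, hi⟩
    rw [← hτ.entry] at this
    simpa [add_comm] using this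
  have hga : ∀ l < d, bitSize (τ.arr 11 l) ≤ K * (β + 1) := fun l hl => by
    rw [hτg ⟨l, hl⟩]; exact hb _
  refine Runs.seq (runs_matVecProg (sa := n) (ra := 1) (pb := 0) (len := d) (rows := n) (out := 0)
    (X := L) (Y := K * (β + 1)) (by decide) (by decide) (by simp [hτ.zero]) (by simp [hτ.one])
    (by simp [hτ.zero, hτ.numVars]) (by simp [hτ.zero, hτ.dim]) (by simp [hτ.zero, hτ.numVars])
    (by simp) (by simp) (by simp) (fun i hi l hl => by simpa using hWa i hi l hl)
    (fun l hl => by simpa using hga l hl)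
    (by omega) (by omega) (by omega) (by omega) (by omega) (by omega) (by omega))
    fun ρ r'' hr'' hF' ⟨h5, _⟩ => ?_
  have hF2 : Frame (.seq (.const 30 0) (.seq (.const 31 0) (.seq (.const 22 0) (.seq (.const 25 0)
      (.seq (.const 32 0) (.seq (.const 33 0) (matVecProg 0 11 5))))))) τ ρ := ⟨fun x hx => by
    simp only [Cmd.WritesVar, not_or] at hx
    rw [hF'.var x (by simp only [hx, not_false_eq_true])]
    simp [hx], fun x hx => by
    simp only [Cmd.WritesArr, not_or] at hx
    rw [hF'.arr x (by simp only [hx, not_false_eq_true])]; rfl⟩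
  have hρ : Constants W ρ := hτ.of_frame hF2
    (by simp [Cmd.WritesVar, matVecProg, dotProg, Cmd.for])
    (by simp [Cmd.WritesVar, matVecProg, dotProg, Cmd.for])
    (by simp [Cmd.WritesVar, matVecProg, dotProg, Cmd.for])
    (by simp [Cmd.WritesVar, matVecProg, dotProg, Cmd.for])
    (by simp [Cmd.WritesArr, matVecProg, dotProg, Cmd.for])
  have hs' : SameIncumbent τ ρ := ⟨hF2.var 7 (by simp [Cmd.WritesVar, matVecProg, dotProg, Cmd.for]),
    hF2.var 8 (by simp [Cmd.WritesVar, matVecProg, dotProg, Cmd.for]),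
    hF2.arr 8 (by simp [Cmd.WritesArr, matVecProg, dotProg, Cmd.for]),
    hF2.arr 9 (by simp [Cmd.WritesArr, matVecProg, dotProg, Cmd.for])⟩
  have hh : ∀ j : Fin n, ρ.arr 5 j = W.transpose.mulVec g j := fun j => by
    have := h5 j j.2
    simp only [Nat.zero_add, State.arr_setVar, mul_one] at this
    rw [this, Finset.sum_range]
    refine Finset.sum_congr rfl fun l _ => ?_
    rw [hτg, add_comm, hτ.entry]; rfl
  -- Queries must fit into `M` bits without the allowance `r`: they are computed from the input
  -- alone, never from replies.
  have hhb : ∀ j : Fin n, bitSize (W.transpose.mulVec g j) ≤ M := fun j => by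
    rw [← hh, ← Nat.zero_add (j : ℕ), h5 j j.2]
    refine (bitSize_sum_mul_le (X := L) (Y := K * (β + 1)) (fun l hl => ?_) fun l hl => ?_).trans
      (by omega)
    · simpa using hWa j j.2 l hl
    · simpa using hga l hl
  refine (runs_processProg hO hlin hρ (hs'.incumbent (hs.incumbent hI hr) hr'') hh hhb hL (by omega)
    hdn).mono le_rfl ?_
  rintro π s - - ⟨h1, h2, h3⟩
  exact ⟨h1, h2, fun h' hc => h3 h' (hs'.covered (hs.covered hc))⟩

end ConvIntMax

namespace ConvIntMax

/-! ## Preparation of the list of vectors in `ℤᵈ` -/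

/-- Write the vectors `W e`, for `e` in the list `E`, into the rows of array `4`. -/
def imagesProg : Cmd :=
  .seq (.add 30 5 3) (.seq (.add 31 0 3) (.seq (.const 22 1) (.seq (.add 25 0 3)
    (.seq (.const 32 0) (.seq (.const 33 0) (.for 36 2 (.seq (matVecProg 0 3 4)
      (.seq (.add 32 32 0) .skip))))))))

/-- Append the unit vectors. -/
def unitRowsProg : Cmd :=
  .seq (.add 50 5 4) (.for 36 5 (.seq (.store 4 33 4) (.seq (.add 33 33 50) .skip)))

/-- Append the negatives of all rows. -/
def negativesProg : Cmd :=
  .seq (.add 51 2 5) (.seq (.mul 52 51 5) (.seq (.for 36 52 (.seq (.load 54 4 36)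
    (.seq (.sub 54 3 54) (.seq (.add 55 36 52) (.seq (.store 4 55 54) .skip)))))
    (.seq (.add 6 51 51) .skip)))

/-- Set up the constants and the list of vectors. -/
def prepareProg (d : ℕ) : Cmd :=
  .seq (.const 4 1) (.seq (.const 5 d) (.seq imagesProg (.seq unitRowsProg negativesProg)))

/-- The vectors `W e`, for `e` in the list `E`, and the unit vectors. -/
def normalRows {d n k : ℕ} (W : Matrix (Fin d) (Fin n) ℤ) (E : Fin k → Fin n → ℤ) (u : ℕ)
    (i : Fin d) : ℤ :=
  if h : u < k then W.mulVec (E ⟨u, h⟩) i else if u = k + i then 1 else 0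

/-- The vectors `normalRows` and their negatives. -/
def signedRows {d n k : ℕ} (W : Matrix (Fin d) (Fin n) ℤ) (E : Fin k → Fin n → ℤ)
    (t : Fin (2 * (k + d))) (i : Fin d) : ℤ :=
  if (t : ℕ) < k + d then normalRows W E t i else -normalRows W E (t - (k + d)) i

variable {d n m k : ℕ} {O : Oracles d n} {M : ℕ} {σ : State} {r : ℕ} {W : Matrix (Fin d) (Fin n) ℤ}
  {A : Matrix (Fin m) (Fin n) ℤ} {b : Fin m → ℤ} {c : (Fin d → ℝ) → ℝ} {E : Fin k → Fin n → ℤ}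

theorem bitSize_dotProduct_le {u v : Fin n → ℤ} {X Y : ℕ} (hu : ∀ j, bitSize (u j) ≤ X)
    (hv : ∀ j, bitSize (v j) ≤ Y) : bitSize (u ⬝ᵥ v) ≤ X + Y + n + 1 := by
  have := bitSize_sum_mul_le (f := vecArray u) (g := vecArray v) (len := n) (X := X) (Y := Y)
    (fun l hl => by simpa [vecArray, hl] using hu ⟨l, hl⟩)
    (fun l hl => by simpa [vecArray, hl] using hv ⟨l, hl⟩)
  simpa [Finset.sum_range, vecArray, dotProduct] using this

/-- The inner products take at most `2 * L + n + 1` bits. One more leaves room for the entry `1` of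
a unit vector, which takes two bits. -/
theorem bitSize_signedRows_le {L : ℕ} (hL : ∀ i j, bitSize (W i j) ≤ L)
    (hE : ∀ t j, bitSize (E t j) ≤ L) (t : Fin (2 * (k + d))) (i : Fin d) :
    bitSize (signedRows W E t i) ≤ 2 * L + n + 2 := by
  have h : ∀ u, bitSize (normalRows W E u i) ≤ 2 * L + n + 2 := fun u => by
    unfold normalRows
    split_ifs with h
    · exact (bitSize_dotProduct_le (hL i) (hE ⟨u, h⟩)).trans (by omega)
    · simp
    · simp
  unfold signedRows
  split_ifs
  · exact h _
  · rw [bitSize_neg]; exact h _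

/-- The zeros behind the images are recorded because the unit vectors are appended by writing only
their ones. Variable `33` is left at the first free cell. -/
theorem runs_imagesProg (hσ : Constants W σ) (hk : σ.var 2 = k) (hE3 : σ.arr 3 = rowArray E)
    (h4 : ∀ p, σ.arr 4 p = 0) {L : ℕ} (hL : ∀ i j, bitSize (W i j) ≤ L)
    (hE : ∀ t j, bitSize (E t j) ≤ L) (hLM : 2 * L + n + 2 ≤ M)
    (hM : k * n + n + d * n + d + k * d + k + 3 < M) :
    Runs O M imagesProg σ r (k * (d * (n * 9 + 11) + 8) + 8) (fun τ _ =>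
      (∀ t : Fin k, ∀ i : Fin d, τ.arr 4 ((t : ℕ) * d + i) = W.mulVec (E t) i) ∧
      (∀ p, k * d ≤ p → τ.arr 4 p = 0) ∧ τ.var 33 = (k * d : ℕ)) := by
  have hsz : ∀ v < M, ∀ r, bitSize (v : ℤ) ≤ M + r := fun v hv r => bitSize_natCast_le_of_lt hv
  refine Runs.mono (T' := (k * (((1 + 1) + (d * (n * 9 + 11) + 4)) + 2) + 2) + 1 + 1 + 1 + 1 + 1 + 1)
    ?_ (by ring_nf; omega) fun _ _ _ _ h => h
  refine Runs.add ?_ (Runs.add ?_ (Runs.const (by simp; omega) (Runs.add ?_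
    (Runs.const (by simp; omega) (Runs.const (by simp; omega) ?_)))))
  · simpa [hσ.zero, hσ.dim] using hsz d (by omega) r
  · simpa [hσ.zero, hσ.numVars] using hsz n (by omega) r
  · simpa [hσ.zero, hσ.numVars] using hsz n (by omega) r
  refine (Runs.for k (by simp [hk]) (by simp [hσ.one]) (by decide) (by decide)
    (by simp [Cmd.WritesVar, matVecProg, dotProg, Cmd.for])
    (by simp [Cmd.WritesVar, matVecProg, dotProg, Cmd.for])
    (by simp [Cmd.WritesVar, matVecProg, dotProg, Cmd.for]) (by omega)
    (fun t τ _ => (∀ s : Fin k, s < t → ∀ i : Fin d, τ.arr 4 ((s : ℕ) * d + i) = W.mulVec (E s) i) ∧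
      (∀ p, t * d ≤ p → τ.arr 4 p = 0) ∧ τ.var 33 = (t * d : ℕ) ∧ τ.var 32 = (t * n : ℕ))
    (by simp [h4]) ?_).mono le_rfl (fun τ r' _ _ h => ⟨fun s => h.2.1 s s.2, h.2.2.1, h.2.2.2.1⟩)
  rintro t ht τ r' hr hi hF ⟨e1, e2, e33, e32⟩
  have w : ∀ x, x ∉ [20, 21, 23, 24, 26, 27, 28, 32, 33, 34, 35, 36] →
      ¬ (Cmd.for 36 2 ((matVecProg 0 3 4).seq ((Cmd.add 32 32 0).seq Cmd.skip))).WritesVar x := by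
    intro x hx
    simp at hx
    simp [Cmd.WritesVar, matVecProg, dotProg, Cmd.for, hx]
  have fa : ∀ a ≠ 4, τ.arr a = σ.arr a := fun a ha => by
    rw [hF.arr a (by simp [Cmd.for, Cmd.WritesArr, dotProg, matVecProg, ha])]; simp
  have f0 := hF.var 0 (w 0 (by simp))
  have f3 := hF.var 3 (w 3 (by simp))
  have f4 := hF.var 4 (w 4 (by simp))
  have f22 := hF.var 22 (w 22 (by simp))
  have f25 := hF.var 25 (w 25 (by simp))
  have f30 := hF.var 30 (w 30 (by simp))
  have f31 := hF.var 31 (w 31 (by simp))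
  simp [hσ.zero, hσ.one, hσ.numVars, hσ.dim] at f0 f3 f4 f22 f25 f30 f31
  have htn : t * n + n ≤ k * n := by rw [← Nat.succ_mul]; gcongr; omega
  have htd : t * d + d ≤ k * d := by rw [← Nat.succ_mul]; gcongr; omega
  have entE : ∀ l (hl : l < n), τ.arr 3 (t * n + l) = E ⟨t, ht⟩ ⟨l, hl⟩ := fun l hl => by
    rw [fa 3 (by decide), hE3]; exact rowArray_apply E ⟨t, ht⟩ ⟨l, hl⟩
  have entW : ∀ i (hi : i < d) l (hl : l < n), τ.arr 0 (i * n + l) = W ⟨i, hi⟩ ⟨l, hl⟩ :=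
    fun i hi l hl => by
      rw [fa 0 (by decide)]; exact hσ.entry ⟨i, hi⟩ ⟨l, hl⟩
  refine Runs.seq (runs_matVecProg (sa := 1) (ra := n) (pb := t * n) (len := n) (rows := d)
    (out := t * d) (X := L) (Y := L) (by decide) (by decide) f3 f4 (by simp [f22]) f25 f30 f31 e32 e33
    (fun i hi l hl => by simpa [entW i hi l hl] using hL ⟨i, hi⟩ ⟨l, hl⟩)
    (fun l hl => by simpa [entE l hl] using hE ⟨t, ht⟩ ⟨l, hl⟩)
    (by omega) (by omega) (by omega) (by omega) (by omega) (by omega) (by omega))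
    fun ρ r'' hr'' hF' ⟨g1, g2, g33⟩ => ?_
  have g32 : ρ.var 32 = (t * n : ℕ) := by
    rw [hF'.var 32 (by simp [matVecProg, dotProg, Cmd.for, Cmd.WritesVar]), e32]
  have g0 : ρ.var 0 = n := by
    rw [hF'.var 0 (by simp [matVecProg, dotProg, Cmd.for, Cmd.WritesVar]), f0]
  refine Runs.add ?_ (Runs.skip ⟨fun s hs i => ?_, fun p hp => ?_, ?_, ?_⟩)
  · rw [g32, g0, ← Nat.cast_add]; exact hsz _ (by omega) _
  · simp only [State.arr_setVar]
    rcases Nat.lt_succ_iff_lt_or_eq.1 hs with hs | hs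
    · rw [g2 _ (Or.inl ?_), e1 s hs]
      have : (s : ℕ) * d + d ≤ t * d := by rw [← Nat.succ_mul]; gcongr; omega
      omega
    · obtain rfl : s = ⟨t, ht⟩ := Fin.ext hs
      rw [g1 i i.2, Finset.sum_range]
      refine Finset.sum_congr rfl fun l _ => ?_
      rw [entE l l.2, mul_one, entW i i.2 l l.2]
  · rw [add_mul, one_mul] at hp
    simp only [State.arr_setVar]
    rw [g2 p (Or.inr hp), e2 p (by omega)]
  · simp [g33]; ring
  · simp [g32, g0]; ring

/-- In an identity matrix stored row by row from `p₀` on, consecutive ones are `d + 1` cells apart.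
-/
theorem runs_unitRowsProg (h4 : σ.var 4 = 1) (h5 : σ.var 5 = d) {p₀ : ℕ} (h33 : σ.var 33 = p₀)
    (hM : p₀ + d * (d + 1) + d + 1 < M) :
    Runs O M unitRowsProg σ r (d * 5 + 3) (fun τ _ => ∀ p,
      τ.arr 4 p = if ∃ j < d, p = p₀ + j * (d + 1) then 1 else σ.arr 4 p) := by
  have hsz : ∀ v < M, ∀ r, bitSize (v : ℤ) ≤ M + r := fun v hv r => bitSize_natCast_le_of_lt hv
  refine Runs.add (by rw [h4, h5]; exact_mod_cast hsz (d + 1) (by omega) _) ?_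
  refine (Runs.for (T := 1 + 1 + 1) d (by simp [h5]) (by simp [h4]) (by decide) (by decide)
    (by simp [Cmd.WritesVar]) (by simp [Cmd.WritesVar]) (by simp [Cmd.WritesVar]) (by omega)
    (fun t τ _ => (∀ p, τ.arr 4 p = if ∃ j < t, p = p₀ + j * (d + 1) then 1 else σ.arr 4 p) ∧
      τ.var 33 = (p₀ + t * (d + 1) : ℕ)) (by simp [h33]) ?_).mono le_rfl (fun τ r' _ _ h => h.2.1)
  rintro t ht τ r' hr hi hF ⟨e1, e33⟩
  have f4 := hF.var 4 (by simp [Cmd.for, Cmd.WritesVar])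
  have f50 := hF.var 50 (by simp [Cmd.for, Cmd.WritesVar])
  simp [h4, h5] at f4 f50
  have htd : (t + 1) * (d + 1) ≤ d * (d + 1) := by gcongr; omega
  have h2 : (t + 1) * (d + 1) = t * (d + 1) + (d + 1) := by ring
  refine Runs.store _ e33 (by rw [f4]; exact hsz 1 (by omega) _) (Runs.add ?_
    (Runs.skip ⟨fun p => ?_, ?_⟩))
  · simp only [State.var_setCell, e33, f50]
    exact_mod_cast hsz (p₀ + t * (d + 1) + (d + 1)) (by omega) _
  · simp only [State.arr_setVar, State.arr_setCell, true_and, e1, f4]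
    have h3 : (∃ j < t + 1, p = p₀ + j * (d + 1)) ↔
        p = p₀ + t * (d + 1) ∨ ∃ j < t, p = p₀ + j * (d + 1) := by
      constructor
      · rintro ⟨j, hj, rfl⟩
        rcases Nat.lt_succ_iff_lt_or_eq.1 hj with h | rfl
        exacts [Or.inr ⟨j, h, rfl⟩, Or.inl rfl]
      · rintro (h | ⟨j, hj, h⟩)
        exacts [⟨t, by omega, h⟩, ⟨j, by omega, h⟩]
    simp only [h3]
    by_cases hp : p = p₀ + t * (d + 1)
    · rw [if_pos hp, if_pos (Or.inl hp)]
    · rw [if_neg hp]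
      exact if_congr (or_iff_right hp).symm rfl rfl
  · simp [e33, f50]; ring

theorem runs_negativesProg (h3 : σ.var 3 = 0) (h4 : σ.var 4 = 1) (h5 : σ.var 5 = d)
    (h2 : σ.var 2 = k) (hb : ∀ p < (k + d) * d, bitSize (σ.arr 4 p) ≤ M)
    (hM : 2 * ((k + d) * d) + 2 * (k + d) + 1 < M) :
    Runs O M negativesProg σ r ((k + d) * d * 7 + 6) (fun τ _ => τ.var 6 = (2 * (k + d) : ℕ) ∧
      (∀ p, p < (k + d) * d → τ.arr 4 p = σ.arr 4 p) ∧
      ∀ p, p < (k + d) * d → τ.arr 4 ((k + d) * d + p) = -σ.arr 4 p) := by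
  have hsz : ∀ v < M, ∀ r, bitSize (v : ℤ) ≤ M + r := fun v hv r => bitSize_natCast_le_of_lt hv
  refine Runs.mono (T' := (1 + 1 + ((k + d) * d * ((1 + 1 + 1 + 1 + 1) + 2) + 2)) + 1 + 1) ?_
    (by omega) fun _ _ _ _ h => h
  refine Runs.add (by rw [h2, h5]; exact_mod_cast hsz (k + d) (by omega) _) (Runs.mul ?_ ?_)
  · simp only [State.var_setVar, h2, h5]
    exact_mod_cast hsz ((k + d) * d) (by omega) _
  refine Runs.seq (Runs.for ((k + d) * d) (by simp [h2, h5]) (by simp [h4]) (by decide) (by decide)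
    (by simp [Cmd.WritesVar]) (by simp [Cmd.WritesVar]) (by simp [Cmd.WritesVar]) (by omega)
    (fun t τ _ => (∀ p, p < (k + d) * d → τ.arr 4 p = σ.arr 4 p) ∧
      ∀ p, p < t → τ.arr 4 ((k + d) * d + p) = -σ.arr 4 p) (by simp) ?_)
    fun τ r' hr hF ⟨_, e1, e2⟩ => ?_
  · rintro t ht τ r' hr hi hF ⟨e1, e2⟩
    have f3 := hF.var 3 (by simp [Cmd.for, Cmd.WritesVar])
    have f52 := hF.var 52 (by simp [Cmd.for, Cmd.WritesVar])
    simp [h3, h2, h5] at f3 f52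
    have hbt := hb t ht
    refine Runs.load t hi (by rw [e1 t ht]; omega) (Runs.sub ?_ (Runs.add ?_
      (Runs.store ((k + d) * d + t) ?_ ?_ (Runs.skip ⟨fun p hp => ?_, fun p hp => ?_⟩))))
    · simp [f3, e1 t ht]; omega
    · have := hsz (t + (k + d) * d) (by omega) r'
      simpa [hi, f52] using this
    · simp [hi, f52]; ring
    · simp [f3, e1 t ht]; omega
    · simp only [State.arr_setVar, State.arr_setCell, true_and]
      rw [if_neg (by omega), e1 p hp]
    · simp only [State.arr_setVar, State.arr_setCell, true_and, Nat.add_left_cancel_iff]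
      split_ifs with h
      · simp [f3, e1 t ht, h]
      · exact e2 p (by omega)
  · have f51 := hF.var 51 (by simp [Cmd.for, Cmd.WritesVar])
    simp [h2, h5] at f51
    refine Runs.add ?_ (Runs.skip ⟨?_, e1, e2⟩)
    · have := hsz (2 * (k + d)) (by omega) r'
      convert this using 2; simp [f51]; ring
    · simp [f51]; ring

theorem runs_prepareProg (A : Matrix (Fin m) (Fin n) ℤ) (b : Fin m → ℤ) {L : ℕ}
    (hL : ∀ i j, bitSize (W i j) ≤ L)
    (hE : ∀ t j, bitSize (E t j) ≤ L) (hLM : 2 * L + n + 2 ≤ M)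
    (hM : k * n + n + d * n + 2 * ((k + d) * d) + 2 * (k + d) + 3 < M) :
    Runs O M (prepareProg d) (initialState W A b E) r
      (k * (d * (n * 9 + 11) + 8) + d * 5 + (k + d) * d * 7 + 19) (fun τ _ =>
      Constants W τ ∧ HoldsRows d (signedRows W E) τ) := by
  have hkd : (k + d) * d = k * d + d * d := by ring
  set σ₀ := initialState W A b E
  refine Runs.mono (T' := ((((k + d) * d * 7 + 6) + (d * 5 + 3)) + (k * (d * (n * 9 + 11) + 8) + 8))
    + 1 + 1) ?_ (by omega) fun _ _ _ _ h => h
  refine Runs.const (by simp; omega) (Runs.const (bitSize_natCast_le_of_lt (by omega)) ?_)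
  have hσ : Constants W ((σ₀.setVar 4 1).setVar 5 d) :=
    ⟨by simp [σ₀, initialState], by simp, by simp [σ₀, initialState], by simp, rfl⟩
  refine Runs.seq (runs_imagesProg hσ (by simp [σ₀, initialState]) rfl (fun _ => rfl) hL hE
    hLM (by omega)) fun τ r' hr hF ⟨e1, e2, e33⟩ => ?_
  have hτ : Constants W τ := hσ.of_frame hF
    (by simp [Cmd.WritesVar, imagesProg, matVecProg, dotProg, Cmd.for])
    (by simp [Cmd.WritesVar, imagesProg, matVecProg, dotProg, Cmd.for])
    (by simp [Cmd.WritesVar, imagesProg, matVecProg, dotProg, Cmd.for])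
    (by simp [Cmd.WritesVar, imagesProg, matVecProg, dotProg, Cmd.for])
    (by simp [Cmd.WritesArr, imagesProg, matVecProg, dotProg, Cmd.for])
  have hk : τ.var 2 = k := by
    rw [hF.var 2 (by simp [Cmd.WritesVar, imagesProg, matVecProg, dotProg, Cmd.for])]
    simp [σ₀, initialState]
  refine Runs.seq (runs_unitRowsProg hτ.one hτ.dim e33 (by rw [mul_add]; omega))
    fun ρ r'' hr' hF' u1 => ?_
  have hρ : Constants W ρ := hτ.of_frame hF'
    (by simp [Cmd.WritesVar, unitRowsProg, Cmd.for]) (by simp [Cmd.WritesVar, unitRowsProg, Cmd.for])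
    (by simp [Cmd.WritesVar, unitRowsProg, Cmd.for]) (by simp [Cmd.WritesVar, unitRowsProg, Cmd.for])
    (by simp [Cmd.WritesArr, unitRowsProg, Cmd.for])
  have hk' : ρ.var 2 = k := by rw [hF'.var 2 (by simp [Cmd.WritesVar, unitRowsProg, Cmd.for]), hk]
  have hrow : ∀ u < k + d, ∀ i : Fin d, ρ.arr 4 (u * d + i) = normalRows W E u i := by
    intro u hu i
    have hi := i.2
    rw [u1, normalRows]
    by_cases huk : u < k
    · have : u * d + d ≤ k * d := by rw [← Nat.succ_mul]; gcongr; omega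
      rw [if_neg (by rintro ⟨j, -, hj⟩; omega), dif_pos huk]
      exact e1 ⟨u, huk⟩ i
    · obtain ⟨v, rfl⟩ := Nat.exists_eq_add_of_le (not_lt.1 huk)
      rw [dif_neg huk, e2 _ (by rw [add_mul]; omega)]
      refine if_congr ⟨?_, fun h => ⟨i, hi, ?_⟩⟩ rfl rfl
      · rintro ⟨j, hj, hjp⟩
        have h1 : v * d + i = j * d + j := by
          have : (k + v) * d = k * d + v * d := by ring
          have : j * (d + 1) = j * d + j := by ring
          omega
        -- The remainder modulo `d` recovers the column, after which cancelling `d` recovers the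
        -- row.
        have h2 : (v * d + i) % d = (j * d + j) % d := by rw [h1]
        simp only [Nat.mul_add_mod', Nat.mod_eq_of_lt hi, Nat.mod_eq_of_lt hj] at h2
        have h3 : v * d = j * d := by omega
        have := Nat.eq_of_mul_eq_mul_right (by omega : 0 < d) h3
        omega
      · obtain rfl : v = i := by omega
        ring
  have hdiv : ∀ p < (k + d) * d, ∃ u < k + d, ∃ i : Fin d, p = u * d + i := fun p hp => by
    have hd : 0 < d := Nat.pos_of_ne_zero (by rintro rfl; simp at hp)
    exact ⟨p / d, (Nat.div_lt_iff_lt_mul hd).2 hp, ⟨p % d, Nat.mod_lt _ hd⟩,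
      (Nat.div_add_mod' p d).symm⟩
  have hbits : ∀ p < (k + d) * d, bitSize (ρ.arr 4 p) ≤ M := fun p hp => by
    obtain ⟨u, hu, i, rfl⟩ := hdiv p hp
    have := bitSize_signedRows_le hL hE ⟨u, by omega⟩ i
    simp only [signedRows, hu, if_true] at this
    rw [hrow u hu]; omega
  refine (runs_negativesProg hρ.zero hρ.one hρ.dim hk' hbits (by omega)).mono le_rfl ?_
  rintro π s - hF2 ⟨h6, a1, a2⟩
  refine ⟨hρ.of_frame hF2 (by simp [Cmd.WritesVar, negativesProg, Cmd.for])
    (by simp [Cmd.WritesVar, negativesProg, Cmd.for]) (by simp [Cmd.WritesVar, negativesProg, Cmd.for])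
    (by simp [Cmd.WritesVar, negativesProg, Cmd.for])
    (by simp [Cmd.WritesArr, negativesProg, Cmd.for]), h6, fun t i => ?_⟩
  have hbd : ∀ u < k + d, u * d + i < (k + d) * d := fun u hu => by
    have : u * d + d ≤ (k + d) * d := by rw [← Nat.succ_mul]; gcongr; omega
    have := i.2
    omega
  rw [signedRows]
  split_ifs with ht
  · rw [a1 _ (hbd t ht), hrow t ht]
  · have ht' : (t : ℕ) - (k + d) < k + d := by omega
    rw [← hrow _ ht', ← a2 _ (hbd _ ht')]
    congr 1
    rw [← add_assoc, ← add_mul]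
    congr 2
    omega

end ConvIntMax

namespace ConvIntMax

/-! ## The main program -/

/-- Process the unit vectors of `ℝⁿ` as queries. -/
def unitQueriesProg : Cmd :=
  .for 60 0 (.seq (.store 12 60 4) (.seq (processProg 12) (.seq (.store 12 60 3) .skip)))

/-- Output the answer. -/
def outputProg : Cmd :=
  .ite 8 4 (.ite 7 4 (.seq (.const 0 1) .skip) (.seq (.const 41 0) (.seq (.const 42 0)
    (.seq (.add 43 0 3) (.seq (copyProg 9 0) (.seq (.const 0 0) .skip))))))
    (.seq (.const 0 2) .skip)

/-- The main program, where `q` computes the vector `normalVec B` from the matrix `B`. -/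
def mainProg (d : ℕ) (q : Cmd) : Cmd :=
  .seq (prepareProg d) (.seq unitQueriesProg (.seq (nestProg d (queryProg q) d) outputProg))

variable {d n m k : ℕ} {O : Oracles d n} {M : ℕ} {σ : State} {r : ℕ} {W : Matrix (Fin d) (Fin n) ℤ}
  {A : Matrix (Fin m) (Fin n) ℤ} {b : Fin m → ℤ} {c : (Fin d → ℝ) → ℝ} {E : Fin k → Fin n → ℤ}

theorem processProg_not_writesVar {a x : ℕ}
    (hx : x ∉ [7, 8, 10, 11, 20, 21, 22, 23, 24, 25, 26, 27, 28, 30, 31, 32, 33, 34, 35, 41, 42, 43,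
      44, 45]) : ¬ (processProg a).WritesVar x := by
  simp at hx
  simp [processProg, compareProg, replaceProg, matVecProg, dotProg, copyProg, Cmd.for,
    Cmd.WritesVar, hx]

theorem processProg_not_writesArr {a x : ℕ} (hx : x ∉ [6, 7, 8, 9]) :
    ¬ (processProg a).WritesArr x := by
  simp at hx
  simp [processProg, compareProg, replaceProg, matVecProg, dotProg, copyProg, Cmd.for,
    Cmd.WritesArr, hx]

/-- These queries detect an infinite feasible set. Array `12` is zero at the start of each round,
since the `1` stored there is removed after the query. -/
theorem runs_unitQueriesProg (hO : IsComparisonOracle c O.cmp) (hlin : IsLinearOracle A b O.lin)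
    (hσ : Constants W σ) (hI : Incumbent W A b σ r) (h12 : ∀ p, σ.arr 12 p = 0) {L : ℕ}
    (hL : ∀ i j, bitSize (W i j) ≤ L) (hLM : L + n + 1 ≤ M) (hdn : d * n + n + d + 2 < M) :
    Runs O M unitQueriesProg σ r (n * (d * (n * 9 + 11) + 7 * n + 7 * d + 34) + 2) (fun τ r' =>
      Incumbent W A b τ r' ∧ ∀ j, Covered W c O τ (Pi.single j 1)) := by
  have w : ∀ x, x ≠ 60 → ¬ (processProg 12).WritesVar x → ¬ (Cmd.for 60 0 (.seq (.store 12 60 4)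
      (.seq (processProg 12) (.seq (.store 12 60 3) .skip)))).WritesVar x := by
    intro x hx hp
    simp [Cmd.WritesVar, Cmd.for, hp, hx]
  refine (Runs.for (T := (1 + 1 + (d * (n * 9 + 11) + 7 * n + 7 * d + 29)) + 1) n hσ.numVars hσ.one
    (by decide) (by decide) (by simp [Cmd.WritesVar, processProg_not_writesVar])
    (by simp [Cmd.WritesVar, processProg_not_writesVar])
    (by simp [Cmd.WritesVar, processProg_not_writesVar]) (by omega)
    (fun t τ r' => Incumbent W A b τ r' ∧ (∀ p, τ.arr 12 p = 0) ∧
      ∀ j : Fin n, j < t → Covered W c O τ (Pi.single j 1)) ?_ ?_).mono (by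
        have : n * (1 + 1 + (d * (n * 9 + 11) + 7 * n + 7 * d + 29) + 1 + 2) =
          n * (d * (n * 9 + 11) + 7 * n + 7 * d + 34) := by ring
        omega)
    (fun τ r' _ _ h => ⟨h.2.1, fun j => h.2.2.2 j j.2⟩)
  · have hs : SameIncumbent σ (σ.setVar 60 0) := ⟨by simp, by simp, rfl, rfl⟩
    exact ⟨hs.incumbent hI le_rfl, h12, fun j h => absurd h (Nat.not_lt_zero _)⟩
  rintro t ht τ r' hr hi hF ⟨hIτ, h0, hcov⟩
  have hτ : Constants W τ := hσ.of_frame hF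
    (w _ (by decide) (processProg_not_writesVar (by simp)))
    (w _ (by decide) (processProg_not_writesVar (by simp)))
    (w _ (by decide) (processProg_not_writesVar (by simp)))
    (w _ (by decide) (processProg_not_writesVar (by simp)))
    (by simp [Cmd.WritesArr, Cmd.for, processProg_not_writesArr])
  refine Runs.store t hi (by rw [hτ.one]; simp; omega) ?_
  set τ' := τ.setCell 12 t (τ.var 4) with hτ'
  have hs : SameIncumbent τ τ' := ⟨rfl, rfl, funext fun p => by simp [hτ'],
    funext fun p => by simp [hτ']⟩
  have hcτ : Constants W τ' := ⟨hτ.zero, hτ.one, hτ.numVars, hτ.dim,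
    by rw [← hτ.rows]; funext p; simp [hτ']⟩
  refine Runs.seq (runs_processProg (h := Pi.single ⟨t, ht⟩ 1) hO hlin hcτ
    (hs.incumbent hIτ le_rfl) (fun j => ?_) (fun j => ?_) hL hLM hdn)
    fun ρ r'' hr' hF' ⟨hIρ, hcρ, hkeep⟩ => ?_
  · simp [hτ', hτ.one, h0, Pi.single_apply, Fin.ext_iff]
  · rw [Pi.single_apply]; split_ifs <;> simp <;> omega
  have h60 : ρ.var 60 = t := by
    rw [hF'.var 60 (processProg_not_writesVar (by simp))]; exact hi
  have h3 : ρ.var 3 = 0 := by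
    rw [hF'.var 3 (processProg_not_writesVar (by simp))]; exact hτ.zero
  have h12' : ρ.arr 12 = τ'.arr 12 := hF'.arr 12 (processProg_not_writesArr (by simp))
  set π := (ρ.setCell 12 t (ρ.var 3)).setVar 60 (t + 1) with hπ
  have hs' : SameIncumbent ρ π := ⟨by simp [hπ], by simp [hπ], funext fun p => by simp [hπ],
    funext fun p => by simp [hπ]⟩
  refine Runs.store t h60 (by rw [h3]; simp; omega) (Runs.skip ⟨hs'.incumbent hIρ le_rfl,
    fun p => ?_, fun j hj => hs'.covered ?_⟩)
  · simp only [State.arr_setVar, State.arr_setCell, true_and, h12', hτ', h3, h0]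
    split_ifs <;> rfl
  · rcases Nat.lt_succ_iff_lt_or_eq.1 hj with hj | hj
    · exact hkeep _ (hs.covered (hcov j hj))
    · obtain rfl : j = ⟨t, ht⟩ := Fin.ext hj
      exact hcρ

/-- Flag `8` is tested first, because after an unbounded reply the incumbent need not be optimal. -/
theorem runs_outputProg (hσ : Constants W σ) (hI : Incumbent W A b σ r)
    (hinf : σ.var 8 = 0 → σ.var 7 = 0 → feasible A b = ∅)
    (hopt : σ.var 8 = 0 → σ.var 7 = 1 → ∀ y ∈ feasible A b, objective W c y ≤ c (σ.bestValue d))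
    (hnM : n + 2 < M) :
    Runs O M outputProg σ r (n * 7 + 9) (fun τ _ => Solves W A b c τ) := by
  refine Runs.mono (T' := ((1 + 1 + (n * 7 + 2)) + 1 + 1 + 1) + 1 + 1) ?_ (by omega)
    fun _ _ _ _ h => h
  refine Runs.ite (fun h8 => Runs.ite (fun h7 => ?_) (fun h7 => ?_)) (fun h8 => ?_)
  · rw [hσ.one] at h8 h7
    have h8' : σ.var 8 = 0 := by rcases hI.unbounded with h | ⟨h, -⟩ <;> omega
    have h7' : σ.var 7 = 0 := by rcases hI.flag with h | h <;> omega
    refine Runs.mono (T' := 1 + 1) (Runs.const (by simp; omega) (Runs.skip ?_)) (by omega)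
      fun _ _ _ _ h => h
    exact Or.inr (Or.inl ⟨by simp, hinf h8' h7'⟩)
  · rw [hσ.one] at h8 h7
    have h8' : σ.var 8 = 0 := by rcases hI.unbounded with h | ⟨h, -⟩ <;> omega
    have h7' : σ.var 7 = 1 := by rcases hI.flag with h | h <;> omega
    obtain ⟨x, hx, h9, hval, hxr⟩ := hI.point h7'
    refine Runs.const (by simp; omega) (Runs.const (by simp; omega) (Runs.add ?_ ?_))
    · simpa [hσ.zero, hσ.numVars] using bitSize_natCast_le_of_lt (by omega)
    refine Runs.seq (runs_copyProg (src := 0) (dst := 0) (len := n) (by decide) (by simp [hσ.one])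
      (by simp) (by simp) (by simp [hσ.zero, hσ.numVars]) (fun l hl => ?_) (by omega) (by omega)
      (by omega)) fun τ r' hr hF ⟨h0, _⟩ => ?_
    · have := (bitSize_le_vecSize _ ⟨l, hl⟩).trans hxr
      simp only [← h9] at this
      simp only [State.arr_setVar, Nat.zero_add]; omega
    refine Runs.const (by simp; omega) (Runs.skip (Or.inl ⟨by simp, x, hx, fun j => ?_, fun y hy => ?_⟩))
    · have := h0 j j.2
      simpa [h9] using this
    · refine (hopt h8' h7' y hy).trans_eq ?_
      rw [objective]
      congr 1
      funext i
      simp only [State.bestValue, hval]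
  · rw [hσ.one] at h8
    obtain ⟨-, hu⟩ := hI.unbounded.resolve_left (by omega)
    refine Runs.mono (T' := 1 + 1) (Runs.const (by simp; omega) (Runs.skip ?_)) (by omega)
      fun _ _ _ _ h => h
    exact Or.inr (Or.inr ⟨by simp, hu⟩)

/-- The number of steps of the main program. -/
def mainSteps (d n k K : ℕ) : ℕ :=
  (((n * 7 + 9) + nestSteps d (2 * (k + d)) ((d * (n * 9 + 11) + 7 * n + 7 * d + 29) +
    (n * (d * 9 + 11) + 4) + 6 + K) d) + (n * (d * (n * 9 + 11) + 7 * n + 7 * d + 34) + 2)) +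
    (k * (d * (n * 9 + 11) + 8) + d * 5 + (k + d) * d * 7 + 19)

theorem queryProg_writesVar {q : Cmd} (hq : ∀ x, q.WritesVar x → 100 + d ≤ x) {x : ℕ}
    (hx : x < 100 + d) (hx' : x ∉ [7, 8, 10, 11, 20, 21, 22, 23, 24, 25, 26, 27, 28, 30, 31, 32, 33,
      34, 35, 41, 42, 43, 44, 45]) : ¬ (queryProg q).WritesVar x := by
  have h1 : ¬ q.WritesVar x := fun h => by have := hq x h; omega
  have h2 := processProg_not_writesVar (a := 5) hx'
  simp at hx'
  simp [queryProg, Cmd.WritesVar, matVecProg, dotProg, Cmd.for, h1, h2, hx']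

theorem queryProg_writesArr {q : Cmd} (hq : ∀ x, q.WritesArr x → x = 11) {x : ℕ}
    (hx : x ∉ [5, 6, 7, 8, 9, 11]) : ¬ (queryProg q).WritesArr x := by
  simp at hx
  have h1 : ¬ q.WritesArr x := fun h => hx.2.2.2.2.2 (hq x h)
  have h2 := processProg_not_writesArr (a := 5) (x := x) (by simp [hx])
  simp [queryProg, Cmd.WritesArr, matVecProg, dotProg, Cmd.for, h1, h2, hx]

/-- If the oracle replies to the queries that the program makes suffice, the program is correct. -/
theorem runs_mainProg {q : Cmd} {K L : ℕ}
    (hq : ∀ x, q.WritesVar x → 100 + d ≤ x) (hqa : ∀ x, q.WritesArr x → x = 11)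
    (hqr : ∀ (σ : State) (r : ℕ) (B : Matrix (Fin d) (Fin d) ℤ),
        (∀ l i : Fin d, σ.arr 10 (l * d + i) = B l i) → (∀ l i, bitSize (B l i) ≤ 2 * L + n + 2) →
        (∀ j, bitSize (normalVec B j) ≤ K * ((2 * L + n + 2) + 1)) ∧
        Runs O M q σ r K (fun τ _ => ∀ j : Fin d, τ.arr 11 j = normalVec B j))
    (hO : IsComparisonOracle c O.cmp) (hlin : IsLinearOracle A b O.lin)
    (hL : ∀ i j, bitSize (W i j) ≤ L) (hE : ∀ t j, bitSize (E t j) ≤ L)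
    (hLM : 2 * L + 2 * n + K * ((2 * L + n + 2) + 1) + d + 2 ≤ M)
    (hM : k * n + n + d * n + 2 * ((k + d) * d) + 2 * (k + d) + d * d + 2 * d + 3 < M)
    (hd : 0 < d)
    (hsuff : (∀ (j : Fin n), O.lin (Pi.single j 1) ≠ .unbounded) →
      (∀ f : Fin d → Fin (2 * (k + d)), O.lin (W.transpose.mulVec
        (normalVec fun l => signedRows W E (f l))) ≠ .unbounded) →
      ∀ y ∈ feasible A b, ∃ (f : Fin d → Fin (2 * (k + d))) (x : Fin n → ℕ),
        O.lin (W.transpose.mulVec (normalVec fun l => signedRows W E (f l))) = .optimal x ∧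
        objective W c y ≤ objective W c x) :
    Runs O M (mainProg d q) (initialState W A b E) r (mainSteps d n k K)
      (fun τ _ => Solves W A b c τ) := by
  refine Runs.seq (runs_prepareProg A b hL hE (by omega) (by omega)) fun τ r₁ _ hF ⟨hτ, hVτ⟩ => ?_
  have hIτ : Incumbent W A b τ r₁ := by
    have h7 : τ.var 7 = 0 := by
      rw [hF.var 7 (by simp [prepareProg, imagesProg, unitRowsProg, negativesProg, matVecProg,
        dotProg, Cmd.for, Cmd.WritesVar])]; rfl
    have h8 : τ.var 8 = 0 := by
      rw [hF.var 8 (by simp [prepareProg, imagesProg, unitRowsProg, negativesProg, matVecProg,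
        dotProg, Cmd.for, Cmd.WritesVar])]; rfl
    exact ⟨Or.inl h7, fun h => absurd (h7.symm.trans h) (by decide), Or.inl h8⟩
  have h12 : ∀ p, τ.arr 12 p = 0 := fun p => by
    rw [hF.arr 12 (by simp [prepareProg, imagesProg, unitRowsProg, negativesProg, matVecProg,
        dotProg, Cmd.for, Cmd.WritesArr])]; rfl
  refine Runs.seq (runs_unitQueriesProg hO hlin hτ hIτ h12 hL (by omega) (by omega))
    fun ρ r₂ _ hF₂ ⟨hIρ, hunit⟩ => ?_
  have hρ : Constants W ρ := hτ.of_frame hF₂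
    (by simp [unitQueriesProg, Cmd.for, Cmd.WritesVar, processProg_not_writesVar])
    (by simp [unitQueriesProg, Cmd.for, Cmd.WritesVar, processProg_not_writesVar])
    (by simp [unitQueriesProg, Cmd.for, Cmd.WritesVar, processProg_not_writesVar])
    (by simp [unitQueriesProg, Cmd.for, Cmd.WritesVar, processProg_not_writesVar])
    (by simp [unitQueriesProg, Cmd.for, Cmd.WritesArr, processProg_not_writesArr])
  have hVρ : HoldsRows d (signedRows W E) ρ := hVτ.of_frame hF₂
    (by simp [unitQueriesProg, Cmd.for, Cmd.WritesVar, processProg_not_writesVar])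
    (by simp [unitQueriesProg, Cmd.for, Cmd.WritesArr, processProg_not_writesArr])
  have hV := bitSize_signedRows_le (n := n) hL hE
  have hcd : 2 * (k + d) * d = 2 * ((k + d) * d) := by ring
  have nest := runs_nestProg (c := c) (O := O) (A := A) (b := b) (M := M) (W := W)
    (V := signedRows W E) (body := queryProg q)
    (h := fun f => W.transpose.mulVec (normalVec fun l => signedRows W E (f l)))
    (fun x hx => by
      refine queryProg_writesVar hq ?_ ?_ <;> simp at hx <;> rcases hx with rfl | rfl | rfl | rfl | rfl
        <;> first | omega | simp)
    (fun x h1 h2 => queryProg_writesVar hq h2 (by simp; omega))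
    (fun x hx => queryProg_writesArr hqa (by
      simp at hx; rcases hx with rfl | rfl | rfl <;> simp))
    (fun σ r f hσ _ hI hf => runs_queryProg hq hqa hqr hO hlin hL (by omega) (by omega) hV σ r f hσ
      hI hf)
    -- At depth `d` no row is prescribed, so any choice function will do; the index `0` exists
    -- because `d` is positive.
    (fun t i => (hV t i).trans (by omega)) (by omega) d le_rfl ρ r₂ (fun _ => ⟨0, by omega⟩) hρ hVρ
    hIρ (fun l hl => absurd l.2 (not_lt.2 hl))
  refine nest.seq fun π r₃ _ hF₃ ⟨hIπ, _, hcov, hkeep⟩ => ?_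
  have nv : ∀ x ∈ [0, 3, 4, 5], ¬ (nestProg d (queryProg q) d).WritesVar x := fun x hx h => by
    have hx' : x < 6 := by simp at hx; omega
    rcases nestProg_writesVar h with h | h | h
    · refine queryProg_writesVar hq (by omega) ?_ h
      simp; omega
    · omega
    · omega
  have hπ : Constants W π := hρ.of_frame hF₃ (nv 3 (by simp)) (nv 4 (by simp)) (nv 0 (by simp))
    (nv 5 (by simp)) fun h => by
      rcases nestProg_writesArr h with h | h
      · exact queryProg_writesArr hqa (by simp) h
      · omega
  have hunit' : ∀ j, Covered W c O π (Pi.single j 1) := fun j => hkeep _ (hunit j)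
  have hcov' := fun f => hcov f fun l hl => absurd l.2 (not_lt.2 hl)
  have hopt : π.var 8 = 0 → ∀ y ∈ feasible A b,
      π.var 7 = 1 ∧ objective W c y ≤ c (π.bestValue d) := by
    intro h8 y hy
    obtain ⟨f, x, hx, hle⟩ := hsuff (fun j hj => by
      have := hunit' j
      simp [Covered, hj, h8] at this) (fun f hf => by
      have := hcov' f
      simp [Covered, hf, h8] at this) y hy
    have := hcov' f
    simp only [Covered, hx] at this
    exact ⟨this.1, hle.trans this.2⟩
  -- If some point were feasible, `hopt` would give an incumbent, so an unset flag `7` proves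
  -- infeasibility.
  refine runs_outputProg hπ hIπ (fun h8 h7 => ?_) (fun h8 _ y hy => (hopt h8 y hy).2) (by omega)
  refine Set.eq_empty_of_forall_notMem fun y hy => ?_
  have := (hopt h8 y hy).1
  omega

end ConvIntMax

namespace ConvIntMax

/-! ## Convex maximization over a finite set -/

section Geometry

variable {N : ℕ}

/-- The equality case of Jensen's inequality: for a convex combination `p` with weights `w`, `a ≤ c
p ≤ ∑ w u * c u ≤ a`, so all weight lies on points with `c u = a`. -/
theorem mem_convexHull_maximizers {U : Finset (Fin N → ℝ)} {c : (Fin N → ℝ) → ℝ}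
    (hc : ConvexOn ℝ Set.univ c) {a : ℝ} (hU : ∀ u ∈ U, c u ≤ a) {p : Fin N → ℝ}
    (hp : p ∈ convexHull ℝ (U : Set (Fin N → ℝ))) (hap : a ≤ c p) :
    p ∈ convexHull ℝ {u | u ∈ U ∧ c u = a} := by
  classical
  obtain ⟨w, hw0, hw1, rfl⟩ := Finset.mem_convexHull'.1 hp
  have h1 : ∑ u ∈ U, w u * a ≤ ∑ u ∈ U, w u * c u := by
    rw [← Finset.sum_mul, hw1, one_mul]
    refine hap.trans ?_
    simpa using hc.map_sum_le (p := id) hw0 hw1 fun _ _ => Set.mem_univ _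
  have h2 : ∀ u ∈ U, w u * c u ≤ w u * a := fun u hu =>
    mul_le_mul_of_nonneg_left (hU u hu) (hw0 u hu)
  have h3 := (Finset.sum_eq_sum_iff_of_le h2).1 (le_antisymm (Finset.sum_le_sum h2) h1)
  have hsupp : ∀ u ∈ U, w u ≠ 0 → c u = a := fun u hu hne => mul_left_cancel₀ hne (h3 u hu)
  rw [← Finset.sum_filter_of_ne (p := fun u => c u = a)
    fun u hu hne => hsupp u hu fun h => hne (by simp [h])]
  rw [← Finset.sum_filter_of_ne (p := fun u => c u = a) fun u hu hne => hsupp u hu hne] at hw1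
  refine (convex_convexHull ℝ _).sum_mem (fun u hu => hw0 u (Finset.mem_filter.1 hu).1) hw1
    fun u hu => subset_convexHull ℝ _ (Finset.mem_filter.1 hu)

/-- A convex function on a finite set has a maximizer that is an exposed point. -/
theorem exists_exposed_maximizer {U : Finset (Fin N → ℝ)} (hne : U.Nonempty)
    {c : (Fin N → ℝ) → ℝ} (hc : ConvexOn ℝ Set.univ c) :
    ∃ v ∈ U, (∀ u ∈ U, c u ≤ c v) ∧
      ∃ l : StrongDual ℝ (Fin N → ℝ), ∀ u ∈ U, u ≠ v → l u < l v := by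
  classical
  obtain ⟨v₀, hv₀, hmax⟩ := U.exists_max_image c hne
  set T : Set (Fin N → ℝ) := {u | u ∈ U ∧ c u = c v₀} with hT
  have hTfin : T.Finite := U.finite_toSet.subset fun u hu => hu.1
  obtain ⟨v, hv⟩ := hTfin.isCompact_convexHull (𝕜 := ℝ).extremePoints_nonempty
    ⟨v₀, subset_convexHull ℝ _ ⟨hv₀, rfl⟩⟩
  have hvT : v ∈ T := extremePoints_convexHull_subset hv
  have hv' := ((convex_convexHull ℝ T).mem_extremePoints_iff_mem_sdiff_convexHull_sdiff.1 hv).2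
  refine ⟨v, hvT.1, fun u hu => hvT.2 ▸ hmax u hu, ?_⟩
  -- Here `v` is an extreme point of the hull of the maximizers. If it were in the hull of the other
  -- points of `U`, the Jensen argument would put it in the hull of the other maximizers. So
  -- Hahn–Banach separates it strictly from the rest of `U`.
  have hnot : v ∉ convexHull ℝ ((U.erase v : Finset _) : Set (Fin N → ℝ)) := by
    intro h
    refine hv' (convexHull_mono ?_ (mem_convexHull_maximizers hc (a := c v₀)
      (fun u hu => hmax u (Finset.mem_of_mem_erase hu)) h hvT.2.ge))
    rintro u ⟨hu, huc⟩
    exact ⟨subset_convexHull ℝ _ ⟨Finset.mem_of_mem_erase hu, huc⟩, Finset.ne_of_mem_erase hu⟩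
  obtain ⟨l, s, h1, h2⟩ := geometric_hahn_banach_closed_point (convex_convexHull ℝ _)
    ((Finset.finite_toSet _).isClosed_convexHull (𝕜 := ℝ)) hnot
  exact ⟨l, fun u hu huv => (h1 u (subset_convexHull ℝ _ (by simp [hu, huv]))).trans h2⟩

theorem convexOn_strongDual (l : StrongDual ℝ (Fin N → ℝ)) : ConvexOn ℝ Set.univ l :=
  l.toLinearMap.convexOn convex_univ

/-- From a vertex `x` of a polytope at which the linear function `g` is not maximal there is an edge
along which `g` increases. -/
theorem exists_improving_edge {U : Finset (Fin N → ℝ)} {x y : Fin N → ℝ} (hx : x ∈ U) (hy : y ∈ U)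
    {l g : StrongDual ℝ (Fin N → ℝ)} (hl : ∀ u ∈ U, u ≠ x → l u < l x) (hg : g x < g y) :
    ∃ F z, ∃ w : Fin N → ℝ, IsEdge (convexHull ℝ (U : Set (Fin N → ℝ))) F ∧ z ∈ U ∧ 0 < g w ∧
      (∃ t : ℝ, 0 < t ∧ z - x = t • w) ∧ ∀ p ∈ F, ∃ t : ℝ, p - x = t • w := by
  classical
  -- The vertex figure at `x`: directions from `x` to the other points, scaled to lie in the
  -- hyperplane `l = -1`. An exposed point `w` of it that maximizes `g` will span an edge.
  set φ : (Fin N → ℝ) → (Fin N → ℝ) := fun u => (l x - l u)⁻¹ • (u - x) with hφ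
  have hyx : y ≠ x := by rintro rfl; exact lt_irrefl _ hg
  have hpos : ∀ u ∈ U, u ≠ x → 0 < l x - l u := fun u hu hne => sub_pos.2 (hl u hu hne)
  have hφu : ∀ u ∈ U, u ≠ x → u - x = (l x - l u) • φ u := fun u hu hne => by
    rw [hφ, smul_smul, mul_inv_cancel₀ (hpos u hu hne).ne', one_smul]
  obtain ⟨w, hw, hwmax, q, hq⟩ := exists_exposed_maximizer (U := (U.erase x).image φ)
    ⟨φ y, Finset.mem_image_of_mem _ (by simp [hyx, hy])⟩ (convexOn_strongDual g)
  obtain ⟨z, hz, hzw⟩ := Finset.mem_image.1 hw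
  obtain ⟨hzx, hzU⟩ := Finset.mem_erase.1 hz
  have hgw : 0 < g w := by
    refine lt_of_lt_of_le ?_ (hwmax (φ y) (Finset.mem_image_of_mem _ (by simp [hyx, hy])))
    rw [hφ, map_smul, map_sub]
    exact mul_pos (inv_pos.2 (hpos y hy hyx)) (sub_pos.2 hg)
  have hw0 : w ≠ 0 := by rintro rfl; simp at hgw
  -- Lifts the functional `q` exposing `w` to one whose maximizers in `U` are `x` and the points in
  -- direction `w` from `x`. The multiple of `l` makes `f` vanish on `w`.
  set f : StrongDual ℝ (Fin N → ℝ) := q + q w • l with hf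
  have hfu : ∀ u ∈ U, u ≠ x → f u - f x = (l x - l u) * (q (φ u) - q w) := fun u hu hne => by
    have : q u - q x = (l x - l u) * q (φ u) := by
      rw [← map_sub, hφu u hu hne, map_smul, smul_eq_mul]
    simp only [hf, add_apply, smul_apply, smul_eq_mul]
    linear_combination this
  have hfle : ∀ u ∈ U, f u ≤ f x := fun u hu => by
    by_cases hne : u = x
    · rw [hne]
    · have h1 := hfu u hu hne
      have h2 : q (φ u) ≤ q w := by
        by_cases h : φ u = w
        · rw [h]
        · exact (hq _ (Finset.mem_image_of_mem _ (by simp [hne, hu])) h).le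
      nlinarith [hpos u hu hne]
  have hfeq : ∀ u ∈ U, f u = f x → ∃ t : ℝ, u - x = t • w := fun u hu he => by
    by_cases hne : u = x
    · exact ⟨0, by simp [hne]⟩
    · have h1 := hfu u hu hne
      have h2 : φ u = w := by
        by_contra h
        have := hq _ (Finset.mem_image_of_mem _ (by simp [hne, hu])) h
        nlinarith [hpos u hu hne]
      exact ⟨_, by rw [← h2]; exact hφu u hu hne⟩
  set P := convexHull ℝ (U : Set (Fin N → ℝ)) with hP
  have hxP : x ∈ P := subset_convexHull ℝ _ hx
  have hfP : ∀ p ∈ P, f p ≤ f x := fun p hp => by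
    obtain ⟨u, hu, hpu⟩ := (convexOn_strongDual f).exists_ge_of_mem_convexHull
      (Set.subset_univ _) hp
    exact hpu.trans (hfle u hu)
  set F : Set (Fin N → ℝ) := {p | p ∈ P ∧ ∀ p' ∈ P, f p' ≤ f p} with hF
  have hline : ∀ p ∈ F, ∃ t : ℝ, p - x = t • w := by
    rintro p ⟨hp, hpm⟩
    have h := mem_convexHull_maximizers (convexOn_strongDual f) hfle hp (hpm x hxP)
    have hconv : Convex ℝ {p : Fin N → ℝ | ∃ t : ℝ, p - x = t • w} := by
      rintro a ⟨s, hs⟩ b ⟨t, ht⟩ α β - - hαβ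
      refine ⟨α * s + β * t, ?_⟩
      rw [add_smul, mul_smul, mul_smul, ← hs, ← ht, smul_sub, smul_sub]
      have : x = α • x + β • x := by rw [← add_smul, hαβ, one_smul]
      nth_rw 1 [this]
      abel
    exact convexHull_min (fun u hu => hfeq u hu.1 hu.2) hconv h
  have hzline : ∃ t : ℝ, 0 < t ∧ z - x = t • w :=
    ⟨_, hpos z hzU hzx, by rw [← hzw]; exact hφu z hzU hzx⟩
  have hxF : x ∈ F := ⟨hxP, hfP⟩
  have hzF : z ∈ F := by
    refine ⟨subset_convexHull ℝ _ hzU, fun p hp => (hfP p hp).trans_eq ?_⟩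
    have := hfu z hzU hzx
    rw [hzw, sub_self, mul_zero] at this
    linarith
  refine ⟨F, z, w, ⟨fun _ => ⟨f, rfl⟩, ?_⟩, hzU, hgw, hzline, hline⟩
  have hspan : vectorSpan ℝ F = Submodule.span ℝ {w} := by
    refine le_antisymm ?_ ?_
    · rw [vectorSpan, Submodule.span_le]
      rintro _ ⟨a, ha, a', ha', rfl⟩
      obtain ⟨s, hs⟩ := hline a ha
      obtain ⟨t, ht⟩ := hline a' ha'
      refine Submodule.mem_span_singleton.2 ⟨s - t, ?_⟩
      rw [sub_smul, ← hs, ← ht]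
      simp
    · rw [Submodule.span_singleton_le_iff_mem]
      obtain ⟨t, ht, hzt⟩ := hzline
      have := vsub_mem_vectorSpan ℝ hzF hxF
      rw [vsub_eq_sub, hzt] at this
      simpa [smul_smul, ht.ne'] using (vectorSpan ℝ F).smul_mem t⁻¹ this
  rw [hspan, finrank_span_singleton hw0]

/-- If `h` is positive on all edge-directions on which `g` is positive, then the maximizers of `h`
are maximizers of `g`. -/
theorem maximizes_of_edgeDirections {U : Finset (Fin N → ℝ)} {h g : StrongDual ℝ (Fin N → ℝ)}
    {S : Set (Fin N → ℝ)}
    (hS : ∀ F, IsEdge (convexHull ℝ (U : Set (Fin N → ℝ))) F → ∃ e ∈ S, IsDirection F e)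
    (hpos : ∀ e ∈ S, 0 < g e → 0 < h e) (hneg : ∀ e ∈ S, g e < 0 → h e < 0)
    {x : Fin N → ℝ} (hx : x ∈ U) (hxmax : ∀ u ∈ U, h u ≤ h x) : ∀ y ∈ U, g y ≤ g x := by
  classical
  intro y hy
  by_contra! hlt
  -- The point `x` need not be a vertex. It is replaced by an exposed point among the maximizers of
  -- `h` at which `g` is smallest, so that `g` is still not maximal there.
  obtain ⟨x', hx', hmin, l', hl'⟩ := exists_exposed_maximizer (U := U.filter fun u => h u = h x)
    ⟨x, by simp [hx]⟩ (convexOn_strongDual (-g))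
  obtain ⟨hx'U, hx'h⟩ := Finset.mem_filter.1 hx'
  have hgx' : g x' < g y := by
    have := hmin x (by simp [hx])
    simp only [neg_apply] at this
    linarith
  -- For large `K` the functional `K • h + l'` exposes `x'` in all of `U`: `h` excludes the points
  -- outside its maximal face and `l'` the others.
  have hev : ∀ᶠ K : ℝ in Filter.atTop, ∀ u ∈ U, u ≠ x' → K * h u + l' u < K * h x' + l' x' := by
    rw [Filter.eventually_all_finset]
    intro u hu
    by_cases hux : u = x'
    · exact Filter.Eventually.of_forall fun _ h => absurd hux h
    rcases (hxmax u hu).eq_or_lt with he | hl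
    · refine Filter.Eventually.of_forall fun K _ => ?_
      have := hl' u (by simp [hu, he]) hux
      rw [he, hx'h]; linarith
    · filter_upwards [Filter.eventually_gt_atTop ((l' u - l' x') / (h x - h u))] with K hK _
      rw [div_lt_iff₀ (sub_pos.2 hl)] at hK
      rw [hx'h]; linarith
  obtain ⟨K, hK⟩ := hev.exists
  obtain ⟨F, z, w, hF, hz, hgw, ⟨t, ht, hzt⟩, hline⟩ :=
    exists_improving_edge (l := K • h + l') hx'U hy (fun u hu hne => by simpa using hK u hu hne) hgx'
  obtain ⟨e, heS, p, hp, p', hp', hpp, s, hs, he⟩ := hS F hF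
  obtain ⟨a, ha⟩ := hline p hp
  obtain ⟨a', ha'⟩ := hline p' hp'
  have hew : e = (s * (a - a')) • w := by
    rw [he, mul_smul, sub_smul, ← ha, ← ha', sub_sub_sub_cancel_right]
  have hne : s * (a - a') ≠ 0 := by
    refine mul_ne_zero hs (sub_ne_zero.2 fun h => hpp ?_)
    rw [← sub_left_inj (a := x'), ha, ha', h]
  have hge : g e = s * (a - a') * g w := by rw [hew, map_smul, smul_eq_mul]
  have hhe : h e = s * (a - a') * h w := by rw [hew, map_smul, smul_eq_mul]
  -- The covering vector may point along the edge in either sense, hence the need for both sign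
  -- hypotheses.
  have hhw : 0 < h w := by
    rcases hne.lt_or_gt with hn | hn
    · have := hneg e heS (by rw [hge]; exact mul_neg_of_neg_of_pos hn hgw)
      rw [hhe] at this
      exact pos_of_mul_neg_right this hn.le
    · have := hpos e heS (by rw [hge]; exact mul_pos hn hgw)
      rw [hhe] at this
      exact pos_of_mul_pos_right this hn.le
  have h1 : h z - h x' = t * h w := by rw [← map_sub, hzt, map_smul, smul_eq_mul]
  have h2 := hxmax z hz
  have := mul_pos ht hhw
  linarith

/-! ## Sign vectors -/

/-- A matrix with independent columns over a field has a nonsingular maximal square submatrix. -/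
theorem exists_submatrix_det_ne_zero {K ι κ : Type*} [Field K] [Finite ι] [Fintype κ] [DecidableEq κ]
    (B : Matrix ι κ K) (hB : ∀ y, B.mulVec y = 0 → y = 0) :
    ∃ f : κ → ι, (B.submatrix f id).det ≠ 0 := by
  cases nonempty_fintype ι
  have hcol : LinearIndependent K B.col := by
    rw [← Matrix.mulVec_injective_iff]
    exact (injective_iff_map_eq_zero B.mulVecLin).2 hB
  have hrank : B.rank = Fintype.card κ := by
    rw [← Matrix.rank_transpose]
    exact LinearIndependent.rank_matrix (M := B.transpose) hcol
  -- Column rank equals row rank, so the rows span the whole space and contain a basis.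
  have hspan : Submodule.span K (Set.range B.row) = ⊤ := by
    refine Submodule.eq_top_of_finrank_eq ?_
    rw [← Matrix.rank_eq_finrank_span_row, hrank, Module.finrank_fintype_fun_eq_card]
  obtain ⟨κ', a, -, hsp, hli⟩ := exists_linearIndependent' K B.row
  have hbasis := Module.Basis.mk hli (by rw [hsp, hspan])
  have : Fintype κ' := FiniteDimensional.fintypeBasisIndex hbasis
  have hcard : Fintype.card κ' = Fintype.card κ := by
    rw [← Module.finrank_eq_card_basis hbasis, Module.finrank_fintype_fun_eq_card]
  let e : κ ≃ κ' := (Fintype.equivOfCardEq hcard).symm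
  refine ⟨a ∘ e, ?_⟩
  have : LinearIndependent K (B.submatrix (a ∘ e) id).row := hli.comp e e.injective
  rw [Matrix.linearIndependent_rows_iff_isUnit, Matrix.isUnit_iff_isUnit_det] at this
  exact this.ne_zero

/-- A nonempty pointed polyhedron `{g : 1 ≤ a_t g}` has a vertex. -/
theorem exists_vertex {ι : Type*} [Fintype ι] (a : ι → Fin N → ℝ) (g₀ : Fin N → ℝ)
    (h₀ : ∀ t, 1 ≤ a t ⬝ᵥ g₀) (hpt : ∀ y, (∀ t, a t ⬝ᵥ y = 0) → y = 0) :
    ∃ g, (∀ t, 1 ≤ a t ⬝ᵥ g) ∧ ∀ y, (∀ t, a t ⬝ᵥ g = 1 → a t ⬝ᵥ y = 0) → y = 0 := by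
  classical
  let tight : (Fin N → ℝ) → Finset ι := fun g => Finset.univ.filter fun t => a t ⬝ᵥ g = 1
  -- A feasible `g` whose set of tight constraints is maximal under inclusion is a vertex.
  obtain ⟨s, ⟨g, hg, hgs⟩, hmax⟩ := (Set.toFinite {s : Finset ι |
    ∃ g, (∀ t, 1 ≤ a t ⬝ᵥ g) ∧ tight g = s}).exists_maximal ⟨_, g₀, h₀, rfl⟩
  refine ⟨g, hg, fun y hy => ?_⟩
  by_contra hne
  obtain ⟨z, hz, t₁, ht₁⟩ : ∃ z, (∀ t, a t ⬝ᵥ g = 1 → a t ⬝ᵥ z = 0) ∧ ∃ t, a t ⬝ᵥ z < 0 := by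
    obtain ⟨t, ht⟩ : ∃ t, a t ⬝ᵥ y ≠ 0 := by
      by_contra! h; exact hne (hpt y h)
    rcases ht.lt_or_gt with h | h
    · exact ⟨y, hy, t, h⟩
    · exact ⟨-y, fun t ht => by rw [dotProduct_neg, hy t ht, neg_zero], t, by
        rw [dotProduct_neg]; linarith⟩
  -- Ratio test: along `z` the tight constraints remain tight, and the first constraint to be
  -- reached becomes tight as well, contradicting maximality.
  obtain ⟨t₂, ht₂, hmin⟩ := (Finset.univ.filter fun t => a t ⬝ᵥ z < 0).exists_min_image
    (fun t => (a t ⬝ᵥ g - 1) / (-(a t ⬝ᵥ z))) ⟨t₁, by simp [ht₁]⟩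
  simp only [Finset.mem_filter, Finset.mem_univ, true_and] at ht₂ hmin
  set r := (a t₂ ⬝ᵥ g - 1) / (-(a t₂ ⬝ᵥ z)) with hr
  have hr0 : 0 ≤ r := div_nonneg (by linarith [hg t₂]) (by linarith)
  have hfeas : ∀ t, 1 ≤ a t ⬝ᵥ (g + r • z) := fun t => by
    rw [dotProduct_add, dotProduct_smul, smul_eq_mul]
    by_cases ht : a t ⬝ᵥ z < 0
    · have := hmin t ht
      rw [le_div_iff₀ (by linarith)] at this
      linarith
    · nlinarith [hg t, not_lt.1 ht]
  have hsub : tight g ⊆ tight (g + r • z) := fun t ht => by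
    simp only [tight, Finset.mem_filter, Finset.mem_univ, true_and] at ht ⊢
    rw [dotProduct_add, dotProduct_smul, hz t ht, ht]; simp
  have hmem : t₂ ∈ tight (g + r • z) := by
    simp only [tight, Finset.mem_filter, Finset.mem_univ, true_and]
    rw [dotProduct_add, dotProduct_smul, smul_eq_mul]
    have : r * (-(a t₂ ⬝ᵥ z)) = a t₂ ⬝ᵥ g - 1 := div_mul_cancel₀ _ (by linarith)
    linarith
  have h1 := hmax ⟨g + r • z, hfeas, rfl⟩ (hgs ▸ hsub)
  have h2 := h1 hmem
  rw [← hgs] at h2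
  simp only [tight, Finset.mem_filter, Finset.mem_univ, true_and] at h2
  have := hz t₂ h2
  linarith

end Geometry

end ConvIntMax

namespace ConvIntMax

open Filter

theorem intCast_mulVec {d n : ℕ} (W : Matrix (Fin d) (Fin n) ℤ) (z : Fin n → ℤ) :
    (W.map fun a : ℤ => (a : ℝ)).mulVec (fun j => (z j : ℝ)) =
      fun i => ((W.mulVec z i : ℤ) : ℝ) := by
  funext i
  simp [Matrix.mulVec, dotProduct]

theorem intCast_dotProduct {n : ℕ} (u v : Fin n → ℤ) :
    (fun j => (u j : ℝ)) ⬝ᵥ (fun j => (v j : ℝ)) = ((u ⬝ᵥ v : ℤ) : ℝ) := by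
  simp [dotProduct]

/-- Among the vectors `normalVec B`, for the matrices `B` of rows of a symmetric list of vectors
that contains the unit vectors, there are representatives of all sign patterns on the list. -/
theorem exists_normalVec_sign {d cnt : ℕ} (a : Fin cnt → Fin d → ℤ)
    (hneg : ∀ t, ∃ t', a t' = -a t) (hunit : ∀ j, ∃ t, a t = Pi.single j 1) (g₀ : Fin d → ℝ) :
    ∃ f : Fin d → Fin cnt, ∀ t, 0 < (fun i => (a t i : ℝ)) ⬝ᵥ g₀ →
      0 < a t ⬝ᵥ normalVec fun l => a (f l) := by
  classical
  set ar : Fin cnt → Fin d → ℝ := fun t i => (a t i : ℝ) with har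
  -- Finitely many hyperplanes do not cover the space, so some `q` is orthogonal to no nonzero
  -- vector of the list. Adding it to a large multiple of `g₀` removes all zero signs and keeps the
  -- positive ones.
  obtain ⟨q, hq⟩ := Module.Dual.exists_forall_ne_zero_of_forall_exists
    (fun t : {t // ar t ≠ 0} => (LinearMap.proj t.1).comp (Matrix.mulVecLin (Matrix.of ar)))
    (fun t => ⟨ar t, fun h => t.2 (dotProduct_self_eq_zero.1 h)⟩)
  replace hq : ∀ t, ar t ≠ 0 → ar t ⬝ᵥ q ≠ 0 := fun t ht => hq ⟨t, ht⟩
  have hev : ∀ᶠ K : ℝ in atTop, ∀ t, ar t ≠ 0 → ar t ⬝ᵥ (K • g₀ + q) ≠ 0 ∧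
      (0 < ar t ⬝ᵥ g₀ → 0 < ar t ⬝ᵥ (K • g₀ + q)) := by
    rw [eventually_all]
    intro t
    simp only [dotProduct_add, dotProduct_smul, smul_eq_mul]
    rcases lt_trichotomy (ar t ⬝ᵥ g₀) 0 with h | h | h
    · filter_upwards [eventually_gt_atTop (-(ar t ⬝ᵥ q) / ar t ⬝ᵥ g₀)] with K hK _
      rw [div_lt_iff_of_neg h] at hK
      exact ⟨by linarith, fun h' => absurd h' h.not_gt⟩
    · exact Eventually.of_forall fun K ht => ⟨by simpa [h] using hq t ht, fun h' => absurd h h'.ne'⟩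
    · filter_upwards [eventually_gt_atTop (-(ar t ⬝ᵥ q) / ar t ⬝ᵥ g₀)] with K hK _
      rw [div_lt_iff₀ h] at hK
      exact ⟨by linarith, fun _ => by linarith⟩
  obtain ⟨K, hK⟩ := hev.exists
  set g₁ := K • g₀ + q with hg₁
  -- Scaling `g₁` turns the strict inequalities into `1 ≤ a t ⬝ᵥ g`, so that this system is
  -- feasible.
  have hev' : ∀ᶠ s : ℝ in atTop, ∀ t : {t // 0 < ar t ⬝ᵥ g₁}, 1 ≤ ar t.1 ⬝ᵥ (s • g₁) := by
    rw [eventually_all]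
    rintro ⟨t, ht⟩
    filter_upwards [eventually_ge_atTop (1 / ar t ⬝ᵥ g₁)] with s hs
    rw [div_le_iff₀ ht] at hs
    simpa using hs
  obtain ⟨s, hs⟩ := hev'.exists
  -- The polyhedron is pointed: for each coordinate, the unit vector or its negative has positive
  -- sign.
  have hpt : ∀ y, (∀ t : {t // 0 < ar t ⬝ᵥ g₁}, ar t.1 ⬝ᵥ y = 0) → y = 0 := fun y hy => by
    funext j
    obtain ⟨t, ht⟩ := hunit j
    obtain ⟨t', ht'⟩ := hneg t
    have h1 : ar t = Pi.single j 1 := by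
      funext i; rw [har]; simp only [ht, Pi.single_apply]; split_ifs <;> simp
    have h2 : ar t' = -Pi.single j 1 := by
      rw [← h1]; funext i; simp [har, ht']
    have h0 : ar t ≠ 0 := by
      rw [h1]; intro h; simpa using congrFun h j
    rcases (hK t h0).1.lt_or_gt with h | h
    · have := hy ⟨t', by rw [h2, neg_dotProduct, ← h1]; linarith⟩
      simp only [h2, neg_dotProduct, single_one_dotProduct, neg_eq_zero] at this
      exact this
    · have := hy ⟨t, h⟩
      simp only [h1, single_one_dotProduct] at this
      exact this
  obtain ⟨g, hg, hvert⟩ := exists_vertex (fun t : {t // 0 < ar t ⬝ᵥ g₁} => ar t.1) (s • g₁) hs hpt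
  obtain ⟨f, hf⟩ := exists_submatrix_det_ne_zero
    (Matrix.of fun t : {t : {t // 0 < ar t ⬝ᵥ g₁} // ar t.1 ⬝ᵥ g = 1} => ar t.1.1)
    (fun y hy => hvert y fun t ht => congrFun hy ⟨t, ht⟩)
  set B : Matrix (Fin d) (Fin d) ℤ := fun l => a (f l).1.1 with hB
  set Br : Matrix (Fin d) (Fin d) ℝ := B.map (Int.castRingHom ℝ) with hBr
  have hdet : (B.det : ℝ) ≠ 0 := by
    rw [← eq_intCast (Int.castRingHom ℝ), RingHom.map_det]
    exact hf
  have hBg : Br.mulVec g = fun _ => 1 := funext fun l => (f l).2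
  have hadj : Br.adjugate.mulVec (fun _ => 1) = (B.det : ℝ) • g := by
    rw [← hBg, Matrix.mulVec_mulVec, Matrix.adjugate_mul, Matrix.smul_mulVec, Matrix.one_mulVec,
      ← eq_intCast (Int.castRingHom ℝ), RingHom.map_det]
    rfl
  -- Multiplying by `det B` twice gives a square, so the signs of `g` are kept whatever the sign of
  -- the determinant.
  have hn : (fun i => (normalVec B i : ℝ)) = ((B.det : ℝ) * B.det) • g := by
    funext i
    have h1 := congrFun hadj i
    simp only [Matrix.mulVec, dotProduct, mul_one, Pi.smul_apply, smul_eq_mul] at h1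
    have h2 : Br.adjugate = B.adjugate.map (Int.castRingHom ℝ) :=
      (RingHom.map_adjugate (Int.castRingHom ℝ) B).symm
    rw [h2] at h1
    simp only [Matrix.map_apply, eq_intCast] at h1
    simp only [normalVec, Pi.smul_apply, smul_eq_mul]
    rw [Int.cast_mul, Int.cast_sum, h1, mul_assoc]
  refine ⟨fun l => (f l).1.1, fun t ht => ?_⟩
  have ht0 : ar t ≠ 0 := by
    intro h; rw [show (fun i => (a t i : ℝ)) = 0 from h, zero_dotProduct] at ht; exact lt_irrefl _ ht
  have ht1 := hg ⟨t, (hK t ht0).2 ht⟩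
  have : (0 : ℝ) < ((a t ⬝ᵥ normalVec B : ℤ) : ℝ) := by
    rw [← intCast_dotProduct, hn, dotProduct_smul, smul_eq_mul]
    exact mul_pos (mul_self_pos.2 hdet) (zero_lt_one.trans_le ht1)
  exact_mod_cast this

variable {d n m k : ℕ} {O : Oracles d n} {W : Matrix (Fin d) (Fin n) ℤ}
  {A : Matrix (Fin m) (Fin n) ℤ} {b : Fin m → ℤ} {c : (Fin d → ℝ) → ℝ} {E : Fin k → Fin n → ℤ}

theorem signedRows_image (t : Fin k) :
    signedRows W E ⟨t, by omega⟩ = W.mulVec (E t) := by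
  funext i
  have := t.2
  simp only [signedRows, normalRows]
  rw [if_pos (by omega), dif_pos t.2]

theorem signedRows_neg (t : Fin (2 * (k + d))) : ∃ t', signedRows W E t' = -signedRows W E t := by
  by_cases ht : (t : ℕ) < k + d
  · refine ⟨⟨k + d + t, by omega⟩, funext fun i => ?_⟩
    simp only [signedRows, Pi.neg_apply]
    rw [if_neg (by omega), if_pos ht, Nat.add_sub_cancel_left]
  · refine ⟨⟨t - (k + d), by omega⟩, funext fun i => ?_⟩
    simp only [signedRows, Pi.neg_apply]
    rw [if_pos (by omega), if_neg ht, neg_neg]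

theorem signedRows_unit (j : Fin d) : ∃ t, signedRows W E t = Pi.single j 1 := by
  refine ⟨⟨k + j, by omega⟩, funext fun i => ?_⟩
  have := j.2
  simp only [signedRows, normalRows, Pi.single_apply]
  rw [if_pos (by omega), dif_neg (by omega)]
  exact if_congr (by rw [Fin.ext_iff]; omega) rfl rfl

/-- A finite optimum of the `j`-th coordinate bounds that coordinate, so the feasible natural
vectors lie in a box. -/
theorem finite_feasible_of_lin (hlin : IsLinearOracle A b O.lin)
    (hunit : ∀ j : Fin n, O.lin (Pi.single j 1) ≠ .unbounded) : (feasible A b).Finite := by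
  rcases (feasible A b).eq_empty_or_nonempty with he | ⟨y, hy⟩
  · rw [he]; exact Set.finite_empty
  have : ∀ j : Fin n, ∃ B : ℕ, ∀ y ∈ feasible A b, y j ≤ B := fun j => by
    have h := hlin (Pi.single j 1)
    cases hr : O.lin (Pi.single j 1) with
    | optimal x =>
      rw [hr] at h
      exact ⟨x j, fun y hy => by simpa using h.2 y hy⟩
    | infeasible =>
      rw [hr] at h
      exact absurd hy (by rw [show feasible A b = ∅ from h]; exact Set.notMem_empty y)
    | unbounded => exact absurd hr (hunit j)
  choose B hB using this
  exact (Set.finite_Iic B).subset fun y hy j => hB j y hy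

/-- The inner product with a vector as a continuous linear functional. -/
noncomputable def dotDual {n : ℕ} (h : Fin n → ℝ) : StrongDual ℝ (Fin n → ℝ) :=
  LinearMap.toContinuousLinearMap ((LinearMap.proj ()).comp
    (Matrix.mulVecLin (Matrix.of fun _ : Unit => h)))

@[simp] theorem dotDual_apply {n : ℕ} (h x : Fin n → ℝ) : dotDual h x = h ⬝ᵥ x := rfl

/-- If no query is unbounded, then the optimal solutions returned for the queries include an optimal
solution of the convex integer program. -/
theorem exists_optimal_query (hc : ConvexOn ℝ Set.univ c)
    (hE : CoversEdgeDirections (Set.range E) (integerHull A b)) (hlin : IsLinearOracle A b O.lin)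
    (hunit : ∀ j : Fin n, O.lin (Pi.single j 1) ≠ .unbounded)
    (hq : ∀ f : Fin d → Fin (2 * (k + d)), O.lin (W.transpose.mulVec
        (normalVec fun l => signedRows W E (f l))) ≠ .unbounded) (y : Fin n → ℕ)
    (hy : y ∈ feasible A b) : ∃ (f : Fin d → Fin (2 * (k + d))) (x : Fin n → ℕ),
        O.lin (W.transpose.mulVec (normalVec fun l => signedRows W E (f l))) = .optimal x ∧
        objective W c y ≤ objective W c x := by
  classical
  have hfin := finite_feasible_of_lin hlin hunit
  set cast : (Fin n → ℕ) → Fin n → ℝ := fun x j => (x j : ℝ) with hcast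
  set U : Finset (Fin n → ℝ) := hfin.toFinset.image cast with hU
  have hUmem : ∀ x ∈ feasible A b, cast x ∈ U := fun x hx =>
    Finset.mem_image_of_mem _ (by simpa using hx)
  have hUhull : convexHull ℝ (U : Set (Fin n → ℝ)) = integerHull A b := by
    rw [integerHull, hU, Finset.coe_image, Set.Finite.coe_toFinset]
  set Wr : Matrix (Fin d) (Fin n) ℝ := W.map fun a : ℤ => (a : ℝ) with hWr
  have hobj : ∀ x, objective W c x = c (Wr.mulVec (cast x)) := fun x => by
    rw [objective, ← intCast_mulVec]
    rfl
  -- The optimum of `c` is sought at an exposed point of the image in dimension `d`, where a linear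
  -- functional identifies it uniquely.
  obtain ⟨v, hv, hvmax, l, hl⟩ := exists_exposed_maximizer (U := U.image Wr.mulVec)
    ⟨_, Finset.mem_image_of_mem _ (hUmem y hy)⟩ hc
  obtain ⟨u, hu, rfl⟩ := Finset.mem_image.1 hv
  set g₀ : Fin d → ℝ := fun i => l (Pi.single i 1) with hg₀
  have hlg : ∀ p, l p = p ⬝ᵥ g₀ := fun p => by
    have := LinearMap.pi_apply_eq_sum_univ (l : (Fin d → ℝ) →ₗ[ℝ] ℝ) p
    refine this.trans (Finset.sum_congr rfl fun i _ => ?_)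
    exact congrArg (fun q => p i * l q) (funext fun j => by simp [Pi.single_apply, eq_comm])
  obtain ⟨f, hf⟩ := exists_normalVec_sign (signedRows W E) signedRows_neg signedRows_unit g₀
  set g := normalVec fun l => signedRows W E (f l) with hg
  set h := W.transpose.mulVec g with hh
  have hC := hlin h
  cases hr : O.lin h with
  | infeasible =>
    rw [hr] at hC
    exact absurd hy (by rw [show feasible A b = ∅ from hC]; exact Set.notMem_empty y)
  | unbounded => exact absurd hr (hq f)
  | optimal x =>
    rw [hr] at hC
    refine ⟨f, x, hr, ?_⟩
    have hEh : ∀ e : Fin n → ℤ, h ⬝ᵥ e = W.mulVec e ⬝ᵥ g := fun e => by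
      rw [hh, Matrix.mulVec_transpose, ← Matrix.dotProduct_mulVec, dotProduct_comm]
    have hlE : ∀ e : Fin n → ℤ, l (Wr.mulVec fun j => (e j : ℝ)) =
        (fun i => ((W.mulVec e i : ℤ) : ℝ)) ⬝ᵥ g₀ := fun e => by rw [hlg, intCast_mulVec]
    have key := maximizes_of_edgeDirections (U := U) (h := dotDual fun j => (h j : ℝ))
      (g := l.comp (LinearMap.toContinuousLinearMap Wr.mulVecLin))
      (S := Set.range fun t j => (E t j : ℝ))
      (fun F hF => by
        rw [hUhull] at hF
        obtain ⟨e, ⟨t, rfl⟩, he⟩ := hE F hF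
        exact ⟨_, ⟨t, rfl⟩, he⟩)
      (by
        rintro _ ⟨t, rfl⟩ hpos
        have hpos' : 0 < l (Wr.mulVec fun j => (E t j : ℝ)) := hpos
        rw [hlE, ← signedRows_image] at hpos'
        have := hf _ hpos'
        rw [signedRows_image, ← hEh] at this
        rw [dotDual_apply, intCast_dotProduct]
        exact_mod_cast this)
      (by
        rintro _ ⟨t, rfl⟩ hneg
        have hneg' : l (Wr.mulVec fun j => (E t j : ℝ)) < 0 := hneg
        rw [hlE] at hneg'
        -- The list is closed under negation, so agreement on positive signs gives agreement on
        -- negative ones.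
        obtain ⟨t', ht'⟩ := signedRows_neg (W := W) (E := E) ⟨t, by omega⟩
        rw [signedRows_image] at ht'
        have := hf t' (by
          rw [ht']
          have : (fun i => ((-W.mulVec (E t) : Fin d → ℤ) i : ℝ)) =
              -fun i => ((W.mulVec (E t) i : ℤ) : ℝ) := by funext i; simp
          rw [this, neg_dotProduct]
          linarith)
        rw [ht', neg_dotProduct, ← hEh] at this
        rw [dotDual_apply, intCast_dotProduct]
        have : h ⬝ᵥ E t < 0 := by linarith
        exact_mod_cast this)
      (hUmem x hC.1)
      (fun u hu => by
        obtain ⟨z, hz, rfl⟩ := Finset.mem_image.1 hu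
        have := hC.2 z (by simpa using hz)
        have h1 := intCast_dotProduct h fun j => (z j : ℤ)
        have h2 := intCast_dotProduct h fun j => (x j : ℤ)
        simp only [Int.cast_natCast] at h1 h2
        rw [dotDual_apply, dotDual_apply, hcast, h1, h2]
        exact_mod_cast this)
    -- The reply `x` may differ from `u`, but it maximizes `l ∘ W`, and `l` has only one maximizer
    -- in the image.
    have hxu : Wr.mulVec (cast x) = Wr.mulVec u := by
      by_contra hne
      exact absurd (key u hu)
        (not_le.2 (hl _ (Finset.mem_image_of_mem _ (hUmem x hC.1)) hne))
    rw [hobj, hobj, hxu]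
    exact hvmax _ (Finset.mem_image_of_mem _ (hUmem y hy))

end ConvIntMax

namespace ConvIntMax

/-! ## The size of integer points of a bounded polyhedron -/

variable {m n : ℕ} {A : Matrix (Fin m) (Fin n) ℤ} {b : Fin m → ℤ}

theorem isClosed_polyhedron : IsClosed (polyhedron A b) := by
  refine IsClosed.inter (isClosed_le continuous_const continuous_id) (isClosed_eq ?_ continuous_const)
  exact Continuous.matrix_mulVec continuous_const continuous_id

/-- The columns of `A` on the support of an extreme point of the polyhedron are independent. -/
theorem eq_zero_of_extreme {z : Fin n → ℝ} (hz : z ∈ (polyhedron A b).extremePoints ℝ)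
    {y : Fin n → ℝ} (hy : (A.map fun a : ℤ => (a : ℝ)).mulVec y = 0) (hs : ∀ j, z j = 0 → y j = 0) :
    y = 0 := by
  -- For small `ε` both `z + ε y` and `z - ε y` stay in the polyhedron, since `y` vanishes off the
  -- support of `z`; extremality then forces `y = 0`.
  have hev : ∀ᶠ ε : ℝ in nhdsWithin 0 (Set.Ioi 0), ∀ j, ε * |y j| ≤ z j := by
    rw [Filter.eventually_all]
    intro j
    rcases (hz.1.1 j).eq_or_lt with h | h
    · have h' : z j = 0 := h.symm
      simp [hs j h', h']
    · have : Filter.Tendsto (fun ε : ℝ => ε * |y j|) (nhdsWithin 0 (Set.Ioi 0)) (nhds (0 * |y j|)) :=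
        ((continuous_id.mul continuous_const).tendsto 0).mono_left nhdsWithin_le_nhds
      rw [zero_mul] at this
      exact (this.eventually_lt_const h).mono fun _ => le_of_lt
  obtain ⟨ε, hε, hε0⟩ := (hev.and self_mem_nhdsWithin).exists
  have hε0 : 0 < ε := hε0
  have hmem : ∀ s : ℝ, |s| = ε → z + s • y ∈ polyhedron A b := fun s hs => by
    refine ⟨fun j => ?_, ?_⟩
    · have h1 := hε j
      have h2 := neg_abs_le (s * y j)
      rw [abs_mul, hs] at h2
      simp only [Pi.zero_apply, Pi.add_apply, Pi.smul_apply, smul_eq_mul]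
      linarith
    · rw [Matrix.mulVec_add, Matrix.mulVec_smul, hy, smul_zero, add_zero, hz.1.2]
  have h := hz.2 (hmem ε (abs_of_pos hε0)) (hmem (-ε) (by rw [abs_neg, abs_of_pos hε0]))
    ⟨1 / 2, 1 / 2, by norm_num, by norm_num, by norm_num, by
      funext j
      simp only [Pi.add_apply, Pi.smul_apply, smul_eq_mul]
      ring⟩
  have h' : ε • y = 0 := by simpa using h
  exact (smul_eq_zero.1 h').resolve_left hε0.ne'

/-- Cramer's rule: the nonzero coordinates of `z` solve a nonsingular square subsystem. Its
determinant is a nonzero integer, so `z j` is at most the numerator, a determinant of order `r ≤ n`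
bounded by `r! * 2 ^ (L * r)`. -/
theorem extreme_le {L : ℕ} (hA : ∀ i j, bitSize (A i j) ≤ L) (hb : ∀ i, bitSize (b i) ≤ L)
    {z : Fin n → ℝ} (hz : z ∈ (polyhedron A b).extremePoints ℝ) (j : Fin n) :
    z j ≤ 2 ^ (n * n + n * L) := by
  classical
  by_cases hj : z j = 0
  · rw [hj]; positivity
  set Ar : Matrix (Fin m) (Fin n) ℝ := A.map fun a : ℤ => (a : ℝ) with hAr
  have hext : ∀ y : {j // z j ≠ 0} → ℝ,
      Ar.mulVec (fun j => if h : z j ≠ 0 then y ⟨j, h⟩ else 0) =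
        (Ar.submatrix id Subtype.val).mulVec y := fun y => by
    funext i
    simp only [Matrix.mulVec, dotProduct, Matrix.submatrix_apply, id]
    refine (Fintype.sum_of_injective Subtype.val Subtype.val_injective _ _ (fun j hj => ?_)
      fun j => ?_).symm
    · have : z j = 0 := by simpa using hj
      simp [this]
    · rw [dif_pos j.2]
  have hzS : (Ar.submatrix id Subtype.val).mulVec (fun j : {j // z j ≠ 0} => z j) =
      fun i => (b i : ℝ) := by
    rw [← hext, ← hz.1.2]
    congr 1
    funext j
    split_ifs with h
    · rfl
    · exact (not_not.1 h).symm
  obtain ⟨f, hf⟩ := exists_submatrix_det_ne_zero (Ar.submatrix id (Subtype.val : {j // z j ≠ 0} → _))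
    (fun y hy => by
      have := eq_zero_of_extreme hz ((hext y).trans hy) (fun j hj => by simp [hj])
      funext j
      have h := congrFun this j
      rwa [dif_pos j.2] at h)
  set B : Matrix {j // z j ≠ 0} {j // z j ≠ 0} ℤ := A.submatrix f Subtype.val with hB
  set Br : Matrix {j // z j ≠ 0} {j // z j ≠ 0} ℝ := B.map (Int.castRingHom ℝ) with hBr
  set j' : {j // z j ≠ 0} := ⟨j, hj⟩
  have hBdet : Br.det = (B.det : ℝ) := by
    rw [← eq_intCast (Int.castRingHom ℝ), RingHom.map_det]; rfl
  have hdet : (1 : ℝ) ≤ |(B.det : ℝ)| := by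
    have : B.det ≠ 0 := fun h => hf (by
      have h2 := hBdet
      rw [h, Int.cast_zero] at h2
      exact h2)
    exact_mod_cast Int.one_le_abs this
  have hBz : Br.mulVec (fun j => z j) = fun i => (b (f i) : ℝ) :=
    funext fun i => congrFun hzS (f i)
  have hcr : Br.det * z j = ((B.updateCol j' fun i => b (f i)).det : ℝ) := by
    have h1 := congrArg Br.adjugate.mulVec hBz
    rw [Matrix.mulVec_mulVec, Matrix.adjugate_mul, Matrix.smul_mulVec, Matrix.one_mulVec,
      ← Matrix.cramer_eq_adjugate_mulVec] at h1
    have h2 := congrFun h1 j'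
    rw [Matrix.cramer_apply] at h2
    refine h2.trans ?_
    rw [← eq_intCast (Int.castRingHom ℝ), RingHom.map_det]
    congr 1
    ext i l
    simp only [RingHom.mapMatrix_apply, Matrix.map_apply, Matrix.updateCol_apply, hBr]
    split_ifs <;> simp
  have habs : ∀ x : ℤ, bitSize x ≤ L → |x| ≤ 2 ^ L := fun x hx => by
    have h := natAbs_lt_two_pow_bitSize x
    have h' : x.natAbs ≤ 2 ^ L := h.le.trans (Nat.pow_le_pow_right (by omega) (by omega))
    rw [Int.abs_eq_natAbs]
    exact_mod_cast h'
  have hN := Matrix.det_le (A := B.updateCol j' fun i => b (f i)) (abv := AbsoluteValue.abs)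
    (x := 2 ^ L) (fun i l => by
      simp only [Matrix.updateCol_apply, AbsoluteValue.abs_apply]
      split_ifs
      · exact habs _ (hb _)
      · exact habs _ (hA _ _))
  have hcard : Fintype.card {j // z j ≠ 0} ≤ n :=
    (Fintype.card_subtype_le fun j => z j ≠ 0).trans_eq (Fintype.card_fin n)
  set r := Fintype.card {j // z j ≠ 0}
  have hfac : r.factorial ≤ 2 ^ (n * n) := by
    calc r.factorial ≤ r ^ r := Nat.factorial_le_pow r
      _ ≤ (2 ^ n) ^ r := by gcongr; exact hcard.trans Nat.lt_two_pow_self.le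
      _ = 2 ^ (n * r) := by rw [pow_mul]
      _ ≤ 2 ^ (n * n) := by gcongr; norm_num
  have hN' : |(B.updateCol j' fun i => b (f i)).det| ≤ 2 ^ (n * n + n * L) := by
    refine hN.trans ?_
    rw [nsmul_eq_mul, pow_add]
    have h1 : ((r.factorial : ℕ) : ℤ) ≤ 2 ^ (n * n) := by exact_mod_cast hfac
    have h2 : ((2 : ℤ) ^ L) ^ r ≤ 2 ^ (n * L) := by
      rw [← pow_mul, mul_comm L r]
      gcongr; norm_num
    gcongr
  have hfinal : |Br.det| * |z j| ≤ 2 ^ (n * n + n * L) := by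
    rw [← abs_mul, hcr]; exact_mod_cast hN'
  rw [hBdet] at hfinal
  have := abs_nonneg (z j)
  nlinarith [le_abs_self (z j)]

/-- The integer points of a bounded polyhedron have polynomial size. -/
theorem vecSize_le_of_isBounded {L : ℕ} (hA : ∀ i j, bitSize (A i j) ≤ L)
    (hb : ∀ i, bitSize (b i) ≤ L) (hbd : Bornology.IsBounded (polyhedron A b)) {x : Fin n → ℕ}
    (hx : x ∈ feasible A b) : vecSize (fun j => (x j : ℤ)) ≤ n * n + n * L + 2 := by
  refine vecSize_le fun j => ?_
  have hcomp : IsCompact (polyhedron A b) := Metric.isCompact_of_isClosed_isBounded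
    isClosed_polyhedron hbd
  have hxP := cast_mem_polyhedron hx
  obtain ⟨p, hp, hpmax⟩ := hcomp.exists_isMaxOn ⟨_, hxP⟩ (continuous_apply j).continuousOn
  -- The face on which coordinate `j` is maximal is compact and so has an extreme point, which is
  -- also extreme in the polyhedron.
  set F := (ContinuousLinearMap.proj (R := ℝ) (φ := fun _ : Fin n => ℝ) j).toExposed (polyhedron A b)
    with hF
  have hexp : IsExposed ℝ (polyhedron A b) F := ContinuousLinearMap.toExposed.isExposed
  obtain ⟨z, hz⟩ := (hexp.isCompact hcomp).extremePoints_nonempty ⟨p, hp, fun y hy => hpmax hy⟩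
  have hzP := hexp.isExtreme.extremePoints_subset_extremePoints hz
  have h1 : (x j : ℝ) ≤ z j := hz.1.2 _ hxP
  have h2 := h1.trans (extreme_le hA hb hzP j)
  have h3 : x j ≤ 2 ^ (n * n + n * L) := by exact_mod_cast h2
  -- The `2` in the bound consists of the sign bit and one bit for passing from `≤` to `<` a power
  -- of two.
  rw [bitSize_le_succ_iff, Int.natAbs_natCast, pow_succ]
  have : 0 < 2 ^ (n * n + n * L) := by positivity
  omega

end ConvIntMax

namespace ConvIntMax

/-! ## Polynomial bounds -/

/-- Each nesting level contributes one factor `C`; the bound is polynomial because the depth is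
fixed. -/
theorem exists_polynomial_nestSteps (d : ℕ) (C T : Polynomial ℕ) (l : ℕ) :
    ∃ P : Polynomial ℕ, ∀ X cnt t, cnt ≤ C.eval X → t ≤ T.eval X →
      nestSteps d cnt t l ≤ P.eval X := by
  induction l with
  | zero => exact ⟨T, fun X cnt t _ ht => ht⟩
  | succ l ih =>
    obtain ⟨P, hP⟩ := ih
    refine ⟨C * (P + ((d * 7 + 7 : ℕ) : Polynomial ℕ)) + ((2 : ℕ) : Polynomial ℕ),
      fun X cnt t hc ht => ?_⟩
    have := hP X cnt t hc ht
    simp only [Polynomial.eval_add, Polynomial.eval_mul, Polynomial.eval_natCast, Nat.cast_id,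
      nestSteps]
    exact Nat.add_le_add_right (Nat.mul_le_mul hc (by omega)) 2

theorem exists_polynomial_mainSteps (d K : ℕ) :
    ∃ P : Polynomial ℕ, ∀ m n k, mainSteps d n k K ≤ P.eval (m + n + k) := by
  let X : Polynomial ℕ := Polynomial.X
  let D : Polynomial ℕ := (d : Polynomial ℕ)
  obtain ⟨P, hP⟩ := exists_polynomial_nestSteps d (2 * (X + D))
    ((D * (X * 9 + 11) + 7 * X + 7 * D + 29) + (X * (D * 9 + 11) + 4) + 6 + (K : Polynomial ℕ)) d
  refine ⟨((X * 7 + 9) + P + (X * (D * (X * 9 + 11) + 7 * X + 7 * D + 34) + 2)) +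
    (X * (D * (X * 9 + 11) + 8) + D * 5 + (X + D) * D * 7 + 19), fun m n k => ?_⟩
  have hn : n ≤ m + n + k := by omega
  have hk : k ≤ m + n + k := by omega
  have := hP (m + n + k) (2 * (k + d)) ((d * (n * 9 + 11) + 7 * n + 7 * d + 29) +
    (n * (d * 9 + 11) + 4) + 6 + K)
    (by
      simp only [X, D, Polynomial.eval_add, Polynomial.eval_mul, Polynomial.eval_X,
        Polynomial.eval_natCast, Polynomial.eval_ofNat, Nat.cast_id]
      gcongr)
    (by
      simp only [X, D, Polynomial.eval_add, Polynomial.eval_mul, Polynomial.eval_X,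
        Polynomial.eval_natCast, Polynomial.eval_ofNat, Nat.cast_id]
      gcongr)
  simp only [X, D, Polynomial.eval_add, Polynomial.eval_mul, Polynomial.eval_X,
    Polynomial.eval_natCast, Polynomial.eval_ofNat, Nat.cast_id, mainSteps]
  gcongr

theorem bitSize_le_sum {l n : ℕ} (N : Fin l → Fin n → ℤ) (i : Fin l) (j : Fin n) :
    bitSize (N i j) ≤ ∑ i, ∑ j, bitSize (N i j) :=
  (Finset.single_le_sum (f := fun j => bitSize (N i j)) (fun _ _ => Nat.zero_le _)
    (Finset.mem_univ j)).trans
    (Finset.single_le_sum (f := fun i => ∑ j, bitSize (N i j)) (fun _ _ => Nat.zero_le _)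
      (Finset.mem_univ i))

theorem mul_le_sum_bitSize {l n : ℕ} (N : Fin l → Fin n → ℤ) :
    l * n ≤ ∑ i, ∑ j, bitSize (N i j) := by
  calc l * n = ∑ _i : Fin l, ∑ _j : Fin n, 1 := by simp
    _ ≤ _ := Finset.sum_le_sum fun i _ => Finset.sum_le_sum fun j _ => one_le_bitSize _

theorem exists_solvingProgram (d : ℕ) (hd : 0 < d) :
    ∃ (p : Cmd) (T S : Polynomial ℕ),
      ∀ (m n k : ℕ) (_ : 0 < n) (W : Matrix (Fin d) (Fin n) ℤ) (A : Matrix (Fin m) (Fin n) ℤ)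
        (b : Fin m → ℤ) (E : Fin k → Fin n → ℤ) (c : (Fin d → ℝ) → ℝ)
        (O : Oracles d n),
        ConvexOn ℝ Set.univ c →
        CoversEdgeDirections (Set.range E) (integerHull A b) →
        IsLinearOracle A b O.lin →
        IsComparisonOracle c O.cmp →
        ∃ (τ : State) (u : Usage),
          Exec O p (initialState W A b E) τ u ∧
          Solves W A b c τ ∧
          u.steps ≤ T.eval (m + n + k) ∧
          u.querySize ≤ S.eval (inputSize W A b E) ∧
          u.numSize ≤ S.eval (inputSize W A b E + u.replySize) ∧
          (Bornology.IsBounded (polyhedron A b) →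
            u.numSize ≤ S.eval (inputSize W A b E)) := by
  obtain ⟨K, q, hq, hqa, hqr⟩ := exists_normalProg d
  obtain ⟨T, hT⟩ := exists_polynomial_mainSteps d K
  -- The linear part is `M` plus one further multiple of `X`; at `X + R` this extra term absorbs
  -- `R`. The quadratic part, with the extra `X`, bounds the replies for a bounded polyhedron.
  obtain ⟨S, hS⟩ : ∃ S : Polynomial ℕ, ∀ X, S.eval X =
      (10 + 3 * K + 2 * d) * X + (3 * K + 3 * (d * d) + 5 * d + 6) + (2 * (X * X) + 2) :=
    ⟨((10 + 3 * K + 2 * d : ℕ) : Polynomial ℕ) * Polynomial.X +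
      ((3 * K + 3 * (d * d) + 5 * d + 6 : ℕ) : Polynomial ℕ) +
      (2 * (Polynomial.X * Polynomial.X) + 2), fun X => by
      simp only [Polynomial.eval_add, Polynomial.eval_mul, Polynomial.eval_X,
        Polynomial.eval_natCast, Polynomial.eval_ofNat, Nat.cast_id]⟩
  refine ⟨mainProg d q, T, S, fun m n k hn W A b E c O hc hE hlin hcmp => ?_⟩
  set X := inputSize W A b E with hX
  have hXdef : X = (∑ i, ∑ j, bitSize (W i j)) + (∑ i, ∑ j, bitSize (A i j)) +
    (∑ i, bitSize (b i)) + ∑ i, ∑ j, bitSize (E i j) := rfl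
  have hW : ∀ i j, bitSize (W i j) ≤ X := fun i j => (bitSize_le_sum W i j).trans (by omega)
  have hA : ∀ i j, bitSize (A i j) ≤ X := fun i j => (bitSize_le_sum A i j).trans (by omega)
  have hE' : ∀ i j, bitSize (E i j) ≤ X := fun i j => (bitSize_le_sum E i j).trans (by omega)
  have hb : ∀ i, bitSize (b i) ≤ X := fun i =>
    (Finset.single_le_sum (f := fun i => bitSize (b i)) (fun _ _ => Nat.zero_le _)
      (Finset.mem_univ i)).trans (by omega)
  -- Every entry has at least a sign bit, so `X` is at least the number of entries. As `d` and `n`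
  -- are positive, `n` and `k` are also at most `X`.
  have hdnX : d * n ≤ X := (mul_le_sum_bitSize W).trans (by omega)
  have hknX : k * n ≤ X := (mul_le_sum_bitSize E).trans (by omega)
  have hnX : n ≤ X := (Nat.le_mul_of_pos_left n hd).trans hdnX
  have hkX : k ≤ X := (Nat.le_mul_of_pos_right k hn).trans hknX
  -- A common bound for all size requirements of the program, linear in `X` since `d` and `K` are
  -- constants.
  set M := (9 + 3 * K + 2 * d) * X + (3 * K + 3 * (d * d) + 5 * d + 6) with hM
  have hMexp : M = 9 * X + 3 * (K * X) + 2 * (d * X) + (3 * K + 3 * (d * d) + 5 * d + 6) := by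
    rw [hM]; ring
  have hKb : K * ((2 * X + n + 2) + 1) ≤ 3 * (K * X) + 3 * K := by
    calc K * ((2 * X + n + 2) + 1) ≤ K * ((2 * X + X + 2) + 1) := by gcongr
      _ = 3 * (K * X) + 3 * K := by ring
  have hkd : (k + d) * d ≤ d * X + d * d := by
    calc (k + d) * d ≤ (X + d) * d := by gcongr
      _ = d * X + d * d := by ring
  obtain ⟨τ, u, he, h1, h2, h3, h4⟩ := runs_mainProg (M := M) (r := 0) (c := c) (E := E) (L := X)
    hq hqa (fun σ r B hB hβ => hqr n O M σ r _ B hB hβ (by omega) (by omega)) hcmp hlin hW hE'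
    (by omega) (by omega) hd
    (fun hu hf y hy => exists_optimal_query hc hE hlin hu hf y hy)
  rw [Nat.zero_max] at h3
  have hMX : M ≤ S.eval X := by
    rw [hS, hM]
    have : (9 + 3 * K + 2 * d) * X ≤ (10 + 3 * K + 2 * d) * X := by gcongr; omega
    omega
  refine ⟨τ, u, he, h4, h1.trans (hT m n k), h2.trans hMX, h3.trans ?_, fun hbd => h3.trans ?_⟩
  · rw [hS, hM]
    have : (10 + 3 * K + 2 * d) * (X + u.replySize) =
        (9 + 3 * K + 2 * d) * X + X + u.replySize + (9 + 3 * K + 2 * d) * u.replySize := by ring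
    omega
  · have hR : u.replySize ≤ X * X + X * X + 2 := he.replySize_le fun g x hx => by
      have := hlin g
      rw [hx] at this
      calc vecSize (fun j => (x j : ℤ)) ≤ n * n + n * X + 2 :=
            vecSize_le_of_isBounded hA hb hbd this.1
        _ ≤ X * X + X * X + 2 := by gcongr
    have : (10 + 3 * K + 2 * d) * X = (9 + 3 * K + 2 * d) * X + X := by ring
    rw [hS, hM]
    omega

end ConvIntMax

/-- For every fixed `d` one program, with bounds `T` and `S` that depend on `d` only, solves all
convex integer programs given by `W`, `A`, `b`, the vectors `E` and the two oracles. -/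
theorem lemma1p1 (d : ℕ) (hd : 0 < d) :
    ∃ (p : ConvIntMax.Cmd) (T S : Polynomial ℕ),
      ∀ (m n k : ℕ) (_ : 0 < n) (W : Matrix (Fin d) (Fin n) ℤ) (A : Matrix (Fin m) (Fin n) ℤ)
        (b : Fin m → ℤ) (E : Fin k → Fin n → ℤ) (c : (Fin d → ℝ) → ℝ)
        (O : ConvIntMax.Oracles d n),
        ConvexOn ℝ Set.univ c →
        ConvIntMax.CoversEdgeDirections (Set.range E) (ConvIntMax.integerHull A b) →
        ConvIntMax.IsLinearOracle A b O.lin →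
        ConvIntMax.IsComparisonOracle c O.cmp →
        ∃ (τ : ConvIntMax.State) (u : ConvIntMax.Usage),
          ConvIntMax.Exec O p (ConvIntMax.initialState W A b E) τ u ∧
          ConvIntMax.Solves W A b c τ ∧
          u.steps ≤ T.eval (m + n + k) ∧
          u.querySize ≤ S.eval (ConvIntMax.inputSize W A b E) ∧
          u.numSize ≤ S.eval (ConvIntMax.inputSize W A b E + u.replySize) ∧
          (Bornology.IsBounded (ConvIntMax.polyhedron A b) →
            u.numSize ≤ S.eval (ConvIntMax.inputSize W A b E)) :=
  ConvIntMax.exists_solvingProgram d hd
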